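/- Let $N\ge1$. A \emph{random Laplacian-type matrix} with sparsity parameter $q$ is a random real symmetric $(N+1)\times(N+1)$ matrix $H$ whose off-diagonal entries $H_{ij}=h_{ij}=h_{ji}$ ($i\neq j$) are such that $(h_{ij})_{i<j}$ are independent with mean zero and variance $1/N$, whose diagonal entries are $H_{ii}=-\sum_{j\ne i}h_{ij}$, and such that $$\mathbb E|h_{ij}|^p\le \frac{c_p}{q^{p-2}N}\quad (p\in\mathbb{N},\ p\ge 3,\ i\neq j),\qquad N^{\beta}\le q\le N^{1/2},$$ where $\beta>0$ and the constants $c_p$ do not depend on $N$. The matrix $H$ always has the eigenvalue $0$ with eigenvector $(1,\dots,1)^*$; let $\lambda_1(H)\le\dots\le\lambda_N(H)$ denote the remaining $N$ eigenvalues, i.e. all eigenvalues counted with multiplicity after one copy of $0$ is removed. Let $\rho_G(x)=(2\pi)^{-1/2}e^{-x^2/2}$ and let $m_{\mathrm{fc}}$ be the unique function on the upper half-plane with $$m_{\mathrm{fc}}(z)=\int_{\mathbb R}\frac{\rho_G(x)}{x-z-m_{\mathrm{fc}}(z)}\,dx,\qquad \operatorname{Im} m_{\mathrm{fc}}(z)\ge0,\qquad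 m_{\mathrm{fc}}(z)\sim -z^{-1}\ \text{ as } z\to\infty,$$ which is the Stieltjes transform of the free convolution of the semicircle law and the standard Gaussian law. Let $\rho_{\mathrm{fc}}(E)=\lim_{\eta\downarrow0}\frac1\pi\operatorname{Im}m_{\mathrm{fc}}(E+\mathrm i\eta)$ be its density, and define the classical locations $\gamma_i=\gamma_i^{(N)}$ by $\int_{-\infty}^{\gamma_i}\rho_{\mathrm{fc}}(x)\,dx=\frac{i-1/2}{N}$. \textbf{Rigidity of eigenvalues.} Fix $\beta>0$, constants $(c_p)_{p\ge3}$ and $\kappa>0$. There is a constant $C>0$ such that for every $\nu>0$ and every $D>0$ there is $N_0$ such that for all $N\ge N_0$ and every $(N+1)\times(N+1)$ random Laplacian-type matrix $H$ with parameters $\beta$, $(c_p)$ and sparsity parameter $q$, with $\xi:=N^{\nu}$, $$\mathbb P\Big[\,|\lambda_i(H)-\gamma_i|\le \frac{C\xi^2}{q}\ \text{ for all integers } i \text{ with } \kappa N\le i\le(1-\kappa)N\Big]\ \ge\ 1-N^{-D}.$$ -/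

import Mathlib

open MeasureTheory ProbabilityTheory Filter Topology

noncomputable section

namespace LaplacianRigidity

/-- `H` is a random Laplacian-type matrix of size `(N+1) × (N+1)`, defined on the probability space
`(Ω, μ)`, with sparsity parameter `q` satisfying `N ^ β ≤ q ≤ N ^ (1/2)` and with moment
constants `c p`, `p ≥ 3`. -/
structure IsRandomLaplacianType {Ω : Type*} [MeasurableSpace Ω] (μ : Measure Ω) (N : ℕ)
    (β q : ℝ) (c : ℕ → ℝ) (H : Ω → Matrix (Fin (N + 1)) (Fin (N + 1)) ℝ) : Prop where
  measurable : ∀ i j, Measurable fun ω => H ω i j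
  symm : ∀ ω i j, H ω i j = H ω j i
  diag : ∀ ω i, H ω i i = -∑ j ∈ Finset.univ.erase i, H ω i j
  /-- The entries above the diagonal are independent. -/
  indep : iIndepFun
    (fun (e : {e : Fin (N + 1) × Fin (N + 1) // e.1 < e.2}) ω => H ω e.1.1 e.1.2) μ
  mean : ∀ i j, i ≠ j → ∫ ω, H ω i j ∂μ = 0
  variance : ∀ i j, i ≠ j → variance (fun ω => H ω i j) μ = 1 / N
  moment : ∀ p : ℕ, 3 ≤ p → ∀ i j, i ≠ j →
    Integrable (fun ω => |H ω i j| ^ p) μ ∧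
      ∫ ω, |H ω i j| ^ p ∂μ ≤ c p / (q ^ (p - 2) * N)
  le_sparsity : (N : ℝ) ^ β ≤ q
  sparsity_le : q ≤ (N : ℝ) ^ (1 / 2 : ℝ)

/-- `nontrivialEigenvalue A i` is the `i`-th smallest (`i = 1, …, N`) among the eigenvalues of `A`,
counted with multiplicity, after one copy of the eigenvalue `0` has been removed. The value for
`i` outside `1, …, N` is irrelevant. -/
def nontrivialEigenvalue {N : ℕ} (A : Matrix (Fin (N + 1)) (Fin (N + 1)) ℝ) (i : ℕ) : ℝ :=
  ((A.charpoly.roots.erase 0).sort (· ≤ ·)).getD (i - 1) 0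

/-- `m` is, on the upper half-plane, the Stieltjes transform of the free convolution of the
semicircle law and the standard Gaussian law: it solves the self-consistent equation there, has
nonnegative imaginary part, and `m z ∼ -1 / z` as `z → ∞` in the upper half-plane. These
conditions determine `m` on the upper half-plane. -/
structure IsFreeConvolutionStieltjes (m : ℂ → ℂ) : Prop where
  self_consistent : ∀ z : ℂ, 0 < z.im →
    m z = ∫ x : ℝ, (gaussianPDFReal 0 1 x : ℂ) / ((x : ℂ) - z - m z)
  im_nonneg : ∀ z : ℂ, 0 < z.im → 0 ≤ (m z).im
  asymptotic : Tendsto (fun z => z * m z) (comap norm atTop ⊓ 𝓟 {z : ℂ | 0 < z.im}) (𝓝 (-1))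

/-- The Stieltjes transform of the free convolution. -/
def mfc : ℂ → ℂ := Classical.epsilon IsFreeConvolutionStieltjes

/-- The density of the free convolution, by Stieltjes inversion. -/
def rhofc (E : ℝ) : ℝ :=
  limUnder (𝓝[>] (0 : ℝ)) fun η : ℝ => 1 / Real.pi * (mfc ((E : ℂ) + Complex.I * (η : ℂ))).im

/-- The `i`-th classical location, the solution `γ` of
`∫_{-∞}^γ ρ_fc(x) dx = (i - 1/2) / N`. -/
def classicalLocation (N i : ℕ) : ℝ :=
  Classical.epsilon fun γ : ℝ => ∫ x in Set.Iic γ, rhofc x = ((i : ℝ) - 1 / 2) / N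

end LaplacianRigidity

end

/-! The proof is a local law for the resolvent followed by integration of the Stieltjes transform
along vertical lines. Write η = Im z, m for the normalized trace of (H - z)⁻¹, m_G for the Stieltjes
transform of the standard Gaussian, and λ = N^α for a small α.

Self-consistent equation. By Schur's complement G_ii is the inverse of H_ii - z - ⟨h, G⁽ⁱ⁾h⟩, where
h is row i. The minor is not independent of h, because its diagonal contains the entries of h.
Adding diag(h) to it gives the Laplacian of the graph without vertex i, which is independent of h.
The perturbation has norm at most λ/q, and the Ward identity makes its effect small relative to Im m
(`form_resolvent_perturb`, `trace_resolvent_perturb`). Moment bounds for martingale sums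
(`martingale_moment`) yield large deviations for quadratic forms. Hence m(z) is close to the average
of 1/(H_ii - z - m).

The diagonal. The H_ii are dependent row sums. As 1/(x - w) is a half-line Fourier integral, it
suffices to control averages of exp(-itH_ii). A Lindeberg replacement of entries by Gaussian
factors, exposed edge by edge, leaves a martingale and a cubic remainder, both of order λ/q
(`tail_expInt`). So the average is close to m_G(z + m).

Stability. The limit satisfies m_fc(z) = m_G(z + m_fc(z)), that is, w = z + m_fc inverts F(w) = w -
m_G(w). Where Im F ≥ 0, equality in a Cauchy–Schwarz argument is impossible, so F is injective there
with nonzero derivative (`integral_one_div_mul_ne_one`), and a connectedness argument gives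
surjectivity up to the real line (`exists_subordination`). The limiting density is positive
everywhere, so there is no edge, and stability is uniform over |Re z| ≤ K. Descending from large η
on a fine vertical grid, `norm_stieltjes_sub_freeStieltjes_le` improves a rough bound to order
λ²/(qη) as long as η ≥ λ³/q.

From transforms to eigenvalues. An explicit potential with derivative -m_fc gives the limiting
distribution function. Integrating Re(m - m_fc) over η bounds an arctan-smoothed counting function,
and a dyadic sum of Im m removes the smoothing (`abs_eigCdf_sub_freeCdf_le`). The counting error is
of order λ³ log N / q. Applied at γ_i ± N^{2ν}/q, where the density is bounded below, it traps the
i-th eigenvalue. The removed zero and the passage from N + 1 to N cost O(1/N), which is at most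
O(1/q). -/

noncomputable section
namespace LaplacianRigidity

/-! ### Moment bounds for sums with predictable coefficients. -/

section Moments

variable {Ω : Type*} [MeasurableSpace Ω] {μ : Measure Ω}

/-- All moments of `f` are finite. -/
def AllMoments (f : Ω → ℝ) (μ : Measure Ω) : Prop := ∀ p : ℕ, MemLp f p μ

lemma AllMoments.sub {f g : Ω → ℝ} (hf : AllMoments f μ) (hg : AllMoments g μ) :
    AllMoments (fun ω => f ω - g ω) μ := fun p => (hf p).sub (hg p)

lemma AllMoments.mul {f g : Ω → ℝ} (hf : AllMoments f μ) (hg : AllMoments g μ) :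
    AllMoments (fun ω => f ω * g ω) μ := by
  intro p
  have : ENNReal.HolderTriple ((2 * p : ℕ) : ENNReal) ((2 * p : ℕ) : ENNReal) (p : ENNReal) := by
    constructor
    push_cast
    rw [ENNReal.mul_inv (by simp) (by simp), ← add_mul, ENNReal.inv_two_add_inv_two, one_mul]
  exact (hg (2 * p)).mul' (hf (2 * p))

lemma allMoments_of_bound [IsFiniteMeasure μ] {f : Ω → ℝ} (hf : Measurable f) (C : ℝ)
    (h : ∀ ω, |f ω| ≤ C) : AllMoments f μ := fun _ =>
  MemLp.of_bound hf.aestronglyMeasurable C (ae_of_all _ h)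

lemma AllMoments.pow [IsFiniteMeasure μ] {f : Ω → ℝ} (hf : AllMoments f μ) (n : ℕ) :
    AllMoments (fun ω => f ω ^ n) μ := by
  induction n with
  | zero => simpa using allMoments_of_bound (μ := μ) (f := fun _ => (1 : ℝ)) measurable_const 1 (by simp)
  | succ n ih => simpa only [pow_succ] using ih.mul hf

lemma AllMoments.abs {f : Ω → ℝ} (hf : AllMoments f μ) : AllMoments (fun ω => |f ω|) μ :=
  fun p => (hf p).norm

lemma AllMoments.integrable {f : Ω → ℝ} (hf : AllMoments f μ) : Integrable f μ :=
  memLp_one_iff_integrable.1 (by simpa using hf 1)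

lemma AllMoments.sum {ι : Type*} (s : Finset ι) {f : ι → Ω → ℝ} (hf : ∀ i ∈ s, AllMoments (f i) μ) :
    AllMoments (fun ω => ∑ i ∈ s, f i ω) μ := fun p => memLp_finsetSum s fun i hi => hf i hi p

lemma allMoments_of_integrable_pow [IsFiniteMeasure μ] {f : Ω → ℝ} (hf : Measurable f)
    (h : ∀ p : ℕ, 3 ≤ p → Integrable (fun ω => |f ω| ^ p) μ) : AllMoments f μ := by
  intro p
  have h3 : MemLp f ((p + 3 : ℕ) : ENNReal) μ := by
    rw [← integrable_norm_rpow_iff hf.aestronglyMeasurable (by simp) (by simp)]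
    simpa [ENNReal.toReal_natCast, -Nat.cast_add, Real.rpow_natCast] using h (p + 3) (by omega)
  exact h3.mono_exponent (by exact_mod_cast (by omega : p ≤ p + 3))

lemma pow_mul_pow_le_add {x y : ℝ} (hx : 0 ≤ x) (hy : 0 ≤ y) (i j : ℕ) :
    x ^ i * y ^ j ≤ x ^ (i + j) + y ^ (i + j) := by
  rcases le_total x y with h | h
  · calc x ^ i * y ^ j ≤ y ^ i * y ^ j := by gcongr
      _ = y ^ (i + j) := (pow_add _ _ _).symm
      _ ≤ _ := le_add_of_nonneg_left (by positivity)
  · calc x ^ i * y ^ j ≤ x ^ i * x ^ j := by gcongr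
      _ = x ^ (i + j) := (pow_add _ _ _).symm
      _ ≤ _ := le_add_of_nonneg_right (by positivity)

/-- One step of the moment recursion for a sum with martingale differences. -/
lemma moment_step [IsProbabilityMeasure μ] {S Y ζ : Ω → ℝ} (hS : AllMoments S μ)
    (hY : Measurable Y) (hζ : AllMoments ζ μ)
    {α b s : ℝ} (hα : 0 ≤ α) (hb : 0 ≤ b) (hs : 0 ≤ s) (hYα : ∀ ω, |Y ω| ≤ α)
    (hind : IndepFun (fun ω => (S ω, Y ω)) ζ μ) (hmean : ∫ ω, ζ ω ∂μ = 0)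
    {m : ℕ → ℝ} (hm : ∀ r, 0 ≤ m r)
    (hmom : ∀ r, 2 ≤ r → ∫ ω, |ζ ω| ^ r ∂μ ≤ m r * b ^ (r - 2) * s) (p : ℕ) :
    ∫ ω, (S ω + Y ω * ζ ω) ^ (2 * p + 2) ∂μ ≤ ∫ ω, S ω ^ (2 * p + 2) ∂μ +
      (∑ r ∈ Finset.range (2 * p + 2), ((2 * p + 2).choose (r + 1) : ℝ) * m (r + 1)) *
        ((s * α ^ 2) * (∫ ω, S ω ^ (2 * p) ∂μ + (b * α) ^ (2 * p))) := by
  have hYA : AllMoments Y μ := allMoments_of_bound hY α hYα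
  set n := 2 * p + 2 with hn
  have hexp : ∀ ω, (S ω + Y ω * ζ ω) ^ n =
      ∑ r ∈ Finset.range (n + 1), (S ω ^ (n - r) * Y ω ^ r) * ζ ω ^ r * (n.choose r : ℝ) := by
    intro ω
    rw [add_comm, add_pow]
    refine Finset.sum_congr rfl fun r _ => ?_
    rw [mul_pow]; ring
  have hA : ∀ r, AllMoments (fun ω => S ω ^ (n - r) * Y ω ^ r) μ := fun r =>
    (hS.pow _).mul (hYA.pow _)
  have hint : ∀ r, ∫ ω, (S ω ^ (n - r) * Y ω ^ r) * ζ ω ^ r * (n.choose r : ℝ) ∂μ =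
      (∫ ω, S ω ^ (n - r) * Y ω ^ r ∂μ) * (∫ ω, ζ ω ^ r ∂μ) * (n.choose r : ℝ) := by
    intro r
    rw [integral_mul_const]
    congr 1
    have := (hind.comp (φ := fun x : ℝ × ℝ => x.1 ^ (n - r) * x.2 ^ r) (ψ := fun x : ℝ => x ^ r)
      (by fun_prop) (by fun_prop))
    exact this.integral_fun_mul_eq_mul_integral (hA r).integrable.aestronglyMeasurable
      (hζ.pow r).integrable.aestronglyMeasurable
  have hE0 : 0 ≤ ∫ ω, S ω ^ (2 * p) ∂μ := integral_nonneg fun ω => by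
    rw [pow_mul]; positivity
  simp_rw [hexp]
  rw [integral_finsetSum _ fun r _ => (((hA r).mul (hζ.pow r)).integrable.mul_const _),
    Finset.sum_range_succ']
  simp_rw [hint]
  rw [add_comm]
  gcongr ?_ + ?_
  · simp
  rw [Finset.sum_mul]
  refine Finset.sum_le_sum fun r hr => ?_
  have hr' : r < n := Finset.mem_range.1 hr
  -- The index is shifted by one, so r = 0 is the term linear in ζ. It vanishes by centring, and
  -- every remaining term carries at least two factors ζ.
  rcases Nat.eq_zero_or_pos r with rfl | hr0
  · simp only [zero_add, pow_one, hmean, mul_zero, zero_mul]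
    have := hm 1
    positivity
  have h1 : |∫ ω, ζ ω ^ (r + 1) ∂μ| ≤ m (r + 1) * b ^ (r - 1) * s := by
    refine (abs_integral_le_integral_abs).trans ?_
    simp_rw [abs_pow]
    exact hmom (r + 1) (by omega)
  have h2 : |∫ ω, S ω ^ (n - (r + 1)) * Y ω ^ (r + 1) ∂μ| ≤
      α ^ (r + 1) * ∫ ω, |S ω| ^ (n - (r + 1)) ∂μ := by
    refine (abs_integral_le_integral_abs).trans ?_
    rw [← integral_const_mul]
    refine integral_mono (hA _).abs.integrable ((hS.abs.pow _).integrable.const_mul _) fun ω => ?_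
    simp only [abs_mul, abs_pow]
    rw [mul_comm]
    gcongr
    exact hYα ω
  -- Once s α² is taken out, the exponents r - 1 and n - (r + 1) add up to 2p, so each mixed term is
  -- dominated by the two pure powers.
  have h3 : (b * α) ^ (r - 1) * ∫ ω, |S ω| ^ (n - (r + 1)) ∂μ ≤
      ∫ ω, S ω ^ (2 * p) ∂μ + (b * α) ^ (2 * p) := by
    rw [← integral_const_mul]
    have : ∫ ω, S ω ^ (2 * p) ∂μ + (b * α) ^ (2 * p) =
        ∫ ω, (S ω ^ (2 * p) + (b * α) ^ (2 * p)) ∂μ := by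
      rw [integral_add (hS.pow _).integrable (integrable_const _)]; simp
    rw [this]
    refine integral_mono ((hS.abs.pow _).integrable.const_mul _)
      ((hS.pow _).integrable.add (integrable_const _)) fun ω => ?_
    have := pow_mul_pow_le_add (mul_nonneg hb hα) (abs_nonneg (S ω)) (r - 1) (n - (r + 1))
    rw [show r - 1 + (n - (r + 1)) = 2 * p by omega, (even_two_mul p).pow_abs] at this
    simp only
    linarith
  calc (∫ ω, S ω ^ (n - (r + 1)) * Y ω ^ (r + 1) ∂μ) * (∫ ω, ζ ω ^ (r + 1) ∂μ) *
        (n.choose (r + 1) : ℝ)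
      ≤ (α ^ (r + 1) * ∫ ω, |S ω| ^ (n - (r + 1)) ∂μ) * (m (r + 1) * b ^ (r - 1) * s) *
        (n.choose (r + 1) : ℝ) := by
        refine mul_le_mul_of_nonneg_right ?_ (by positivity)
        refine (le_abs_self _).trans ?_
        rw [abs_mul]
        exact mul_le_mul h2 h1 (abs_nonneg _) ((abs_nonneg _).trans h2)
    _ = ((n.choose (r + 1) : ℝ) * m (r + 1)) * ((s * α ^ 2) *
        ((b * α) ^ (r - 1) * ∫ ω, |S ω| ^ (n - (r + 1)) ∂μ)) := by
        obtain ⟨k, rfl⟩ : ∃ k, r = k + 1 := ⟨r - 1, by omega⟩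
        simp only [Nat.add_sub_cancel, mul_pow]
        ring
    _ ≤ _ := by
        have := hm (r + 1)
        gcongr

/-- The constant in the moment bound for sums with martingale differences. -/
def momentConst (m : ℕ → ℝ) : ℕ → ℝ
  | 0 => 1
  | p + 1 => (∑ r ∈ Finset.range (2 * p + 2), ((2 * p + 2).choose (r + 1) : ℝ) * m (r + 1)) *
      (momentConst m p + 1)

lemma momentConst_nonneg {m : ℕ → ℝ} (hm : ∀ r, 0 ≤ m r) (p : ℕ) : 0 ≤ momentConst m p := by
  induction p with
  | zero => simp [momentConst]
  | succ p ih =>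
    rw [momentConst]
    have : ∀ r, 0 ≤ m (r + 1) := fun r => hm _
    exact mul_nonneg (Finset.sum_nonneg fun r _ => mul_nonneg (by positivity) (this r)) (by linarith)

/-- The σ-algebra generated by the variables with index below `a`. -/
@[reducible] def past {ι : Type*} [LinearOrder ι] (X : ι → Ω → ℝ) (a : ι) : MeasurableSpace Ω :=
  ⨆ b : {b // b < a}, MeasurableSpace.comap (X b) inferInstance

lemma measurable_past {ι : Type*} [LinearOrder ι] (X : ι → Ω → ℝ) {a b : ι} (h : b < a) :
    Measurable[past X a] (X b) := by
  have : MeasurableSpace.comap (X b) inferInstance ≤ past X a :=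
    le_iSup (fun b : {b // b < a} => MeasurableSpace.comap (X b) inferInstance) ⟨b, h⟩
  exact (Measurable.of_comap_le this)

lemma past_mono {ι : Type*} [LinearOrder ι] (X : ι → Ω → ℝ) {a b : ι} (h : b ≤ a) :
    past X b ≤ past X a :=
  iSup_le fun c => (measurable_past X (c.2.trans_le h)).comap_le

lemma past_le {ι : Type*} [LinearOrder ι] {X : ι → Ω → ℝ} (hX : ∀ i, Measurable (X i)) (a : ι) :
    past X a ≤ ‹MeasurableSpace Ω› :=
  iSup_le fun c => (hX c).comap_le

/-- The index sets {b < a} and {a} are disjoint, so their σ-algebras are independent. -/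
lemma indepFun_past {ι : Type*} [LinearOrder ι] {X : ι → Ω → ℝ} (hX : ∀ i, Measurable (X i))
    (hind : iIndepFun X μ) (a : ι) {β : Type*} [MeasurableSpace β] {U : Ω → β}
    (hU : Measurable[past X a] U) : IndepFun U (X a) μ := by
  have h := indep_iSup_of_disjoint (fun i => (hX i).comap_le) hind
    (S := {b | b < a}) (T := {a}) (by simp)
  rw [IndepFun_iff_Indep]
  refine indep_of_indep_of_le_left (indep_of_indep_of_le_right h ?_) ?_
  · simp
  · refine hU.comap_le.trans ?_
    exact iSup_le fun b => le_iSup₂ (f := fun i (_ : i ∈ {b | b < a}) =>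
      MeasurableSpace.comap (X i) inferInstance) b.1 b.2

/-- Moment bound for `∑ Y_a φ(X_a)` with `Y_a` depending on the earlier `X` only. -/
theorem martingale_moment [IsProbabilityMeasure μ] {ι : Type*} [LinearOrder ι] {X : ι → Ω → ℝ}
    (hX : ∀ i, Measurable (X i)) (hind : iIndepFun X μ) {φ : ℝ → ℝ}
    (hφ : Measurable φ) (hmomA : ∀ i, AllMoments (fun ω => φ (X i ω)) μ)
    (hmean : ∀ i, ∫ ω, φ (X i ω) ∂μ = 0) {b s B : ℝ} (hb : 0 ≤ b) (hs : 0 ≤ s)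
    {m : ℕ → ℝ} (hm : ∀ r, 0 ≤ m r)
    (hmom : ∀ i r, 2 ≤ r → ∫ ω, |φ (X i ω)| ^ r ∂μ ≤ m r * b ^ (r - 2) * s)
    {Y : ι → Ω → ℝ} (hY : ∀ i, Measurable[past X i] (Y i)) {α : ι → ℝ}
    (hα : ∀ i, 0 ≤ α i) (hYα : ∀ i ω, |Y i ω| ≤ α i) (hB : ∀ i, b * α i ≤ B) (p : ℕ)
    (t : Finset ι) :
    ∫ ω, (∑ i ∈ t, Y i ω * φ (X i ω)) ^ (2 * p) ∂μ ≤
      momentConst m p * (s * ∑ i ∈ t, α i ^ 2 + B ^ 2) ^ p := by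
  have hYm : ∀ i, Measurable (Y i) := fun i => (hY i).mono (past_le hX i) le_rfl
  have hYA : ∀ i, AllMoments (Y i) μ := fun i => allMoments_of_bound (hYm i) (α i) (hYα i)
  have hSA : ∀ t : Finset ι, AllMoments (fun ω => ∑ i ∈ t, Y i ω * φ (X i ω)) μ := fun t =>
    AllMoments.sum t fun i _ => (hYA i).mul (hmomA i)
  have hV : ∀ t : Finset ι, 0 ≤ ∑ i ∈ t, α i ^ 2 := fun t => Finset.sum_nonneg fun i _ => sq_nonneg _
  induction p generalizing t with
  | zero => simp [momentConst]
  | succ p ih =>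
    -- The inner induction adds the largest index last, which makes the sum over the others
    -- measurable with respect to its past. The outer induction bounds the 2p-th moment of every
    -- subsum. Keeping the full t in the power lets the increments add up linearly in α².
    have key : ∀ t' : Finset ι, t' ⊆ t → ∫ ω, (∑ i ∈ t', Y i ω * φ (X i ω)) ^ (2 * p + 2) ∂μ ≤
        momentConst m (p + 1) * ((s * ∑ i ∈ t', α i ^ 2) *
          (s * ∑ i ∈ t, α i ^ 2 + B ^ 2) ^ p) := by
      intro t'
      induction t' using Finset.induction_on_max with
      | empty => intro _; simp
      | insert a t' hlt iht =>
        intro hsub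
        have hat : a ∉ t' := fun h => (hlt a h).false
        have hsub' : t' ⊆ t := (Finset.subset_insert a t').trans hsub
        have hSp : Measurable[past X a] (fun ω => ∑ i ∈ t', Y i ω * φ (X i ω)) := by
          refine Finset.measurable_fun_sum (m := past X a) t' fun i hi => ?_
          exact ((hY i).mono (past_mono X (hlt i hi).le) le_rfl).mul
            (hφ.comp (measurable_past X (hlt i hi)))
        have hpair : Measurable[past X a]
            (fun ω => (∑ i ∈ t', Y i ω * φ (X i ω), Y a ω)) := hSp.prodMk (hY a)
        have hI := (indepFun_past hX hind a hpair).comp measurable_id hφ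
        have hst := moment_step (hSA t') (hYm a) (hmomA a) (hα a) hb hs (hYα a) hI (hmean a) hm (hmom a) p
        simp_rw [Finset.sum_insert hat, add_comm (Y a _ * φ (X a _))]
        refine hst.trans ?_
        have hC : 0 ≤ ∑ r ∈ Finset.range (2 * p + 2),
            ((2 * p + 2).choose (r + 1) : ℝ) * m (r + 1) :=
          Finset.sum_nonneg fun r _ => mul_nonneg (by positivity) (hm _)
        have hW : 0 ≤ s * ∑ i ∈ t, α i ^ 2 := mul_nonneg hs (hV t)
        have h1 : ∫ ω, (∑ i ∈ t', Y i ω * φ (X i ω)) ^ (2 * p) ∂μ + (b * α a) ^ (2 * p) ≤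
            (momentConst m p + 1) * (s * ∑ i ∈ t, α i ^ 2 + B ^ 2) ^ p := by
          rw [add_mul, one_mul]
          refine add_le_add ((ih t').trans ?_) ?_
          · refine mul_le_mul_of_nonneg_left ?_ (momentConst_nonneg hm p)
            have : ∑ i ∈ t', α i ^ 2 ≤ ∑ i ∈ t, α i ^ 2 :=
              Finset.sum_le_sum_of_subset_of_nonneg hsub' fun i _ _ => sq_nonneg _
            have := hV t'
            gcongr
          · rw [pow_mul]
            have : (b * α a) ^ 2 ≤ B ^ 2 := pow_le_pow_left₀ (mul_nonneg hb (hα a)) (hB a) 2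
            gcongr
            linarith
        calc _ ≤ momentConst m (p + 1) * ((s * ∑ i ∈ t', α i ^ 2) *
                (s * ∑ i ∈ t, α i ^ 2 + B ^ 2) ^ p) +
              (∑ r ∈ Finset.range (2 * p + 2), ((2 * p + 2).choose (r + 1) : ℝ) * m (r + 1)) *
              ((s * α a ^ 2) * ((momentConst m p + 1) *
                (s * ∑ i ∈ t, α i ^ 2 + B ^ 2) ^ p)) := by
              refine add_le_add (iht hsub') (mul_le_mul_of_nonneg_left ?_ hC)
              exact mul_le_mul_of_nonneg_left h1 (mul_nonneg hs (sq_nonneg _))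
          _ = _ := by rw [momentConst]; ring
    refine (key t subset_rfl).trans ?_
    have := momentConst_nonneg hm (p + 1)
    have hW : 0 ≤ s * ∑ i ∈ t, α i ^ 2 := mul_nonneg hs (hV t)
    rw [pow_succ' (s * ∑ i ∈ t, α i ^ 2 + B ^ 2)]
    gcongr
    exact le_add_of_nonneg_right (sq_nonneg B)

/-- Markov's inequality for the 2p-th power. The case V = 0 is separate because V^{2p} cannot be
cancelled; there, for p > 0, the moment bound forces S = 0 almost surely. -/
lemma measureReal_gt_le_of_moment [IsFiniteMeasure μ] {S : Ω → ℝ} (hS : AllMoments S μ)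
    (p : ℕ) {K V lam : ℝ} (hlam : 0 < lam) (hV : 0 ≤ V) (hK : 0 ≤ K)
    (h : ∫ ω, S ω ^ (2 * p) ∂μ ≤ K * (V ^ 2) ^ p) :
    μ.real {ω | lam * V < |S ω|} ≤ K / lam ^ (2 * p) := by
  have hI := (hS.pow (2 * p)).integrable
  have hnn : 0 ≤ᵐ[μ] fun ω => S ω ^ (2 * p) := ae_of_all _ fun ω => by
    simp only [Pi.zero_apply, pow_mul]; positivity
  rcases hV.eq_or_lt with rfl | hV0
  · rcases Nat.eq_zero_or_pos p with rfl | hp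
    · simp only [mul_zero, pow_zero, integral_const, smul_eq_mul, mul_one, div_one] at h ⊢
      exact (measureReal_mono (Set.subset_univ _)).trans h
    have h0 : ∫ ω, S ω ^ (2 * p) ∂μ = 0 := by
      refine le_antisymm (h.trans ?_) (integral_nonneg_of_ae hnn)
      simp [hp.ne']
    rw [integral_eq_zero_iff_of_nonneg_ae hnn hI] at h0
    have : μ {ω | lam * 0 < |S ω|} = 0 := by
      refine measure_mono_null ?_ h0
      intro ω hω
      simp only [Set.mem_ofPred_eq, mul_zero, abs_pos] at hω
      simp only [Set.mem_compl_iff, Set.mem_ofPred_eq, Pi.zero_apply]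
      exact pow_ne_zero _ hω
    rw [measureReal_def, this]
    simp only [ENNReal.toReal_zero]; positivity
  · have hm := mul_meas_ge_le_integral_of_nonneg hnn hI ((lam * V) ^ (2 * p))
    have hsub : {ω | lam * V < |S ω|} ⊆ {ω | (lam * V) ^ (2 * p) ≤ S ω ^ (2 * p)} := by
      intro ω hω
      simp only [Set.mem_ofPred_eq] at hω ⊢
      rw [← (even_two_mul p).pow_abs (S ω)]
      gcongr
    have hle := measureReal_mono (μ := μ) hsub
    rw [le_div_iff₀ (by positivity)]
    have hVp : 0 < (V ^ 2) ^ p := by positivity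
    have e : (lam * V) ^ (2 * p) = lam ^ (2 * p) * (V ^ 2) ^ p := by
      rw [mul_pow, pow_mul V]
    rw [e] at hm hle
    have : lam ^ (2 * p) * (V ^ 2) ^ p * μ.real {ω | lam * V < |S ω|} ≤ K * (V ^ 2) ^ p := by
      refine le_trans (mul_le_mul_of_nonneg_left hle (by positivity)) ?_
      exact hm.trans h
    have h5 : (μ.real {ω | lam * V < |S ω|} * lam ^ (2 * p)) * (V ^ 2) ^ p ≤ K * (V ^ 2) ^ p := by
      linarith
    exact le_of_mul_le_mul_right h5 hVp

end Moments

end LaplacianRigidity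
end

/-! ### Large deviations for linear and quadratic forms in sparse variables. -/

noncomputable section
namespace LaplacianRigidity

/-- Truncation turns a bound that holds with high probability into a deterministic one, as the
martingale bounds require. The σ-algebra is left free so that predictability survives. -/
lemma measurable_truncate {Ω : Type*} {_ : MeasurableSpace Ω} {f : Ω → ℝ} (hf : Measurable f) (c : ℝ) :
    Measurable fun ω => if |f ω| ≤ c then f ω else 0 :=
  Measurable.ite (measurableSet_le hf.abs measurable_const) hf measurable_const

section Sparse

variable {Ω : Type*} [MeasurableSpace Ω] {μ : Measure Ω}

/-- Independent centred variables of variance `1 / N` with sparse moment bounds. -/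
structure SparseFamily {ι : Type*} (X : ι → Ω → ℝ) (μ : Measure Ω) (N q : ℝ) (m : ℕ → ℝ) :
    Prop where
  meas : ∀ i, Measurable (X i)
  indep : iIndepFun X μ
  mean : ∀ i, ∫ ω, X i ω ∂μ = 0
  var : ∀ i, ∫ ω, X i ω ^ 2 ∂μ = 1 / N
  allMoments : ∀ i, AllMoments (X i) μ
  moment : ∀ i r, 2 ≤ r → ∫ ω, |X i ω| ^ r ∂μ ≤ m r * (1 / q) ^ (r - 2) * (1 / N)
  const_nonneg : ∀ r, 0 ≤ m r
  pos : 0 < q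
  sq_le : q ^ 2 ≤ N

/-- Moment constants of the centred squares of a sparse family. -/
def squareConst (m : ℕ → ℝ) (r : ℕ) : ℝ := 2 ^ r * (m (2 * r) + 1)

variable {ι : Type*} {X : ι → Ω → ℝ} {N q : ℝ} {m : ℕ → ℝ}

lemma SparseFamily.N_pos (h : SparseFamily X μ N q m) : 0 < N :=
  lt_of_lt_of_le (by have := h.pos; positivity) h.sq_le

lemma SparseFamily.inv_N_le (h : SparseFamily X μ N q m) : 1 / N ≤ (1 / q) ^ 2 := by
  have := h.pos
  rw [one_div_pow]
  exact one_div_le_one_div_of_le (by positivity) h.sq_le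

lemma SparseFamily.squareConst_nonneg (h : SparseFamily X μ N q m) (r : ℕ) :
    0 ≤ squareConst m r := by
  have := h.const_nonneg (2 * r)
  unfold squareConst; positivity

lemma SparseFamily.allMoments_sq [IsProbabilityMeasure μ] (h : SparseFamily X μ N q m) (i : ι) :
    AllMoments (fun ω => X i ω ^ 2 - 1 / N) μ :=
  ((h.allMoments i).pow 2).sub (allMoments_of_bound measurable_const |1 / N| fun _ => le_rfl)

lemma SparseFamily.mean_sq [IsProbabilityMeasure μ] (h : SparseFamily X μ N q m) (i : ι) :
    ∫ ω, (X i ω ^ 2 - 1 / N) ∂μ = 0 := by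
  rw [integral_sub ((h.allMoments i).pow 2).integrable (integrable_const _), h.var i]
  simp

/-- The centred squares are again sparse, with 1/q replaced by 1/q² and 1/N by 1/(q²N). The
contribution N⁻ʳ of the centring is absorbed through q² ≤ N. -/
lemma SparseFamily.moment_sq [IsProbabilityMeasure μ] (h : SparseFamily X μ N q m) (i : ι) (r : ℕ)
    (hr : 2 ≤ r) : ∫ ω, |X i ω ^ 2 - 1 / N| ^ r ∂μ ≤
      squareConst m r * ((1 / q) ^ 2) ^ (r - 2) * ((1 / q) ^ 2 * (1 / N)) := by
  have hN := h.N_pos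
  have hq := h.pos
  have h1 : ∀ ω, |X i ω ^ 2 - 1 / N| ^ r ≤ 2 ^ r * (|X i ω| ^ (2 * r) + (1 / N) ^ r) := by
    intro ω
    have ha : |X i ω ^ 2 - 1 / N| ≤ X i ω ^ 2 + 1 / N := by
      rw [abs_le]
      have : 0 < 1 / N := by positivity
      constructor <;> nlinarith [sq_nonneg (X i ω)]
    have hb : (X i ω ^ 2 + 1 / N) ^ r ≤ 2 ^ r * ((X i ω ^ 2) ^ r + (1 / N) ^ r) := by
      refine (add_pow_le (sq_nonneg _) (by positivity) r).trans ?_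
      have : (2 : ℝ) ^ (r - 1) ≤ 2 ^ r := pow_le_pow_right₀ (by norm_num) (by omega)
      exact mul_le_mul_of_nonneg_right this (by positivity)
    refine (pow_le_pow_left₀ (abs_nonneg _) ha r).trans (hb.trans_eq ?_)
    rw [pow_mul, sq_abs]
  have h2 : ∫ ω, |X i ω ^ 2 - 1 / N| ^ r ∂μ ≤
      ∫ ω, 2 ^ r * (|X i ω| ^ (2 * r) + (1 / N) ^ r) ∂μ :=
    integral_mono ((h.allMoments_sq i).abs.pow r).integrable
      ((((h.allMoments i).abs.pow (2 * r)).integrable.add (integrable_const _)).const_mul _) h1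
  refine h2.trans ?_
  rw [integral_const_mul, integral_add ((h.allMoments i).abs.pow (2 * r)).integrable
    (integrable_const _)]
  simp only [integral_const, smul_eq_mul, probReal_univ, one_mul]
  have h3 := h.moment i (2 * r) (by omega)
  have h4 : (1 / N) ^ r ≤ (1 / q) ^ (2 * r - 2) * (1 / N) := by
    obtain ⟨k, rfl⟩ : ∃ k, r = k + 1 := ⟨r - 1, by omega⟩
    rw [pow_succ, show 2 * (k + 1) - 2 = 2 * k by omega, pow_mul]
    have := h.inv_N_le
    gcongr
  have h5 : ((1 / q) ^ 2) ^ (r - 2) * ((1 / q) ^ 2 * (1 / N)) = (1 / q) ^ (2 * r - 2) * (1 / N) := by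
    rw [← mul_assoc, ← pow_succ, ← pow_mul]
    congr 2; omega
  rw [mul_assoc, h5, squareConst]
  calc _ ≤ 2 ^ r * (m (2 * r) * (1 / q) ^ (2 * r - 2) * (1 / N) +
        (1 / q) ^ (2 * r - 2) * (1 / N)) := by gcongr
    _ = _ := by ring

/-- Tail bound for `∑ Y_i X_i` with `Y_i` depending on the earlier variables. -/
lemma SparseFamily.tail_linear [IsProbabilityMeasure μ] [LinearOrder ι]
    (h : SparseFamily X μ N q m)
    {Y : ι → Ω → ℝ} (hY : ∀ i, Measurable[past X i] (Y i)) {α : ι → ℝ}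
    (hα : ∀ i, 0 ≤ α i) (hYα : ∀ i ω, |Y i ω| ≤ α i) (p : ℕ) (t : Finset ι) {V B lam : ℝ}
    (hB : ∀ i, α i / q ≤ B) (hV0 : 0 ≤ V) (hV : (∑ i ∈ t, α i ^ 2) / N + B ^ 2 ≤ V ^ 2)
    (hlam : 0 < lam) :
    μ.real {ω | lam * V < |∑ i ∈ t, Y i ω * X i ω|} ≤ momentConst m p / lam ^ (2 * p) := by
  have hq := h.pos
  have hN := h.N_pos
  have key := martingale_moment h.meas h.indep measurable_id h.allMoments h.mean
    (b := 1 / q) (s := 1 / N) (B := B) (by positivity) (by positivity) h.const_nonneg h.moment hY hα hYα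
    (fun i => by rw [one_div_mul_eq_div]; exact hB i) p t
  have hYA : ∀ i, AllMoments (Y i) μ := fun i =>
    allMoments_of_bound ((hY i).mono (past_le h.meas i) le_rfl) (α i) (hYα i)
  refine measureReal_gt_le_of_moment (AllMoments.sum t fun i _ => (hYA i).mul (h.allMoments i)) p
    hlam hV0 (momentConst_nonneg h.const_nonneg p) (key.trans ?_)
  have := momentConst_nonneg h.const_nonneg p
  have h0 : 0 ≤ ∑ i ∈ t, α i ^ 2 := Finset.sum_nonneg fun i _ => sq_nonneg _
  gcongr
  rwa [one_div_mul_eq_div]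

/-- Tail bound for `∑ Y_i (X_i ^ 2 - 1 / N)` with `Y_i` depending on the earlier variables. -/
lemma SparseFamily.tail_square [IsProbabilityMeasure μ] [LinearOrder ι]
    (h : SparseFamily X μ N q m)
    {Y : ι → Ω → ℝ} (hY : ∀ i, Measurable[past X i] (Y i)) {α : ι → ℝ}
    (hα : ∀ i, 0 ≤ α i) (hYα : ∀ i ω, |Y i ω| ≤ α i) (p : ℕ) (t : Finset ι) {V B lam : ℝ}
    (hB : ∀ i, α i / q ^ 2 ≤ B) (hV0 : 0 ≤ V)
    (hV : (∑ i ∈ t, α i ^ 2) / (q ^ 2 * N) + B ^ 2 ≤ V ^ 2)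
    (hlam : 0 < lam) :
    μ.real {ω | lam * V < |∑ i ∈ t, Y i ω * (X i ω ^ 2 - 1 / N)|} ≤
      momentConst (squareConst m) p / lam ^ (2 * p) := by
  have hq := h.pos
  have hN := h.N_pos
  have key := martingale_moment h.meas h.indep (φ := fun x => x ^ 2 - 1 / N) (by fun_prop)
    h.allMoments_sq h.mean_sq
    (b := (1 / q) ^ 2) (s := (1 / q) ^ 2 * (1 / N)) (B := B) (by positivity) (by positivity)
    h.squareConst_nonneg h.moment_sq hY hα hYα
    (fun i => by rw [one_div_pow, one_div_mul_eq_div]; exact hB i) p t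
  have hYA : ∀ i, AllMoments (Y i) μ := fun i =>
    allMoments_of_bound ((hY i).mono (past_le h.meas i) le_rfl) (α i) (hYα i)
  refine measureReal_gt_le_of_moment (AllMoments.sum t fun i _ => (hYA i).mul (h.allMoments_sq i)) p
    hlam hV0 (momentConst_nonneg h.squareConst_nonneg p) (key.trans ?_)
  have := momentConst_nonneg h.squareConst_nonneg p
  have h0 : 0 ≤ ∑ i ∈ t, α i ^ 2 := Finset.sum_nonneg fun i _ => sq_nonneg _
  gcongr
  rwa [one_div_pow, one_div_mul_one_div, one_div_mul_eq_div]

/-- Since 1/N ≤ q⁻², the 2p-th moment is of order q^{-2p}: a single entry has size 1/q up to factors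
λ. -/
lemma SparseFamily.tail_entry [IsProbabilityMeasure μ] (h : SparseFamily X μ N q m) (i : ι) (p : ℕ)
    (hp : 1 ≤ p) {lam : ℝ} (hlam : 0 < lam) :
    μ.real {ω | lam / q < |X i ω|} ≤ m (2 * p) / lam ^ (2 * p) := by
  have hq := h.pos
  have hN := h.N_pos
  have hm := h.const_nonneg (2 * p)
  have e : ∀ ω, (lam / q < |X i ω|) = (lam * (1 / q) < |X i ω|) := fun ω => by rw [mul_one_div]
  simp_rw [e]
  refine measureReal_gt_le_of_moment (h.allMoments i) p hlam (by positivity) hm ?_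
  have := h.moment i (2 * p) (by omega)
  simp_rw [(even_two_mul p).pow_abs] at this
  refine this.trans ?_
  rw [mul_assoc]
  gcongr
  calc (1 / q) ^ (2 * p - 2) * (1 / N) ≤ (1 / q) ^ (2 * p - 2) * (1 / q) ^ 2 := by
        have := h.inv_N_le; gcongr
    _ = _ := by rw [← pow_add, ← pow_mul]; congr 1; omega

lemma sum_sum_eq_diag_add_lower {n : ℕ} (f : Fin n → Fin n → ℝ) (hf : ∀ k l, f k l = f l k) :
    ∑ k, ∑ l, f k l = ∑ k, f k k + ∑ k, ∑ l ∈ Finset.univ.filter (· < k), 2 * f k l := by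
  have h1 : ∀ k, ∑ l, f k l = f k k + ∑ l ∈ Finset.univ.filter (· < k), f k l +
      ∑ l ∈ Finset.univ.filter (k < ·), f k l := by
    intro k
    have hk : ∀ l, f k l = (if l = k then f k l else 0) + (if l < k then f k l else 0) +
        (if k < l then f k l else 0) := by
      intro l
      rcases lt_trichotomy l k with h | h | h
      · simp [h, h.ne, h.not_gt]
      · simp [h]
      · simp [h, h.ne', h.not_gt]
    rw [Finset.sum_congr rfl fun l _ => hk l, Finset.sum_add_distrib, Finset.sum_add_distrib,
      Finset.sum_filter, Finset.sum_filter]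
    simp
  have h2 : ∑ k, ∑ l ∈ Finset.univ.filter (k < ·), f k l =
      ∑ k, ∑ l ∈ Finset.univ.filter (· < k), f k l := by
    simp_rw [Finset.sum_filter]
    rw [Finset.sum_comm]
    simp_rw [hf]
  simp_rw [h1, Finset.sum_add_distrib, h2, ← Finset.mul_sum]
  ring

/-- Large deviation bound for quadratic forms in a sparse family. -/
theorem SparseFamily.tail_quadratic [IsProbabilityMeasure μ] {n : ℕ} {X : Fin n → Ω → ℝ}
    (h : SparseFamily X μ N q m)
    (A : Fin n → Fin n → ℝ) (hA : ∀ k l, A k l = A l k) {F R lam : ℝ} (hF0 : 0 ≤ F)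
    (hF : ∑ k, ∑ l, A k l ^ 2 ≤ F ^ 2) (hR0 : 0 ≤ R) (hR : ∀ k, ∑ l, A k l ^ 2 ≤ R ^ 2)
    (hlam : 1 ≤ lam) (p : ℕ) :
    μ.real {ω | 4 * lam ^ 2 * (F / (q * √N) + R / q ^ 2) <
        |∑ k, ∑ l, X k ω * A k l * X l ω - (∑ k, A k k) / N|} ≤
      ((n + 1) * momentConst m p + momentConst (squareConst m) p) / lam ^ (2 * p) := by
  have hq := h.pos
  have hN := h.N_pos
  have hlam0 : 0 < lam := by linarith
  have hsN : √N ^ 2 = N := Real.sq_sqrt hN.le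
  have hsN0 : 0 < √N := Real.sqrt_pos.2 hN
  set W := F / (q * √N) + R / q ^ 2 with hW
  have hW0 : 0 ≤ W := by positivity
  have hWsq : F ^ 2 / (q ^ 2 * N) + (R / q ^ 2) ^ 2 ≤ W ^ 2 := by
    rw [hW, add_sq, div_pow F, mul_pow, hsN]
    have : 0 ≤ 2 * (F / (q * √N)) * (R / q ^ 2) := by positivity
    linarith
  set rr : Fin n → ℝ := fun k => √(∑ l, A k l ^ 2) with hrr
  have hrr0 : ∀ k, 0 ≤ rr k := fun k => Real.sqrt_nonneg _
  have hrsq : ∀ k, rr k ^ 2 = ∑ l, A k l ^ 2 := fun k =>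
    Real.sq_sqrt (Finset.sum_nonneg fun l _ => sq_nonneg _)
  have hrR : ∀ k, rr k ≤ R := fun k => by
    refine abs_le_of_sq_le_sq' ?_ hR0 |>.2
    rw [hrsq]; exact hR k
  have hAr : ∀ k l, |A k l| ≤ rr k := fun k l => by
    refine Real.le_sqrt_of_sq_le ?_
    rw [sq_abs]
    exact Finset.single_le_sum (f := fun l => A k l ^ 2) (fun l _ => sq_nonneg _) (Finset.mem_univ l)
  -- Twice the lower triangle represents the off-diagonal part as ∑ L_k X_k, where L_k depends on
  -- the earlier variables only.
  set L : Fin n → Ω → ℝ := fun k ω => ∑ l ∈ Finset.univ.filter (· < k), 2 * A k l * X l ω with hL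
  have hLm : ∀ k, Measurable[past X k] (L k) := fun k => by
    refine Finset.measurable_fun_sum (m := past X k) _ fun l hl => ?_
    exact (measurable_past X (Finset.mem_filter.1 hl).2).const_mul _
  -- The factor 3 is chosen because the variance term and the jump term are each at most 4 r_k²/q²,
  -- and 4 + 4 ≤ 9.
  set β : Fin n → ℝ := fun k => 3 * rr k / q with hβ
  have hβ0 : ∀ k, 0 ≤ β k := fun k => by have := hrr0 k; positivity
  have step1 : ∀ k, μ.real {ω | lam * β k < |L k ω|} ≤ momentConst m p / lam ^ (2 * p) := by
    intro k
    refine h.tail_linear (Y := fun l _ => 2 * A k l) (α := fun l => 2 * |A k l|)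
      (fun l => measurable_const) (fun l => by positivity) (fun l ω => by rw [abs_mul]; simp) p _
      (B := 2 * rr k / q) (fun l => ?_) (hβ0 k) ?_ hlam0
    · have := hAr k l; gcongr
    · have e1 : ∑ l ∈ Finset.univ.filter (· < k), (2 * |A k l|) ^ 2 ≤ 4 * rr k ^ 2 := by
        rw [hrsq, Finset.mul_sum]
        refine (Finset.sum_le_sum_of_subset_of_nonneg (Finset.subset_univ _)
          fun i _ _ => sq_nonneg _).trans_eq ?_
        refine Finset.sum_congr rfl fun l _ => ?_
        rw [mul_pow, sq_abs]; norm_num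
      have e2 : (∑ l ∈ Finset.univ.filter (· < k), (2 * |A k l|) ^ 2) / N ≤
          4 * rr k ^ 2 * (1 / q) ^ 2 := by
        rw [div_eq_mul_one_div]
        exact mul_le_mul e1 h.inv_N_le (by positivity) (by positivity)
      have e3 : β k ^ 2 = 9 * rr k ^ 2 * (1 / q) ^ 2 := by simp only [hβ]; ring
      have e4 : (2 * rr k / q) ^ 2 = 4 * rr k ^ 2 * (1 / q) ^ 2 := by ring
      rw [e3, e4]
      have : 0 ≤ rr k ^ 2 * (1 / q) ^ 2 := by positivity
      linarith
  -- L_k is cut at its likely size so that the martingale bound applies a second time; outside a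
  -- union of n rare events the cut changes nothing.
  set Lt : Fin n → Ω → ℝ := fun k ω => if |L k ω| ≤ lam * β k then L k ω else 0 with hLt
  have hLtm : ∀ k, Measurable[past X k] (Lt k) := fun k => measurable_truncate (hLm k) _
  have hLtb : ∀ k ω, |Lt k ω| ≤ lam * β k := fun k ω => by
    have := hβ0 k
    simp only [hLt]; split_ifs with hc
    · exact hc
    · rw [abs_zero]; positivity
  have step2 : μ.real {ω | lam * (3 * lam * W) < |∑ k, Lt k ω * X k ω|} ≤
      momentConst m p / lam ^ (2 * p) := by
    refine h.tail_linear hLtm (α := fun k => lam * β k)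
      (fun k => mul_nonneg hlam0.le (hβ0 k)) hLtb p _
      (B := 3 * lam * (R / q ^ 2)) (fun k => ?_) (by positivity) ?_ hlam0
    · have := hrR k
      calc lam * β k / q = 3 * lam * (rr k / q ^ 2) := by simp only [hβ]; field_simp
        _ ≤ _ := by gcongr
    · have e1 : (∑ k, (lam * β k) ^ 2) / N ≤ 9 * lam ^ 2 * (F ^ 2 / (q ^ 2 * N)) := by
        have : ∑ k, (lam * β k) ^ 2 = (9 * lam ^ 2 / q ^ 2) * ∑ k, ∑ l, A k l ^ 2 := by
          rw [Finset.mul_sum]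
          refine Finset.sum_congr rfl fun k _ => ?_
          rw [← hrsq]; simp only [hβ]; field_simp; ring
        rw [this]
        calc _ ≤ (9 * lam ^ 2 / q ^ 2) * F ^ 2 / N := by gcongr
          _ = _ := by field_simp
      have e2 : (3 * lam * (R / q ^ 2)) ^ 2 = 9 * lam ^ 2 * (R / q ^ 2) ^ 2 := by ring
      have e3 : (3 * lam * W) ^ 2 = 9 * lam ^ 2 * W ^ 2 := by ring
      rw [e2, e3]
      nlinarith [sq_nonneg lam]
  have step3 : μ.real {ω | lam * W < |∑ k, A k k * (X k ω ^ 2 - 1 / N)|} ≤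
      momentConst (squareConst m) p / lam ^ (2 * p) := by
    refine h.tail_square (Y := fun k _ => A k k) (fun k => measurable_const) (α := fun k => |A k k|)
      (fun k => abs_nonneg _) (fun k _ => le_rfl) p _ (B := R / q ^ 2) (fun k => ?_) hW0 ?_ hlam0
    · have := (hAr k k).trans (hrR k); gcongr
    · refine le_trans ?_ hWsq
      have : ∑ k, |A k k| ^ 2 ≤ F ^ 2 := by
        refine le_trans (Finset.sum_le_sum fun k _ => ?_) hF
        rw [sq_abs]
        exact Finset.single_le_sum (f := fun l => A k l ^ 2) (fun l _ => sq_nonneg _)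
          (Finset.mem_univ k)
      gcongr
  have hsub : {ω | 4 * lam ^ 2 * W < |∑ k, ∑ l, X k ω * A k l * X l ω - (∑ k, A k k) / N|} ⊆
      ((⋃ k ∈ (Finset.univ : Finset (Fin n)), {ω | lam * β k < |L k ω|}) ∪
        {ω | lam * (3 * lam * W) < |∑ k, Lt k ω * X k ω|}) ∪
        {ω | lam * W < |∑ k, A k k * (X k ω ^ 2 - 1 / N)|} := by
    intro ω hω
    by_contra hcon
    simp only [Set.mem_union, Set.mem_iUnion, Set.mem_ofPred_eq, not_or, not_exists, not_lt,
      Finset.mem_univ, exists_prop, true_and] at hcon hω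
    obtain ⟨⟨c1, c2⟩, c3⟩ := hcon
    have e0 : ∑ k, ∑ l, X k ω * A k l * X l ω - (∑ k, A k k) / N =
        ∑ k, A k k * (X k ω ^ 2 - 1 / N) + ∑ k, Lt k ω * X k ω := by
      rw [sum_sum_eq_diag_add_lower (fun k l => X k ω * A k l * X l ω)
        (fun k l => by rw [hA k l]; ring)]
      have : ∀ k, Lt k ω * X k ω =
          ∑ l ∈ Finset.univ.filter (· < k), 2 * (X k ω * A k l * X l ω) := by
        intro k
        have hk : Lt k ω = L k ω := if_pos (c1 k)
        rw [hk, hL, Finset.sum_mul]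
        exact Finset.sum_congr rfl fun l _ => by ring
      simp_rw [this, mul_sub, Finset.sum_sub_distrib, ← Finset.sum_mul]
      have : ∀ k, A k k * X k ω ^ 2 = X k ω * A k k * X k ω := fun k => by ring
      simp_rw [this]
      ring
    rw [e0] at hω
    have := (abs_add_le (∑ k, A k k * (X k ω ^ 2 - 1 / N)) (∑ k, Lt k ω * X k ω)).trans
      (add_le_add c3 c2)
    have hl2 : lam * W ≤ lam ^ 2 * W := by
      rw [pow_two]; exact mul_le_mul_of_nonneg_right (le_mul_of_one_le_left hlam0.le hlam) hW0
    nlinarith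
  refine (measureReal_mono hsub).trans ((measureReal_union_le _ _).trans ?_)
  have u1 := measureReal_union_le (μ := μ)
    (⋃ k ∈ (Finset.univ : Finset (Fin n)), {ω | lam * β k < |L k ω|})
    {ω | lam * (3 * lam * W) < |∑ k, Lt k ω * X k ω|}
  have u2 := measureReal_biUnion_finset_le (μ := μ) (Finset.univ : Finset (Fin n))
    (fun k => {ω | lam * β k < |L k ω|})
  have u3 : ∑ k : Fin n, μ.real {ω | lam * β k < |L k ω|} ≤
      n * (momentConst m p / lam ^ (2 * p)) := by
    refine (Finset.sum_le_sum fun k _ => step1 k).trans_eq ?_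
    simp
  have : ((n + 1) * momentConst m p + momentConst (squareConst m) p) / lam ^ (2 * p) =
    n * (momentConst m p / lam ^ (2 * p)) + momentConst m p / lam ^ (2 * p) +
      momentConst (squareConst m) p / lam ^ (2 * p) := by ring
  linarith

end Sparse

end LaplacianRigidity
end

/-! ### Resolvents of real symmetric matrices and diagonal perturbations. -/

noncomputable section
namespace LaplacianRigidity

section Resolvent

open Matrix

variable {n : Type*} [Fintype n] [DecidableEq n]

/-- The matrix `A - z` over `ℂ`. -/
def shifted (A : Matrix n n ℝ) (z : ℂ) : Matrix n n ℂ := A.map (fun x : ℝ => (x : ℂ)) - z • 1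

/-- The resolvent `(A - z)⁻¹`. -/
def resolvent (A : Matrix n n ℝ) (z : ℂ) : Matrix n n ℂ := (shifted A z)⁻¹

lemma shifted_transpose {A : Matrix n n ℝ} (hA : A.IsSymm) (z : ℂ) :
    (shifted A z)ᵀ = shifted A z := by
  rw [shifted, transpose_sub, transpose_smul, transpose_one, ← transpose_map, hA.eq]

/-- The form of a real symmetric matrix is real on complex vectors, so only -z contributes to the
imaginary part. -/
lemma im_star_dotProduct_shifted {A : Matrix n n ℝ} (hA : A.IsSymm) (z : ℂ) (x : n → ℂ) :
    (star x ⬝ᵥ shifted A z *ᵥ x).im = -(z.im * ∑ k, ‖x k‖ ^ 2) := by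
  have h1 : star x ⬝ᵥ shifted A z *ᵥ x =
      star x ⬝ᵥ (A.map (fun x : ℝ => (x : ℂ))) *ᵥ x - z * ∑ k, ((‖x k‖ ^ 2 : ℝ) : ℂ) := by
    rw [shifted, sub_mulVec, dotProduct_sub, smul_mulVec, one_mulVec, dotProduct_smul, smul_eq_mul]
    congr 2
    simp only [dotProduct, Pi.star_apply, RCLike.star_def]
    refine Finset.sum_congr rfl fun k _ => ?_
    rw [mul_comm, Complex.mul_conj, Complex.normSq_eq_norm_sq]
  have h2 : (star x ⬝ᵥ (A.map (fun x : ℝ => (x : ℂ))) *ᵥ x).im = 0 := by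
    rw [← Complex.conj_eq_iff_im]
    simp only [dotProduct, mulVec, Pi.star_apply, RCLike.star_def, map_sum, map_mul, Complex.conj_conj,
      Finset.mul_sum, Matrix.map_apply, Complex.conj_ofReal]
    rw [Finset.sum_comm]
    refine Finset.sum_congr rfl fun k _ => Finset.sum_congr rfl fun l _ => ?_
    rw [hA.apply]
    ring
  rw [h1, Complex.sub_im, h2, ← Complex.ofReal_sum, Complex.im_mul_ofReal]
  ring

lemma isUnit_det_shifted {A : Matrix n n ℝ} (hA : A.IsSymm) {z : ℂ} (hz : 0 < z.im) :
    IsUnit (shifted A z).det := by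
  rw [← Matrix.isUnit_iff_isUnit_det, ← Matrix.mulVec_injective_iff_isUnit]
  refine (injective_iff_map_eq_zero (shifted A z).mulVecLin).2 fun x hx => ?_
  have h := im_star_dotProduct_shifted hA z x
  rw [mulVecLin_apply] at hx
  rw [hx, dotProduct_zero, Complex.zero_im, eq_comm, neg_eq_zero, mul_eq_zero] at h
  have h' := h.resolve_left hz.ne'
  rw [Finset.sum_eq_zero_iff_of_nonneg fun k _ => by positivity] at h'
  ext k
  simpa using h' k (Finset.mem_univ k)

lemma shifted_mul_resolvent {A : Matrix n n ℝ} (hA : A.IsSymm) {z : ℂ} (hz : 0 < z.im) :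
    shifted A z * resolvent A z = 1 := Matrix.mul_nonsing_inv _ (isUnit_det_shifted hA hz)

lemma resolvent_mul_shifted {A : Matrix n n ℝ} (hA : A.IsSymm) {z : ℂ} (hz : 0 < z.im) :
    resolvent A z * shifted A z = 1 := Matrix.nonsing_inv_mul _ (isUnit_det_shifted hA hz)

lemma resolvent_symm {A : Matrix n n ℝ} (hA : A.IsSymm) (z : ℂ) (k l : n) :
    resolvent A z k l = resolvent A z l k := by
  have : (resolvent A z)ᵀ = resolvent A z := by
    rw [resolvent, transpose_nonsing_inv, shifted_transpose hA]
  exact congrFun (congrFun this l) k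

/-- The complexification of a real vector. -/
def cvec (h : n → ℝ) : n → ℂ := fun k => (h k : ℂ)

/-- Ward identity: with y = Gh, the form h·Gh is the complex conjugate of y*(A - z)y, whose
imaginary part is explicit. -/
lemma im_resolvent_form {A : Matrix n n ℝ} (hA : A.IsSymm) {z : ℂ} (hz : 0 < z.im) (h : n → ℝ) :
    (cvec h ⬝ᵥ resolvent A z *ᵥ cvec h).im = z.im * ∑ k, ‖(resolvent A z *ᵥ cvec h) k‖ ^ 2 := by
  set y := resolvent A z *ᵥ cvec h with hy
  have h1 : shifted A z *ᵥ y = cvec h := by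
    rw [hy, mulVec_mulVec, shifted_mul_resolvent hA hz, one_mulVec]
  have h2 := im_star_dotProduct_shifted hA z y
  rw [h1] at h2
  have h3 : cvec h ⬝ᵥ y = (starRingEnd ℂ) (star y ⬝ᵥ cvec h) := by
    simp only [dotProduct, map_sum, map_mul, Pi.star_apply, RCLike.star_def, Complex.conj_conj, cvec,
      Complex.conj_ofReal]
    exact Finset.sum_congr rfl fun k _ => mul_comm _ _
  rw [h3, Complex.conj_im, h2, neg_neg]

lemma cvec_single (k : n) : cvec (Pi.single k (1 : ℝ)) = Pi.single k (1 : ℂ) := by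
  ext l
  by_cases h : l = k
  · subst h; simp [cvec]
  · simp [cvec, h]

lemma im_resolvent_diag {A : Matrix n n ℝ} (hA : A.IsSymm) {z : ℂ} (hz : 0 < z.im) (k : n) :
    (resolvent A z k k).im = z.im * ∑ l, ‖resolvent A z l k‖ ^ 2 := by
  have := im_resolvent_form hA hz (Pi.single k 1)
  simpa [cvec_single] using this

/-- If T is the squared norm of column k, the Ward identity gives η T ≤ |G_kk| ≤ √T, hence T ≤ η⁻²,
with no recourse to the spectral theorem. -/
lemma resolvent_col_sq_le {A : Matrix n n ℝ} (hA : A.IsSymm) {z : ℂ} (hz : 0 < z.im) (k : n) :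
    ∑ l, ‖resolvent A z l k‖ ^ 2 ≤ (1 / z.im) ^ 2 := by
  set T := ∑ l, ‖resolvent A z l k‖ ^ 2 with hT
  have h0 : 0 ≤ T := Finset.sum_nonneg fun _ _ => by positivity
  have h1 : ‖resolvent A z k k‖ ^ 2 ≤ T :=
    Finset.single_le_sum (f := fun l => ‖resolvent A z l k‖ ^ 2) (fun l _ => by positivity)
      (Finset.mem_univ k)
  have h2 : z.im * T ≤ ‖resolvent A z k k‖ := by
    rw [hT, ← im_resolvent_diag hA hz k]
    exact (le_abs_self _).trans (Complex.abs_im_le_norm _)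
  have h3 : (z.im * T) ^ 2 ≤ T := (pow_le_pow_left₀ (mul_nonneg hz.le h0) h2 2).trans h1
  rw [_root_.one_div_pow, le_div_iff₀ (by positivity)]
  by_contra! hcon
  have hT0 : 0 < T := by
    rcases h0.eq_or_lt with h | h
    · rw [← h] at hcon; norm_num at hcon
    · exact h
  nlinarith

lemma norm_resolvent_diag_le {A : Matrix n n ℝ} (hA : A.IsSymm) {z : ℂ} (hz : 0 < z.im) (k : n) :
    ‖resolvent A z k k‖ ≤ 1 / z.im := by
  have h1 : ‖resolvent A z k k‖ ^ 2 ≤ (1 / z.im) ^ 2 :=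
    (Finset.single_le_sum (f := fun l => ‖resolvent A z l k‖ ^ 2) (fun l _ => by positivity)
      (Finset.mem_univ k)).trans (resolvent_col_sq_le hA hz k)
  exact le_of_sq_le_sq h1 (by positivity)

lemma norm_trace_resolvent_le {A : Matrix n n ℝ} (hA : A.IsSymm) {z : ℂ} (hz : 0 < z.im) :
    ‖(resolvent A z).trace‖ ≤ Fintype.card n / z.im := by
  refine (norm_sum_le _ _).trans ((Finset.sum_le_sum fun k _ =>
    norm_resolvent_diag_le hA hz k).trans_eq ?_)
  simp [div_eq_mul_inv]

lemma im_trace_resolvent {A : Matrix n n ℝ} (hA : A.IsSymm) {z : ℂ} (hz : 0 < z.im) :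
    (resolvent A z).trace.im = z.im * ∑ k, ∑ l, ‖resolvent A z k l‖ ^ 2 := by
  rw [trace, Complex.im_sum, Finset.mul_sum]
  refine Finset.sum_congr rfl fun k _ => ?_
  rw [diag_apply, im_resolvent_diag hA hz k]
  simp_rw [resolvent_symm hA z k]

lemma im_trace_resolvent_nonneg {A : Matrix n n ℝ} (hA : A.IsSymm) {z : ℂ} (hz : 0 < z.im) :
    0 ≤ (resolvent A z).trace.im := by
  rw [im_trace_resolvent hA hz]
  have : 0 ≤ ∑ k, ∑ l, ‖resolvent A z k l‖ ^ 2 :=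
    Finset.sum_nonneg fun _ _ => Finset.sum_nonneg fun _ _ => by positivity
  positivity

lemma resolvent_sub_add_diagonal {B : Matrix n n ℝ} (hB : B.IsSymm) {h : n → ℝ} {z : ℂ}
    (hz : 0 < z.im) :
    resolvent B z - resolvent (B + diagonal h) z =
      resolvent B z * diagonal (cvec h) * resolvent (B + diagonal h) z := by
  have hB' : (B + diagonal h).IsSymm := hB.add (isSymm_diagonal h)
  have e : diagonal (cvec h) = shifted (B + diagonal h) z - shifted B z := by
    ext k l
    by_cases hkl : k = l
    · subst hkl; simp [shifted, cvec]
    · simp [shifted, hkl]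
  rw [e, mul_sub, sub_mul, mul_assoc, shifted_mul_resolvent hB' hz, resolvent_mul_shifted hB hz]
  simp

lemma norm_sum_mul_mul_le {x y : n → ℂ} {h : n → ℝ} {τ : ℝ} (hτ : ∀ k, |h k| ≤ τ) :
    ‖∑ k, x k * h k * y k‖ ≤ τ * √((∑ k, ‖x k‖ ^ 2) * ∑ k, ‖y k‖ ^ 2) := by
  rcases isEmpty_or_nonempty n with hn | ⟨⟨k₀⟩⟩
  · simp
  have hτ0 : 0 ≤ τ := (abs_nonneg _).trans (hτ k₀)
  calc ‖∑ k, x k * h k * y k‖ ≤ ∑ k, ‖x k * h k * y k‖ := norm_sum_le _ _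
    _ ≤ ∑ k, τ * (‖x k‖ * ‖y k‖) := by
        refine Finset.sum_le_sum fun k _ => ?_
        rw [norm_mul, norm_mul, Complex.norm_real, Real.norm_eq_abs]
        have := hτ k
        calc ‖x k‖ * |h k| * ‖y k‖ = |h k| * (‖x k‖ * ‖y k‖) := by ring
          _ ≤ _ := by gcongr
    _ = τ * ∑ k, ‖x k‖ * ‖y k‖ := by rw [Finset.mul_sum]
    _ ≤ _ := by
        refine mul_le_mul_of_nonneg_left ?_ hτ0
        refine Real.le_sqrt_of_sq_le ?_
        exact Finset.sum_mul_sq_le_sq_mul_sq _ _ _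

/-- The resolvent identity and Cauchy–Schwarz leave τ ‖Gh‖ ‖G'h‖, and the Ward identity rewrites
both norms as imaginary parts. The error is therefore relative to the size of the form itself. -/
lemma form_resolvent_perturb {B : Matrix n n ℝ} (hB : B.IsSymm) {h : n → ℝ} {τ : ℝ}
    (hτ : ∀ k, |h k| ≤ τ) {z : ℂ} (hz : 0 < z.im) :
    ‖cvec h ⬝ᵥ resolvent B z *ᵥ cvec h -
        cvec h ⬝ᵥ resolvent (B + diagonal h) z *ᵥ cvec h‖ ≤
      τ / z.im * √((cvec h ⬝ᵥ resolvent B z *ᵥ cvec h).im *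
        (cvec h ⬝ᵥ resolvent (B + diagonal h) z *ᵥ cvec h).im) := by
  have hB' : (B + diagonal h).IsSymm := hB.add (isSymm_diagonal h)
  rw [← dotProduct_sub, ← sub_mulVec, resolvent_sub_add_diagonal hB hz,
    im_resolvent_form hB hz, im_resolvent_form hB' hz]
  set x := resolvent B z *ᵥ cvec h with hx
  set y := resolvent (B + diagonal h) z *ᵥ cvec h with hy
  have e : cvec h ⬝ᵥ (resolvent B z * diagonal (cvec h) * resolvent (B + diagonal h) z) *ᵥ cvec h =
      ∑ k, x k * h k * y k := by
    rw [← mulVec_mulVec, ← mulVec_mulVec, dotProduct_mulVec]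
    have : cvec h ᵥ* resolvent B z = x := by
      rw [hx, ← mulVec_transpose]
      congr 1
      ext k l
      exact resolvent_symm hB z l k
    rw [this]
    simp only [dotProduct, mulVec_diagonal, cvec, hy]
    exact Finset.sum_congr rfl fun k _ => by rw [mul_assoc]
  rw [e]
  refine (norm_sum_mul_mul_le hτ).trans_eq ?_
  rw [show z.im * (∑ k, ‖x k‖ ^ 2) * (z.im * ∑ k, ‖y k‖ ^ 2) =
    z.im ^ 2 * ((∑ k, ‖x k‖ ^ 2) * ∑ k, ‖y k‖ ^ 2) by ring, Real.sqrt_mul (sq_nonneg _),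
    Real.sqrt_sq hz.le]
  field_simp

/-- The same argument in Hilbert–Schmidt norm, with vectors indexed by pairs. -/
lemma trace_resolvent_perturb {B : Matrix n n ℝ} (hB : B.IsSymm) {h : n → ℝ} {τ : ℝ}
    (hτ : ∀ k, |h k| ≤ τ) {z : ℂ} (hz : 0 < z.im) :
    ‖(resolvent B z).trace - (resolvent (B + diagonal h) z).trace‖ ≤
      τ / z.im * √((resolvent B z).trace.im * (resolvent (B + diagonal h) z).trace.im) := by
  have hB' : (B + diagonal h).IsSymm := hB.add (isSymm_diagonal h)
  rw [← trace_sub, resolvent_sub_add_diagonal hB hz, im_trace_resolvent hB hz,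
    im_trace_resolvent hB' hz]
  have e : (resolvent B z * diagonal (cvec h) * resolvent (B + diagonal h) z).trace =
      ∑ p : n × n, resolvent B z p.1 p.2 * (h p.2 : ℝ) * resolvent (B + diagonal h) z p.1 p.2 := by
    rw [Fintype.sum_prod_type]
    simp only [trace, diag_apply, mul_apply (M := resolvent B z * diagonal (cvec h)), mul_diagonal,
      cvec]
    refine Finset.sum_congr rfl fun k _ => Finset.sum_congr rfl fun l _ => ?_
    rw [resolvent_symm hB' z l k]
  rw [e]
  refine (norm_sum_mul_mul_le (n := n × n) (h := fun p => h p.2) (fun p => hτ p.2)).trans_eq ?_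
  rw [Fintype.sum_prod_type, Fintype.sum_prod_type]
  set a := ∑ k, ∑ l, ‖resolvent B z k l‖ ^ 2
  set b := ∑ k, ∑ l, ‖resolvent (B + diagonal h) z k l‖ ^ 2
  rw [show z.im * a * (z.im * b) = z.im ^ 2 * (a * b) by ring, Real.sqrt_mul (sq_nonneg _),
    Real.sqrt_sq hz.le]
  field_simp

/-- The geometric mean is at most the arithmetic one, and Im a ≤ Im b + ‖a - b‖ is absorbed because
δ ≤ 1/2. This removes a from the right-hand side. -/
lemma norm_sub_le_two_mul_im {a b : ℂ} {δ : ℝ} (ha : 0 ≤ a.im) (hb : 0 ≤ b.im) (hδ0 : 0 ≤ δ)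
    (hδ : δ ≤ 1 / 2) (h : ‖a - b‖ ≤ δ * √(a.im * b.im)) : ‖a - b‖ ≤ 2 * δ * b.im := by
  have h1 : √(a.im * b.im) ≤ (a.im + b.im) / 2 := by
    rw [Real.sqrt_le_left (by linarith)]
    nlinarith [sq_nonneg (a.im - b.im)]
  have h2 : a.im - b.im ≤ ‖a - b‖ := by
    rw [← Complex.sub_im]; exact (le_abs_self _).trans (Complex.abs_im_le_norm _)
  have h3 : ‖a - b‖ ≤ δ * ((a.im + b.im) / 2) := h.trans (by gcongr)
  have h4 : δ * (a.im - b.im) ≤ δ * ‖a - b‖ := by gcongr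
  have h5 : δ * ‖a - b‖ ≤ 1 / 2 * ‖a - b‖ := by gcongr
  nlinarith [mul_nonneg hδ0 hb]

end Resolvent

/-! ### Schur complement and the approximate self-consistent equation. -/

section Schur

open Matrix

variable {N : ℕ}

/-- The minor obtained by deleting row and column `i`. -/
def minor (H : Matrix (Fin (N + 1)) (Fin (N + 1)) ℝ) (i : Fin (N + 1)) :
    Matrix (Fin N) (Fin N) ℝ := H.submatrix i.succAbove i.succAbove

/-- The off-diagonal part of row `i`. -/
def offRow (H : Matrix (Fin (N + 1)) (Fin (N + 1)) ℝ) (i : Fin (N + 1)) : Fin N → ℝ :=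
  fun k => H i (i.succAbove k)

lemma minor_isSymm {H : Matrix (Fin (N + 1)) (Fin (N + 1)) ℝ} (hH : H.IsSymm) (i : Fin (N + 1)) :
    (minor H i).IsSymm := hH.submatrix _

/-- Column j of (H - z)G = 1, restricted to the rows other than i, is a linear system for the minor.
The case j = i gives Schur's formula, the case j ≠ i the rank-one correction of the diagonal. -/
lemma resolvent_col_eq {H : Matrix (Fin (N + 1)) (Fin (N + 1)) ℝ} (hH : H.IsSymm)
    (i j : Fin (N + 1)) {z : ℂ} (hz : 0 < z.im) :
    (fun k => resolvent H z (i.succAbove k) j) =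
      resolvent (minor H i) z *ᵥ (fun k => (1 : Matrix _ _ ℂ) (i.succAbove k) j) -
        resolvent H z i j • (resolvent (minor H i) z *ᵥ cvec (offRow H i)) := by
  have hM := minor_isSymm hH i
  set x : Fin N → ℂ := fun k => resolvent H z (i.succAbove k) j with hx
  have h1 : shifted (minor H i) z *ᵥ x =
      (fun k => (1 : Matrix _ _ ℂ) (i.succAbove k) j) - resolvent H z i j • cvec (offRow H i) := by
    ext k
    have h := congrFun (congrFun (shifted_mul_resolvent hH hz) (i.succAbove k)) j
    rw [mul_apply, Fin.sum_univ_succAbove _ i] at h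
    simp only [Pi.sub_apply, Pi.smul_apply, smul_eq_mul]
    rw [← h]
    have e1 : shifted H z (i.succAbove k) i = cvec (offRow H i) k := by
      simp [shifted, cvec, offRow, hH.apply i, Fin.succAbove_ne]
    have e2 : ∀ l, shifted H z (i.succAbove k) (i.succAbove l) = shifted (minor H i) z k l := by
      intro l
      simp [shifted, minor, one_apply]
    rw [e1]
    simp_rw [e2]
    rw [mulVec, dotProduct]
    ring
  have h2 : x = resolvent (minor H i) z *ᵥ (shifted (minor H i) z *ᵥ x) := by
    rw [mulVec_mulVec, resolvent_mul_shifted hM hz, one_mulVec]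
  rw [h2, h1, mulVec_sub, mulVec_smul]

/-- Schur's complement formula; as a product equal to 1 it also shows that neither factor vanishes.
-/
lemma resolvent_diag_mul {H : Matrix (Fin (N + 1)) (Fin (N + 1)) ℝ} (hH : H.IsSymm)
    (i : Fin (N + 1)) {z : ℂ} (hz : 0 < z.im) :
    resolvent H z i i * (H i i - z - cvec (offRow H i) ⬝ᵥ
      resolvent (minor H i) z *ᵥ cvec (offRow H i)) = 1 := by
  have h := congrFun (congrFun (shifted_mul_resolvent hH hz) i) i
  rw [mul_apply, Fin.sum_univ_succAbove _ i, one_apply_eq] at h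
  have hc := resolvent_col_eq hH i i hz
  have e0 : (fun k => (1 : Matrix _ _ ℂ) (i.succAbove k) i) = 0 := by
    ext k; simp [Fin.succAbove_ne]
  rw [e0, mulVec_zero, zero_sub] at hc
  have e1 : ∀ k, shifted H z i (i.succAbove k) = cvec (offRow H i) k := by
    intro k
    simp [shifted, cvec, offRow, (Fin.succAbove_ne i k).symm]
  have e2 : ∑ k, shifted H z i (i.succAbove k) * resolvent H z (i.succAbove k) i =
      -(resolvent H z i i * (cvec (offRow H i) ⬝ᵥ
        resolvent (minor H i) z *ᵥ cvec (offRow H i))) := by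
    simp_rw [e1]
    have : ∑ k, cvec (offRow H i) k * resolvent H z (i.succAbove k) i =
      cvec (offRow H i) ⬝ᵥ (fun k => resolvent H z (i.succAbove k) i) := rfl
    rw [this, hc, dotProduct_neg, dotProduct_smul, smul_eq_mul]
  rw [e2] at h
  have e3 : shifted H z i i = H i i - z := by simp [shifted]
  rw [e3] at h
  linear_combination h

/-- The difference is g(1 + ∑ y_k²), and 1/g has imaginary part of modulus η(1 + ∑ |y_k|²), which
cancels the numerator up to 1/η. -/
lemma norm_trace_resolvent_sub_minor {H : Matrix (Fin (N + 1)) (Fin (N + 1)) ℝ} (hH : H.IsSymm)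
    (i : Fin (N + 1)) {z : ℂ} (hz : 0 < z.im) :
    ‖(resolvent H z).trace - (resolvent (minor H i) z).trace‖ ≤ 1 / z.im := by
  have hM := minor_isSymm hH i
  set y := resolvent (minor H i) z *ᵥ cvec (offRow H i) with hy
  set g := resolvent H z i i with hg
  have h1 : ∀ k, resolvent H z (i.succAbove k) i = -(g * y k) := by
    intro k
    have hc := congrFun (resolvent_col_eq hH i i hz) k
    have e0 : (fun k => (1 : Matrix _ _ ℂ) (i.succAbove k) i) = 0 := by
      ext k; simp [Fin.succAbove_ne]
    rw [e0, mulVec_zero, zero_sub] at hc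
    simpa using hc
  have h2 : ∀ k, resolvent H z (i.succAbove k) (i.succAbove k) =
      resolvent (minor H i) z k k + g * y k ^ 2 := by
    intro k
    have hc := congrFun (resolvent_col_eq hH i (i.succAbove k) hz) k
    have e0 : (fun l => (1 : Matrix _ _ ℂ) (i.succAbove l) (i.succAbove k)) = Pi.single k 1 := by
      ext l
      by_cases hlk : l = k
      · subst hlk; simp
      · rw [one_apply_ne (fun h => hlk (Fin.succAbove_right_injective h)), Pi.single_eq_of_ne hlk]
    rw [e0, mulVec_single_one] at hc
    simp only [Pi.sub_apply, Pi.smul_apply, smul_eq_mul, col_apply] at hc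
    rw [hc, resolvent_symm hH z i, h1]
    ring
  have h3 : (resolvent H z).trace - (resolvent (minor H i) z).trace = g * (1 + ∑ k, y k ^ 2) := by
    rw [trace, Fin.sum_univ_succAbove _ i, trace]
    simp only [diag_apply, h2, Finset.sum_add_distrib, ← Finset.mul_sum]
    rw [← hg]; ring
  have h4 := resolvent_diag_mul hH i hz
  set D := (H i i : ℂ) - z - cvec (offRow H i) ⬝ᵥ y with hD
  have h5 : D.im = -(z.im * (1 + ∑ k, ‖y k‖ ^ 2)) := by
    rw [hD, Complex.sub_im, Complex.sub_im, im_resolvent_form hM hz, Complex.ofReal_im]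
    ring
  have hs : 0 ≤ ∑ k, ‖y k‖ ^ 2 := Finset.sum_nonneg fun _ _ => by positivity
  have h6 : z.im * (1 + ∑ k, ‖y k‖ ^ 2) ≤ ‖D‖ := by
    have := Complex.abs_im_le_norm D
    rw [h5, abs_neg, abs_of_nonneg (by positivity)] at this
    exact this
  have h7 : ‖(1 : ℂ) + ∑ k, y k ^ 2‖ ≤ 1 + ∑ k, ‖y k‖ ^ 2 := by
    refine (norm_add_le _ _).trans ?_
    rw [norm_one]
    gcongr
    refine (norm_sum_le _ _).trans_eq ?_
    simp_rw [norm_pow]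
  have h8 : ‖g‖ * ‖D‖ = 1 := by rw [← norm_mul, h4, norm_one]
  rw [h3, norm_mul, le_div_iff₀ hz]
  calc ‖g‖ * ‖(1 : ℂ) + ∑ k, y k ^ 2‖ * z.im ≤ ‖g‖ * (1 + ∑ k, ‖y k‖ ^ 2) * z.im := by gcongr
    _ = ‖g‖ * (z.im * (1 + ∑ k, ‖y k‖ ^ 2)) := by ring
    _ ≤ ‖g‖ * ‖D‖ := by gcongr
    _ = 1 := h8

/-- The normalized trace of the resolvent. -/
def stieltjes (H : Matrix (Fin (N + 1)) (Fin (N + 1)) ℝ) (z : ℂ) : ℂ :=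
  (resolvent H z).trace / (N + 1 : ℝ)

/-- The Stieltjes transform of the empirical measure of the diagonal entries. -/
def diagStieltjes (H : Matrix (Fin (N + 1)) (Fin (N + 1)) ℝ) (w : ℂ) : ℂ :=
  (∑ i, 1 / ((H i i : ℂ) - w)) / (N + 1 : ℝ)

lemma norm_stieltjes_le {H : Matrix (Fin (N + 1)) (Fin (N + 1)) ℝ} (hH : H.IsSymm) {z : ℂ}
    (hz : 0 < z.im) : ‖stieltjes H z‖ ≤ 1 / z.im := by
  have hN : (0 : ℝ) < N + 1 := by positivity
  rw [stieltjes, norm_div, Complex.norm_real, Real.norm_of_nonneg hN.le, div_le_iff₀ hN]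
  refine (norm_trace_resolvent_le hH hz).trans_eq ?_
  rw [Fintype.card_fin]; push_cast; ring

lemma stieltjes_im_nonneg {H : Matrix (Fin (N + 1)) (Fin (N + 1)) ℝ} (hH : H.IsSymm) {z : ℂ}
    (hz : 0 < z.im) : 0 ≤ (stieltjes H z).im := by
  rw [stieltjes, Complex.div_ofReal_im]
  exact div_nonneg (im_trace_resolvent_nonneg hH hz) (by positivity)

/-- The comparison runs from the form of the minor to the form of the reduced minor, to its trace,
to the trace of the minor, to that of H. Only the second link, `hX`, is probabilistic. Errors are
kept proportional to Im(z + m), which is what the inversion in `norm_inv_sub_inv_le` tolerates. -/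
lemma norm_form_sub_stieltjes_le {H : Matrix (Fin (N + 1)) (Fin (N + 1)) ℝ} (hH : H.IsSymm)
    (hN : 0 < N) {z : ℂ} (hz : 0 < z.im) {τ ε : ℝ} (hε0 : 0 ≤ ε) (hε : ε ≤ 1 / 100)
    (i : Fin (N + 1)) (hτ : ∀ k, |offRow H i k| ≤ τ) (hτε : τ / z.im ≤ ε)
    (hNε : 1 / (N * z.im) ≤ ε * z.im)
    (hX : ‖cvec (offRow H i) ⬝ᵥ resolvent (minor H i + diagonal (offRow H i)) z *ᵥ
        cvec (offRow H i) - (resolvent (minor H i + diagonal (offRow H i)) z).trace / (N : ℝ)‖ ≤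
      ε * ((resolvent (minor H i + diagonal (offRow H i)) z).trace.im / N + z.im)) :
    ‖cvec (offRow H i) ⬝ᵥ resolvent (minor H i) z *ᵥ cvec (offRow H i) - stieltjes H z‖ ≤
      16 * ε * (z + stieltjes H z).im := by
  have hM := minor_isSymm hH i
  have hM' : (minor H i + diagonal (offRow H i)).IsSymm := hM.add (isSymm_diagonal _)
  have hN' : (0 : ℝ) < N := by exact_mod_cast hN
  have hδ : τ / z.im * 1 ≤ 1 / 2 := by linarith
  have hτ0 : 0 ≤ τ / z.im := by
    have := (abs_nonneg _).trans (hτ ⟨0, hN⟩)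
    positivity
  have p1 := norm_sub_le_two_mul_im
    (by rw [im_resolvent_form hM hz]
        have : 0 ≤ ∑ k, ‖(resolvent (minor H i) z *ᵥ cvec (offRow H i)) k‖ ^ 2 :=
          Finset.sum_nonneg fun _ _ => by positivity
        positivity)
    (by rw [im_resolvent_form hM' hz]
        have : 0 ≤ ∑ k, ‖(resolvent (minor H i + diagonal (offRow H i)) z *ᵥ
            cvec (offRow H i)) k‖ ^ 2 :=
          Finset.sum_nonneg fun _ _ => by positivity
        positivity) hτ0 (by linarith) (form_resolvent_perturb hM hτ hz)
  have p2 := norm_sub_le_two_mul_im (im_trace_resolvent_nonneg hM hz)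
    (im_trace_resolvent_nonneg hM' hz) hτ0 (by linarith) (trace_resolvent_perturb hM hτ hz)
  have p3 := norm_trace_resolvent_sub_minor hH i hz
  have p4 := norm_stieltjes_le hH hz
  have p5 := stieltjes_im_nonneg hH hz
  have p6 := im_trace_resolvent_nonneg hM' hz
  have hGm : (resolvent H z).trace = (N + 1 : ℝ) * stieltjes H z := by
    rw [stieltjes, mul_div_cancel₀]
    exact_mod_cast (by positivity : (N + 1 : ℝ) ≠ 0)
  set Yq := cvec (offRow H i) ⬝ᵥ resolvent (minor H i) z *ᵥ cvec (offRow H i)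
  set Xq := cvec (offRow H i) ⬝ᵥ resolvent (minor H i + diagonal (offRow H i)) z *ᵥ
    cvec (offRow H i)
  set T' := (resolvent (minor H i + diagonal (offRow H i)) z).trace
  set T := (resolvent (minor H i) z).trace
  set m := stieltjes H z
  set η := z.im
  set b := T'.im / N with hb
  have hb0 : 0 ≤ b := by positivity
  have hXim : Xq.im ≤ b + ε * (b + η) := by
    have : (Xq - T' / (N : ℝ)).im ≤ ‖Xq - T' / (N : ℝ)‖ :=
      (le_abs_self _).trans (Complex.abs_im_le_norm _)
    rw [Complex.sub_im, Complex.div_ofReal_im] at this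
    linarith
  have q1 : ‖Yq - Xq‖ ≤ 3 * ε * (b + η) := by
    have : 2 * (τ / η) * Xq.im ≤ 2 * ε * (b + ε * (b + η)) := by
      have hpos : 0 ≤ b + ε * (b + η) := by positivity
      calc _ ≤ 2 * (τ / η) * (b + ε * (b + η)) := by gcongr
        _ ≤ _ := by gcongr
    nlinarith [mul_nonneg hε0 hb0, mul_nonneg hε0 hz.le]
  have q2 : ‖T' / (N : ℝ) - T / (N : ℝ)‖ ≤ 2 * ε * b := by
    rw [← sub_div, norm_div, norm_sub_rev, Complex.norm_real, Real.norm_of_nonneg hN'.le,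
      div_le_iff₀ hN']
    refine p2.trans ?_
    have : 2 * (τ / η) * T'.im ≤ 2 * ε * T'.im := by gcongr
    refine this.trans_eq ?_
    rw [hb]; field_simp
  -- Normalizing by N rather than N + 1 produces the extra term m/N, comparable to the interlacing
  -- error 1/(Nη).
  have q3 : ‖T / (N : ℝ) - m‖ ≤ 2 * ε * η := by
    have e : T / ((N : ℝ) : ℂ) - m = (m - ((resolvent H z).trace - T)) / (N : ℝ) := by
      rw [hGm]
      have : ((N : ℝ) : ℂ) ≠ 0 := by exact_mod_cast hN'.ne'
      field_simp
      push_cast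
      ring
    rw [e, norm_div, Complex.norm_real, Real.norm_of_nonneg hN'.le, div_le_iff₀ hN']
    have h1 := (norm_sub_le m ((resolvent H z).trace - T)).trans (add_le_add p4 p3)
    refine h1.trans ?_
    have h2 : 1 / η = 1 / (N * η) * N := by field_simp
    have h3 : 1 / (N * η) * N ≤ ε * η * N := by gcongr
    linarith
  have q4 : ‖T' / (N : ℝ) - m‖ ≤ 2 * ε * (b + η) := by
    have := norm_sub_le_norm_sub_add_norm_sub (T' / (N : ℝ)) (T / (N : ℝ)) m
    linarith
  have q5 : b + η ≤ 2 * (m.im + η) := by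
    have : (T' / (N : ℝ) - m).im ≤ ‖T' / (N : ℝ) - m‖ :=
      (le_abs_self _).trans (Complex.abs_im_le_norm _)
    rw [Complex.sub_im, Complex.div_ofReal_im] at this
    nlinarith
  have q6 : ‖Yq - m‖ ≤ 8 * ε * (b + η) := by
    have h1 := norm_sub_le_norm_sub_add_norm_sub Yq Xq m
    have h2 := norm_sub_le_norm_sub_add_norm_sub Xq (T' / (N : ℝ)) m
    have := mul_nonneg hε0 (add_nonneg hb0 hz.le)
    linarith
  refine q6.trans ?_
  rw [Complex.add_im]
  nlinarith

/-- As |v - w| ≥ Im w, the error is at most 2ε Im w / |v - w|², which is 2ε times the imaginary part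
of the unperturbed inverse. Summed over the diagonal, it reproduces Im `diagStieltjes`. -/
lemma norm_inv_sub_inv_le {v : ℝ} {w e : ℂ} (hw : 0 < w.im) {ε : ℝ} (hε : ε ≤ 1 / 2)
    (he : ‖e‖ ≤ ε * w.im) :
    ‖1 / ((v : ℂ) - w - e) - 1 / (v - w)‖ ≤ 2 * ε * (1 / ((v : ℂ) - w)).im := by
  have hd : w.im ≤ ‖(v : ℂ) - w‖ := by
    have := Complex.abs_im_le_norm ((v : ℂ) - w)
    simp only [Complex.sub_im, Complex.ofReal_im, zero_sub, abs_neg, abs_of_pos hw] at this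
    exact this
  have hd0 : 0 < ‖(v : ℂ) - w‖ := hw.trans_le hd
  have hd1 : ‖(v : ℂ) - w‖ / 2 ≤ ‖(v : ℂ) - w - e‖ := by
    have := norm_sub_norm_le ((v : ℂ) - w) e
    nlinarith
  have hne : (v : ℂ) - w ≠ 0 := norm_pos_iff.1 hd0
  have hne' : (v : ℂ) - w - e ≠ 0 := norm_pos_iff.1 (by linarith)
  have him : (1 / ((v : ℂ) - w)).im = w.im / ‖(v : ℂ) - w‖ ^ 2 := by
    rw [one_div, Complex.inv_im, Complex.normSq_eq_norm_sq]; simp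
  rw [him, div_sub_div _ _ hne' hne, norm_div, norm_mul]
  have e1 : 1 * ((v : ℂ) - w) - (v - w - e) * 1 = e := by ring
  rw [e1, div_le_iff₀ (by positivity)]
  calc ‖e‖ ≤ ε * w.im := he
    _ = 2 * ε * (w.im / ‖(v : ℂ) - w‖ ^ 2) * (‖(v : ℂ) - w‖ / 2 * ‖(v : ℂ) - w‖) := by
        field_simp
    _ ≤ _ := by
        have : 0 ≤ ε * w.im := (norm_nonneg _).trans he
        have h2 : 0 ≤ 2 * ε * (w.im / ‖(v : ℂ) - w‖ ^ 2) := by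
          rw [show 2 * ε * (w.im / ‖(v : ℂ) - w‖ ^ 2) = 2 * (ε * w.im) / ‖(v : ℂ) - w‖ ^ 2 by ring]
          positivity
        gcongr

/-- Approximate self-consistent equation. -/
theorem norm_stieltjes_sub_diagStieltjes_le {H : Matrix (Fin (N + 1)) (Fin (N + 1)) ℝ}
    (hH : H.IsSymm) (hN : 0 < N) {z : ℂ} (hz : 0 < z.im) {τ ε : ℝ} (hε0 : 0 ≤ ε)
    (hε : ε ≤ 1 / 100)
    (hτ : ∀ i k, |offRow H i k| ≤ τ) (hτε : τ / z.im ≤ ε)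
    (hNε : 1 / (N * z.im) ≤ ε * z.im)
    (hX : ∀ i, ‖cvec (offRow H i) ⬝ᵥ resolvent (minor H i + diagonal (offRow H i)) z *ᵥ
        cvec (offRow H i) - (resolvent (minor H i + diagonal (offRow H i)) z).trace / (N : ℝ)‖ ≤
      ε * ((resolvent (minor H i + diagonal (offRow H i)) z).trace.im / N + z.im)) :
    ‖stieltjes H z - diagStieltjes H (z + stieltjes H z)‖ ≤
      32 * ε * (diagStieltjes H (z + stieltjes H z)).im := by
  have hw : 0 < (z + stieltjes H z).im := by
    have := stieltjes_im_nonneg hH hz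
    rw [Complex.add_im]; linarith
  have key : ∀ i, ‖resolvent H z i i - 1 / ((H i i : ℂ) - (z + stieltjes H z))‖ ≤
      32 * ε * (1 / ((H i i : ℂ) - (z + stieltjes H z))).im := by
    intro i
    have h1 := norm_form_sub_stieltjes_le hH hN hz hε0 hε i (hτ i) hτε hNε (hX i)
    have h2 := norm_inv_sub_inv_le (v := H i i) hw (ε := 16 * ε) (by linarith) h1
    have h3 := resolvent_diag_mul hH i hz
    have h4 : resolvent H z i i = 1 / ((H i i : ℂ) - (z + stieltjes H z) -
        (cvec (offRow H i) ⬝ᵥ resolvent (minor H i) z *ᵥ cvec (offRow H i) -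
          stieltjes H z)) := by
      rw [eq_div_iff]
      · rw [← h3]; ring
      · intro h0
        have : (H i i : ℂ) - z - cvec (offRow H i) ⬝ᵥ
            resolvent (minor H i) z *ᵥ cvec (offRow H i) = 0 := by rw [← h0]; ring
        rw [this, mul_zero] at h3
        exact zero_ne_one h3
    rw [h4]
    refine h2.trans_eq (by ring)
  have hN1 : (0 : ℝ) < N + 1 := by positivity
  set w := z + stieltjes H z
  rw [diagStieltjes, Complex.div_ofReal_im, stieltjes, ← sub_div, norm_div, Complex.norm_real,
    Real.norm_of_nonneg hN1.le, ← mul_div_assoc]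
  gcongr
  rw [trace, ← Finset.sum_sub_distrib, Complex.im_sum, Finset.mul_sum]
  refine (norm_sum_le _ _).trans (Finset.sum_le_sum fun i _ => key i)

end Schur

end LaplacianRigidity
end

/-! ### The Stieltjes transform of the standard Gaussian. -/

noncomputable section
namespace LaplacianRigidity

section GaussianStieltjes

open Complex Set

/-- The half-line Gaussian moment `∫₀^∞ t ^ k e^{iwt - t²/2} dt`. -/
def halfMoment (k : ℕ) (w : ℂ) : ℂ :=
  ∫ t in Ioi (0 : ℝ), (t : ℂ) ^ k * cexp (I * w * t - t ^ 2 / 2)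

/-- `∫₀^∞ t ^ k e^{-t²/2} dt`. -/
def absHalfMoment (k : ℕ) : ℝ := ∫ t in Ioi (0 : ℝ), t ^ k * Real.exp (-(1 / 2) * t ^ 2)

lemma integrableOn_pow_mul_exp (k : ℕ) :
    IntegrableOn (fun t : ℝ => t ^ k * Real.exp (-(1 / 2) * t ^ 2)) (Ioi 0) := by
  have := integrableOn_rpow_mul_exp_neg_mul_sq (b := 1 / 2) (by norm_num) (s := k)
    (by have : (0 : ℝ) ≤ k := by positivity
        linarith)
  simpa [Real.rpow_natCast] using this

lemma absHalfMoment_nonneg (k : ℕ) : 0 ≤ absHalfMoment k :=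
  setIntegral_nonneg measurableSet_Ioi fun t ht => by
    have : (0 : ℝ) < t := ht
    positivity

lemma norm_halfMoment_integrand_le {w : ℂ} (hw : 0 ≤ w.im) (k : ℕ) {t : ℝ} (ht : 0 < t) :
    ‖(t : ℂ) ^ k * cexp (I * w * t - t ^ 2 / 2)‖ ≤ t ^ k * Real.exp (-(1 / 2) * t ^ 2) := by
  rw [norm_mul, norm_pow, norm_real, Real.norm_of_nonneg ht.le, norm_exp]
  have : (I * w * t - (t : ℂ) ^ 2 / 2).re = -(w.im * t) - t ^ 2 / 2 := by
    have h2 : ((t : ℂ) ^ 2).re = t ^ 2 := by rw [← ofReal_pow, ofReal_re]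
    simp [h2]
  rw [this]
  have : 0 ≤ w.im * t := by positivity
  gcongr
  linarith

lemma integrableOn_halfMoment {w : ℂ} (hw : 0 ≤ w.im) (k : ℕ) :
    IntegrableOn (fun t : ℝ => (t : ℂ) ^ k * cexp (I * w * t - t ^ 2 / 2)) (Ioi 0) := by
  refine Integrable.mono' (integrableOn_pow_mul_exp k) (by fun_prop) ?_
  exact (ae_restrict_mem measurableSet_Ioi).mono fun t ht => norm_halfMoment_integrand_le hw k ht

lemma norm_halfMoment_le {w : ℂ} (hw : 0 ≤ w.im) (k : ℕ) : ‖halfMoment k w‖ ≤ absHalfMoment k := by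
  refine norm_integral_le_of_norm_le (integrableOn_pow_mul_exp k) ?_
  exact (ae_restrict_mem measurableSet_Ioi).mono fun t ht => norm_halfMoment_integrand_le hw k ht

lemma hasDerivAt_halfMoment {w : ℂ} (hw : 0 < w.im) (k : ℕ) :
    HasDerivAt (halfMoment k) (I * halfMoment (k + 1) w) w := by
  have hopen : IsOpen {u : ℂ | 0 < u.im} := isOpen_lt continuous_const continuous_im
  have := (hasDerivAt_integral_of_dominated_loc_of_deriv_le (μ := volume.restrict (Ioi (0 : ℝ)))
    (F := fun (u : ℂ) (t : ℝ) => (t : ℂ) ^ k * cexp (I * u * t - t ^ 2 / 2))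
    (F' := fun (u : ℂ) (t : ℝ) => I * ((t : ℂ) ^ (k + 1) * cexp (I * u * t - t ^ 2 / 2)))
    (bound := fun t => t ^ (k + 1) * Real.exp (-(1 / 2) * t ^ 2))
    (hopen.mem_nhds hw) (Eventually.of_forall fun u => by fun_prop)
    (integrableOn_halfMoment hw.le k) (by fun_prop) ?_ (integrableOn_pow_mul_exp (k + 1)) ?_).2
  · rw [integral_const_mul] at this
    exact this
  · refine (ae_restrict_mem measurableSet_Ioi).mono fun t ht u hu => ?_
    rw [norm_mul, norm_I, one_mul]
    exact norm_halfMoment_integrand_le (le_of_lt hu) (k + 1) ht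
  · refine Eventually.of_forall fun t u _ => ?_
    have h1 : HasDerivAt (fun u : ℂ => I * u * t - t ^ 2 / 2) (I * t) u := by
      have := (((hasDerivAt_id u).const_mul I).mul_const (t : ℂ)).sub_const ((t : ℂ) ^ 2 / 2)
      simpa using this
    have := (h1.cexp).const_mul ((t : ℂ) ^ k)
    convert! this using 1
    ring

lemma tendsto_pow_mul_cexp {w : ℂ} (hw : 0 ≤ w.im) (k : ℕ) :
    Tendsto (fun t : ℝ => (t : ℂ) ^ k * cexp (I * w * t - t ^ 2 / 2)) atTop (𝓝 0) := by
  have h1 : Tendsto (fun t : ℝ => t ^ k * Real.exp (-(1 / 2) * t ^ 2)) atTop (𝓝 0) := by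
    have := (rpow_mul_exp_neg_mul_sq_isLittleO_exp_neg (b := 1 / 2) (by norm_num) k).trans_tendsto
      ?_
    · simpa [Real.rpow_natCast] using this
    · refine Real.tendsto_exp_atBot.comp ?_
      exact tendsto_id.const_mul_atTop_of_neg (by norm_num)
  refine squeeze_zero_norm' ?_ h1
  filter_upwards [eventually_gt_atTop 0] with t ht
  exact norm_halfMoment_integrand_le hw k ht

lemma hasDerivAt_cexp_phase (w : ℂ) (t : ℝ) :
    HasDerivAt (fun t : ℝ => cexp (I * w * t - t ^ 2 / 2))
      (cexp (I * w * t - t ^ 2 / 2) * (I * w - t)) t := by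
  have h0 : HasDerivAt (fun s : ℂ => I * w * s - s ^ 2 / 2) (I * w - t) (t : ℂ) := by
    have := ((hasDerivAt_id (t : ℂ)).const_mul (I * w)).sub
      (((hasDerivAt_id (t : ℂ)).pow 2).div_const 2)
    convert! this using 1
    simp
  exact (h0.cexp).comp_ofReal

/-- Integration of the total derivative of the phase over the half-line; the 1 is the boundary value
at the origin. -/
lemma halfMoment_one {w : ℂ} (hw : 0 ≤ w.im) : halfMoment 1 w = 1 + I * w * halfMoment 0 w := by
  have h0 := integrableOn_halfMoment hw 0
  have h1 := integrableOn_halfMoment hw 1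
  have key := integral_Ioi_of_hasDerivAt_of_tendsto' (a := (0 : ℝ))
    (fun t _ => hasDerivAt_cexp_phase w t)
    ((IntegrableOn.congr_fun (Integrable.sub (h0.const_mul (I * w)) h1)
      (fun t _ => by simp; ring) measurableSet_Ioi))
    (by simpa using tendsto_pow_mul_cexp hw 0)
  have e : ∫ t in Ioi (0 : ℝ), cexp (I * w * t - t ^ 2 / 2) * (I * w - t) =
      I * w * halfMoment 0 w - halfMoment 1 w := by
    rw [halfMoment, halfMoment, ← integral_const_mul, ← integral_sub (h0.const_mul _) h1]
    congr 1; ext t; simp; ring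
  rw [e] at key
  simp at key
  linear_combination -key

lemma halfMoment_two {w : ℂ} (hw : 0 ≤ w.im) :
    halfMoment 2 w = halfMoment 0 w + I * w * halfMoment 1 w := by
  have h0 := integrableOn_halfMoment hw 0
  have h1 := integrableOn_halfMoment hw 1
  have h2 := integrableOn_halfMoment hw 2
  have key := integral_Ioi_of_hasDerivAt_of_tendsto' (a := (0 : ℝ))
    (f := fun t : ℝ => (t : ℂ) * cexp (I * w * t - t ^ 2 / 2))
    (f' := fun t : ℝ => cexp (I * w * t - t ^ 2 / 2) +
      t * (cexp (I * w * t - t ^ 2 / 2) * (I * w - t)))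
    (fun t _ => by
      have := ((hasDerivAt_id t).ofReal_comp).mul (hasDerivAt_cexp_phase w t)
      convert! this using 1
      simp)
    ((IntegrableOn.congr_fun (Integrable.sub (Integrable.add h0 (h1.const_mul (I * w))) h2)
      (fun t _ => by simp; ring) measurableSet_Ioi))
    (by simpa using tendsto_pow_mul_cexp hw 1)
  have e : ∫ t in Ioi (0 : ℝ), (cexp (I * w * t - t ^ 2 / 2) +
      t * (cexp (I * w * t - t ^ 2 / 2) * (I * w - t))) =
      halfMoment 0 w + I * w * halfMoment 1 w - halfMoment 2 w := by
    rw [halfMoment, halfMoment, halfMoment, ← integral_const_mul,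
      ← integral_add h0 (h1.const_mul _)]
    refine Eq.trans ?_ (integral_sub (Integrable.add h0 (h1.const_mul (I * w))) h2)
    congr 1; ext t; simp; ring
  rw [e] at key
  simp at key
  linear_combination -key

/-- The standard Gaussian law. -/
abbrev stdGauss : Measure ℝ := gaussianReal 0 1

/-- The Stieltjes transform of the standard Gaussian law. -/
def gaussStieltjes (w : ℂ) : ℂ := ∫ x : ℝ, 1 / ((x : ℂ) - w) ∂stdGauss

lemma im_le_norm_ofReal_sub (x : ℝ) {w : ℂ} (hw : 0 < w.im) : w.im ≤ ‖(x : ℂ) - w‖ := by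
  have := Complex.abs_im_le_norm ((x : ℂ) - w)
  simp only [sub_im, ofReal_im, zero_sub, abs_neg, abs_of_pos hw] at this
  exact this

lemma ofReal_sub_ne_zero (x : ℝ) {w : ℂ} (hw : 0 < w.im) : (x : ℂ) - w ≠ 0 :=
  norm_pos_iff.1 (hw.trans_le (im_le_norm_ofReal_sub x hw))

/-- This representation turns statements about Stieltjes transforms into statements about
characteristic functions. -/
lemma one_div_ofReal_sub_eq (x : ℝ) {w : ℂ} (hw : 0 < w.im) :
    1 / ((x : ℂ) - w) = I * ∫ t in Ioi (0 : ℝ), cexp (I * (w - x) * t) := by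
  have h : (I * (w - x)).re < 0 := by simp [hw]
  rw [integral_exp_mul_complex_Ioi h]
  have h1 := ofReal_sub_ne_zero x hw
  have h2 : I * (w - x) ≠ 0 := mul_ne_zero I_ne_zero (by rw [← neg_sub]; exact neg_ne_zero.2 h1)
  have h3 : w - x ≠ 0 := right_ne_zero_of_mul h2
  simp only [ofReal_zero, mul_zero, exp_zero]
  field_simp
  ring

/-- Fubini and the Gaussian characteristic function. Unlike the defining integral, the half-line
integral stays bounded as Im w tends to 0. -/
lemma gaussStieltjes_eq {w : ℂ} (hw : 0 < w.im) : gaussStieltjes w = I * halfMoment 0 w := by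
  rw [gaussStieltjes]
  simp_rw [one_div_ofReal_sub_eq _ hw]
  rw [integral_const_mul, integral_integral_swap]
  · congr 1
    refine setIntegral_congr_fun measurableSet_Ioi fun t _ => ?_
    have h1 : ∀ x : ℝ, cexp (I * (w - x) * t) = cexp (I * w * t) * cexp (((-t : ℝ) : ℂ) * x * I) := by
      intro x; rw [← Complex.exp_add]; congr 1; push_cast; ring
    simp only [h1]
    rw [integral_const_mul, ← charFun_apply_real, charFun_gaussianReal, ← Complex.exp_add]
    simp only [pow_zero, one_mul]
    congr 1
    push_cast
    ring
  · have hi : Integrable (fun t : ℝ => Real.exp (-w.im * t)) (volume.restrict (Ioi 0)) :=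
      exp_neg_integrableOn_Ioi 0 hw
    have hp : Integrable (fun p : ℝ × ℝ => Real.exp (-w.im * p.2))
        (stdGauss.prod (volume.restrict (Ioi 0))) := by
      have := (integrable_const (1 : ℝ) (μ := stdGauss)).mul_prod hi
      simpa using this
    refine hp.mono' (by simp only [Function.uncurry_def]; fun_prop) (ae_of_all _ fun p => ?_)
    simp only [Function.uncurry, norm_exp]
    gcongr
    simp

lemma norm_gaussStieltjes_le {w : ℂ} (hw : 0 < w.im) : ‖gaussStieltjes w‖ ≤ absHalfMoment 0 := by
  rw [gaussStieltjes_eq hw, norm_mul, norm_I, one_mul]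
  exact norm_halfMoment_le hw.le 0

/-- The derivative of the Stieltjes transform of the standard Gaussian law. -/
def gaussStieltjesDeriv (w : ℂ) : ℂ := ∫ x : ℝ, 1 / ((x : ℂ) - w) ^ 2 ∂stdGauss

lemma norm_one_div_le (x : ℝ) {w : ℂ} {c : ℝ} (hc : 0 < c) (hw : c ≤ w.im) :
    ‖1 / ((x : ℂ) - w)‖ ≤ 1 / c := by
  rw [norm_div, norm_one]
  exact one_div_le_one_div_of_le hc (hw.trans (im_le_norm_ofReal_sub x (hc.trans_le hw)))

lemma integrable_one_div_mul {w₁ w₂ : ℂ} (h1 : 0 < w₁.im) (h2 : 0 < w₂.im) :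
    Integrable (fun x : ℝ => 1 / ((x : ℂ) - w₁) * (1 / ((x : ℂ) - w₂))) stdGauss := by
  refine Integrable.of_bound (C := 1 / w₁.im * (1 / w₂.im)) (by fun_prop) (ae_of_all _ fun x => ?_)
  rw [norm_mul]
  gcongr
  · exact norm_one_div_le x h1 le_rfl
  · exact norm_one_div_le x h2 le_rfl

lemma integrable_one_div {w : ℂ} (hw : 0 < w.im) :
    Integrable (fun x : ℝ => 1 / ((x : ℂ) - w)) stdGauss :=
  Integrable.of_bound (C := 1 / w.im) (Measurable.aestronglyMeasurable (by fun_prop))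
    (ae_of_all _ fun x => norm_one_div_le x hw le_rfl)

lemma hasDerivAt_gaussStieltjes {w : ℂ} (hw : 0 < w.im) :
    HasDerivAt gaussStieltjes (gaussStieltjesDeriv w) w := by
  have hopen : IsOpen {u : ℂ | w.im / 2 < u.im} := isOpen_lt continuous_const continuous_im
  refine (hasDerivAt_integral_of_dominated_loc_of_deriv_le (μ := stdGauss)
    (F := fun (u : ℂ) (x : ℝ) => 1 / ((x : ℂ) - u))
    (F' := fun (u : ℂ) (x : ℝ) => 1 / ((x : ℂ) - u) ^ 2)
    (bound := fun _ => (1 / (w.im / 2)) ^ 2)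
    (hopen.mem_nhds (by simp [hw] : w ∈ {u : ℂ | w.im / 2 < u.im}))
    (Eventually.of_forall fun u => Measurable.aestronglyMeasurable (by fun_prop))
    (integrable_one_div hw) (Measurable.aestronglyMeasurable (by fun_prop)) ?_ (integrable_const _) ?_).2
  · refine ae_of_all _ fun x u hu => ?_
    rw [← one_div_pow, norm_pow]
    exact pow_le_pow_left₀ (norm_nonneg _) (norm_one_div_le x (half_pos hw) (le_of_lt hu)) 2
  · refine ae_of_all _ fun x u hu => ?_
    have hu' : 0 < u.im := (half_pos hw).trans hu
    have := ((hasDerivAt_id u).const_sub (x : ℂ)).inv (ofReal_sub_ne_zero x hu')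
    convert! this using 1
    · ext u; simp [one_div]
    · simp [one_div]

lemma gaussStieltjesDeriv_eq {w : ℂ} (hw : 0 < w.im) :
    gaussStieltjesDeriv w = -halfMoment 1 w := by
  have hopen : IsOpen {u : ℂ | 0 < u.im} := isOpen_lt continuous_const continuous_im
  have h1 := hasDerivAt_gaussStieltjes hw
  have h2 := (hasDerivAt_halfMoment hw 0).const_mul I
  have h3 : gaussStieltjes =ᶠ[𝓝 w] fun u => I * halfMoment 0 u := by
    filter_upwards [hopen.mem_nhds hw] with u hu using gaussStieltjes_eq hu
  have := h1.unique (h2.congr_of_eventuallyEq h3)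
  rw [this, zero_add, ← mul_assoc, I_mul_I, neg_one_mul]

/-- The linear differential equation of m_G; continuity of the derivative becomes immediate from it.
-/
lemma gaussStieltjesDeriv_eq' {w : ℂ} (hw : 0 < w.im) :
    gaussStieltjesDeriv w = -(1 + w * gaussStieltjes w) := by
  rw [gaussStieltjesDeriv_eq hw, halfMoment_one hw.le, gaussStieltjes_eq hw]
  ring

/-- A second integration by parts shows that 1 + w m_G(w) decays like 1/|w|, uniformly up to the
real axis. -/
lemma norm_one_add_mul_gaussStieltjes_le {w : ℂ} (hw : 0 < w.im) :
    ‖1 + w * gaussStieltjes w‖ * ‖w‖ ≤ absHalfMoment 0 + absHalfMoment 2 := by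
  have h1 : 1 + w * gaussStieltjes w = halfMoment 1 w := by
    rw [gaussStieltjes_eq hw, halfMoment_one hw.le]; ring
  have h2 : halfMoment 1 w * w = I * (halfMoment 0 w - halfMoment 2 w) := by
    rw [halfMoment_two hw.le]
    linear_combination (w * halfMoment 1 w) * I_sq
  rw [h1, ← norm_mul, h2, norm_mul, norm_I, one_mul]
  exact (norm_sub_le _ _).trans (add_le_add (norm_halfMoment_le hw.le 0) (norm_halfMoment_le hw.le 2))

lemma gaussStieltjes_sub {w₁ w₂ : ℂ} (h1 : 0 < w₁.im) (h2 : 0 < w₂.im) :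
    gaussStieltjes w₁ - gaussStieltjes w₂ =
      (w₁ - w₂) * ∫ x : ℝ, 1 / ((x : ℂ) - w₁) * (1 / ((x : ℂ) - w₂)) ∂stdGauss := by
  rw [gaussStieltjes, gaussStieltjes, ← integral_sub (integrable_one_div h1) (integrable_one_div h2),
    ← integral_const_mul]
  congr 1; ext x
  have := ofReal_sub_ne_zero x h1
  have := ofReal_sub_ne_zero x h2
  field_simp
  ring

lemma one_div_im (x : ℝ) (w : ℂ) : (1 / ((x : ℂ) - w)).im = w.im * ‖1 / ((x : ℂ) - w)‖ ^ 2 := by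
  rw [one_div, inv_im, normSq_eq_norm_sq, norm_inv]
  simp [div_eq_mul_inv]

lemma gaussStieltjes_im {w : ℂ} (hw : 0 < w.im) :
    (gaussStieltjes w).im = w.im * ∫ x : ℝ, ‖1 / ((x : ℂ) - w)‖ ^ 2 ∂stdGauss := by
  have : (gaussStieltjes w).im = ∫ x : ℝ, (1 / ((x : ℂ) - w)).im ∂stdGauss :=
    (integral_im (integrable_one_div hw)).symm
  rw [this, ← integral_const_mul]
  congr 1; ext x
  exact one_div_im x w

/-- Lower bound on the imaginary part near the real axis. -/
lemma gaussStieltjes_im_ge {K : ℝ} {w : ℂ} (hw : 0 < w.im) (hK : ‖w‖ ≤ K) :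
    gaussianPDFReal 0 1 (2 * K) ≤ (gaussStieltjes w).im := by
  have hK0 : 0 < K := lt_of_lt_of_le (hw.trans_le ((le_abs_self _).trans (abs_im_le_norm w))) hK
  set a := w.re
  set s := w.im
  have ha : |a| ≤ K := (abs_re_le_norm w).trans hK
  have hs : s ≤ K := ((le_abs_self _).trans (abs_im_le_norm w)).trans hK
  have hint : Integrable (fun x : ℝ => gaussianPDFReal 0 1 x * (s * ‖1 / ((x : ℂ) - w)‖ ^ 2)) := by
    refine (integrable_gaussianPDFReal 0 1).mul_bdd (c := s * (1 / s) ^ 2) (Measurable.aestronglyMeasurable (by fun_prop))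
      (ae_of_all _ fun x => ?_)
    rw [Real.norm_of_nonneg (by positivity)]
    gcongr
    exact norm_one_div_le x hw le_rfl
  have h1 : (gaussStieltjes w).im =
      ∫ x : ℝ, gaussianPDFReal 0 1 x * (s * ‖1 / ((x : ℂ) - w)‖ ^ 2) := by
    rw [gaussStieltjes_im hw, ← integral_const_mul,
      integral_gaussianReal_eq_integral_smul one_ne_zero]
    simp [s]
  have hnn : ∀ x : ℝ, 0 ≤ gaussianPDFReal 0 1 x * (s * ‖1 / ((x : ℂ) - w)‖ ^ 2) := fun x => by
    have := gaussianPDFReal_nonneg 0 1 x; positivity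
  rw [h1]
  -- On the interval of radius s = Im w around Re w, the Poisson kernel is at least 1/(2s) and the
  -- density at least its value at 2K, since |x| ≤ 2K there.
  calc gaussianPDFReal 0 1 (2 * K) = ∫ x in Icc (a - s) (a + s),
        gaussianPDFReal 0 1 (2 * K) * (1 / (2 * s)) := by
        rw [setIntegral_const, Real.volume_real_Icc_of_le (by linarith)]
        simp; field_simp; ring
    _ ≤ ∫ x in Icc (a - s) (a + s), gaussianPDFReal 0 1 x * (s * ‖1 / ((x : ℂ) - w)‖ ^ 2) := by
        refine setIntegral_mono_on (by exact integrableOn_const (by simp)) hint.integrableOn measurableSet_Icc fun x hx => ?_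
        have hx1 : |x - a| ≤ s := abs_le.2 ⟨by linarith [hx.1], by linarith [hx.2]⟩
        have hx2 : |x| ≤ 2 * K := by
          have := abs_add_le (x - a) a
          rw [sub_add_cancel] at this
          linarith
        have hx3 : x ^ 2 ≤ (2 * K) ^ 2 := by
          rw [← sq_abs]; exact pow_le_pow_left₀ (abs_nonneg _) hx2 2
        have hp : gaussianPDFReal 0 1 (2 * K) ≤ gaussianPDFReal 0 1 x := by
          simp only [gaussianPDFReal, NNReal.coe_one, sub_zero]
          gcongr
        have hq : 1 / (2 * s) ≤ s * ‖1 / ((x : ℂ) - w)‖ ^ 2 := by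
          have e : ‖(x : ℂ) - w‖ ^ 2 = (x - a) ^ 2 + s ^ 2 := by
            rw [← normSq_eq_norm_sq, normSq_apply]; simp [a, s]; ring
          rw [norm_div, norm_one, one_div_pow, e, mul_one_div, div_le_div_iff₀ (by positivity)
            (by positivity)]
          have : (x - a) ^ 2 ≤ s ^ 2 := by
            rw [← sq_abs (x - a)]; exact pow_le_pow_left₀ (abs_nonneg _) hx1 2
          nlinarith
        exact mul_le_mul hp hq (by positivity) (gaussianPDFReal_nonneg 0 1 x)
    _ ≤ _ := setIntegral_le_integral hint (ae_of_all _ hnn)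

end GaussianStieltjes

end LaplacianRigidity
end

/-! ### Subordination: inverting w - m_G(w) up to the real line. -/

noncomputable section
namespace LaplacianRigidity

section Subordination

open Complex Set

lemma isOpen_upper : IsOpen {u : ℂ | 0 < u.im} := isOpen_lt continuous_const continuous_im

/-- The mean square of the Gaussian resolvent. -/
def gaussSq (w : ℂ) : ℝ := ∫ x : ℝ, ‖1 / ((x : ℂ) - w)‖ ^ 2 ∂stdGauss

lemma integrable_norm_one_div_sq {w : ℂ} (hw : 0 < w.im) :
    Integrable (fun x : ℝ => ‖1 / ((x : ℂ) - w)‖ ^ 2) stdGauss := by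
  refine Integrable.of_bound (C := (1 / w.im) ^ 2) (Measurable.aestronglyMeasurable (by fun_prop))
    (ae_of_all _ fun x => ?_)
  rw [norm_pow, norm_norm]
  exact pow_le_pow_left₀ (norm_nonneg _) (norm_one_div_le x hw le_rfl) 2

/-- Im(w - m_G(w)) equals Im w times 1 - `gaussSq w`. -/
lemma gaussSq_le_one {w : ℂ} (hw : 0 < w.im) (h : 0 ≤ (w - gaussStieltjes w).im) :
    gaussSq w ≤ 1 := by
  rw [sub_im, gaussStieltjes_im hw] at h
  have : w.im * gaussSq w ≤ w.im * 1 := by rw [mul_one]; exact sub_nonneg.1 h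
  exact le_of_mul_le_mul_left this hw

/-- With u and v the two resolvent functions, the value 1 would give ∫ |ū - v|² ≤ 1 + 1 - 2 = 0. But
Im ū < 0 < Im v, so the integrand is positive everywhere. -/
lemma integral_one_div_mul_ne_one {w₁ w₂ : ℂ} (h1 : 0 < w₁.im) (h2 : 0 < w₂.im)
    (hs1 : gaussSq w₁ ≤ 1) (hs2 : gaussSq w₂ ≤ 1) :
    ∫ x : ℝ, 1 / ((x : ℂ) - w₁) * (1 / ((x : ℂ) - w₂)) ∂stdGauss ≠ 1 := by
  intro h
  set u : ℝ → ℂ := fun x => 1 / ((x : ℂ) - w₁) with hu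
  set v : ℝ → ℂ := fun x => 1 / ((x : ℂ) - w₂) with hv
  have hid : ∀ x, ‖(starRingEnd ℂ) (u x) - v x‖ ^ 2 =
      ‖u x‖ ^ 2 + ‖v x‖ ^ 2 - 2 * (u x * v x).re := by
    intro x
    rw [← normSq_eq_norm_sq, ← normSq_eq_norm_sq, ← normSq_eq_norm_sq, normSq_sub]
    simp [normSq_conj, mul_re]
  have hiu := integrable_norm_one_div_sq h1
  have hiv := integrable_norm_one_div_sq h2
  have hiuv := integrable_one_div_mul h1 h2
  have hre : ∫ x, (u x * v x).re ∂stdGauss = 1 := by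
    have : ∫ x, (u x * v x).re ∂stdGauss = (∫ x, u x * v x ∂stdGauss).re := integral_re hiuv
    rw [this, h, one_re]
  have hint : Integrable (fun x => ‖(starRingEnd ℂ) (u x) - v x‖ ^ 2) stdGauss := by
    simp_rw [hid]
    exact (hiu.add hiv).sub (hiuv.re.const_mul 2)
  have hle : ∫ x, ‖(starRingEnd ℂ) (u x) - v x‖ ^ 2 ∂stdGauss ≤ 0 := by
    simp_rw [hid]
    rw [integral_sub (f := fun x => ‖u x‖ ^ 2 + ‖v x‖ ^ 2) (g := fun x => 2 * (u x * v x).re)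
      (hiu.add hiv) (hiuv.re.const_mul 2), integral_add hiu hiv, integral_const_mul, hre]
    have e1 : ∫ x, ‖u x‖ ^ 2 ∂stdGauss = gaussSq w₁ := rfl
    have e2 : ∫ x, ‖v x‖ ^ 2 ∂stdGauss = gaussSq w₂ := rfl
    rw [e1, e2]; linarith
  have hpos : 0 < ∫ x, ‖(starRingEnd ℂ) (u x) - v x‖ ^ 2 ∂stdGauss := by
    rw [integral_pos_iff_support_of_nonneg (fun x => by positivity) hint]
    have : Function.support (fun x => ‖(starRingEnd ℂ) (u x) - v x‖ ^ 2) = univ := by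
      refine eq_univ_of_forall fun x => ?_
      rw [Function.mem_support]
      have hu0 : 0 < (u x).im := by
        rw [hu]; simp only [one_div_im]
        have : 1 / ((x : ℂ) - w₁) ≠ 0 := one_div_ne_zero (ofReal_sub_ne_zero x h1)
        have := norm_pos_iff.2 this
        positivity
      have hv0 : 0 < (v x).im := by
        rw [hv]; simp only [one_div_im]
        have : 1 / ((x : ℂ) - w₂) ≠ 0 := one_div_ne_zero (ofReal_sub_ne_zero x h2)
        have := norm_pos_iff.2 this
        positivity
      have : (starRingEnd ℂ) (u x) - v x ≠ 0 := by
        intro h0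
        have := congrArg im h0
        simp only [sub_im, conj_im, zero_im] at this
        linarith
      have := norm_pos_iff.2 this
      positivity
    rw [this]; simp
  exact absurd hle (not_le.2 hpos)

/-- Two distinct preimages would make the divided difference of m_G equal to 1, and that divided
difference is the integral just excluded. -/
lemma subordination_unique {w₁ w₂ : ℂ} (h1 : 0 < w₁.im) (h2 : 0 < w₂.im)
    (h : w₁ - gaussStieltjes w₁ = w₂ - gaussStieltjes w₂)
    (h0 : 0 ≤ (w₁ - gaussStieltjes w₁).im) : w₁ = w₂ := by
  by_contra hne
  have h0' := h0
  rw [h] at h0'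
  refine integral_one_div_mul_ne_one h1 h2 (gaussSq_le_one h1 h0) (gaussSq_le_one h2 h0') ?_
  have hs := gaussStieltjes_sub h1 h2
  have hne' : w₁ - w₂ ≠ 0 := sub_ne_zero.2 hne
  have : w₁ - w₂ = (w₁ - w₂) * ∫ x : ℝ, 1 / ((x : ℂ) - w₁) * (1 / ((x : ℂ) - w₂)) ∂stdGauss := by
    rw [← hs]; linear_combination h
  exact (mul_left_cancel₀ hne' (by rw [← this, mul_one])).symm

/-- The infinitesimal case w₁ = w₂ of injectivity. -/
lemma one_sub_deriv_ne_zero {w : ℂ} (hw : 0 < w.im) (h0 : 0 ≤ (w - gaussStieltjes w).im) :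
    1 - gaussStieltjesDeriv w ≠ 0 := by
  intro h
  have hs := gaussSq_le_one hw h0
  refine integral_one_div_mul_ne_one hw hw hs hs ?_
  rw [sub_eq_zero] at h
  refine Eq.trans ?_ h.symm
  rw [gaussStieltjesDeriv]
  congr 1; ext x
  rw [one_div_mul_one_div, pow_two]

lemma continuousAt_gaussStieltjesDeriv {w : ℂ} (hw : 0 < w.im) :
    ContinuousAt gaussStieltjesDeriv w := by
  have h : gaussStieltjesDeriv =ᶠ[𝓝 w] fun u => -(1 + u * gaussStieltjes u) := by
    filter_upwards [isOpen_upper.mem_nhds hw] with u hu using gaussStieltjesDeriv_eq' hu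
  refine ContinuousAt.congr ?_ h.symm
  have := (hasDerivAt_gaussStieltjes hw).continuousAt
  fun_prop

lemma hasStrictDerivAt_sub_gaussStieltjes {w : ℂ} (hw : 0 < w.im) :
    HasStrictDerivAt (fun w => w - gaussStieltjes w) (1 - gaussStieltjesDeriv w) w := by
  refine (hasStrictDerivAt_id w).sub ?_
  refine hasStrictDerivAt_of_hasDerivAt_of_continuousAt ?_ (continuousAt_gaussStieltjesDeriv hw)
  filter_upwards [isOpen_upper.mem_nhds hw] with u hu using hasDerivAt_gaussStieltjes hu

/-- The image of the set where F has nonzero derivative is open. It meets the closed upper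
half-plane in a relatively closed set, and connectedness of the half-plane finishes the argument.
Real z are included, which gives boundary values of m_fc. -/
lemma exists_subordination {z : ℂ} (hz : 0 ≤ z.im) :
    ∃ w : ℂ, 0 < w.im ∧ w - gaussStieltjes w = z := by
  set F : ℂ → ℂ := fun w => w - gaussStieltjes w with hF
  set U : Set ℂ := {w | 0 < w.im ∧ gaussStieltjesDeriv w ≠ 1} with hU
  have hUo : IsOpen U := by
    rw [isOpen_iff_mem_nhds]
    rintro w ⟨hw, hw'⟩
    filter_upwards [isOpen_upper.mem_nhds hw,
      (continuousAt_gaussStieltjesDeriv hw).eventually_ne hw'] with u h1 h2 using ⟨h1, h2⟩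
  have hopen : IsOpen (F '' U) := by
    rw [isOpen_iff_mem_nhds]
    rintro _ ⟨w, hw, rfl⟩
    have := (hasStrictDerivAt_sub_gaussStieltjes hw.1).map_nhds_eq
      (sub_ne_zero.2 (Ne.symm hw.2))
    rw [← this]
    exact image_mem_map (hUo.mem_nhds hw)
  have hmem : ∀ w : ℂ, 0 < w.im → 0 ≤ (F w).im → F w ∈ F '' U := fun w hw h0 =>
    ⟨w, ⟨hw, fun h => one_sub_deriv_ne_zero hw h0 (by rw [h, sub_self])⟩, rfl⟩
  have hconv : IsPreconnected {z : ℂ | 0 ≤ z.im} :=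
    (convex_halfSpace_im_ge 0).isPreconnected
  have hsub : {z : ℂ | 0 ≤ z.im} ⊆ F '' U := by
    refine hconv.subset_of_closure_inter_subset hopen ?_ ?_
    -- The base point is F(i): there |1/(x - i)| ≤ 1, so the mean square is at most 1.
    · have h0 : 0 ≤ (F I).im := by
        have h1 : gaussSq I ≤ 1 := by
          have : gaussSq I ≤ ∫ _ : ℝ, (1 : ℝ) ∂stdGauss := by
            refine integral_mono (integrable_norm_one_div_sq (by simp)) (integrable_const _)
              fun x => ?_
            have := norm_one_div_le x one_pos (w := I) (by simp)
            rw [div_one] at this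
            exact pow_le_one₀ (norm_nonneg _) this
          simpa using this
        have h2 := gaussStieltjes_im (w := I) (by simp)
        simp only [hF, sub_im, I_im, h2]
        simp only [I_im, one_mul] at h2 ⊢
        exact sub_nonneg.2 h1
      exact ⟨F I, h0, hmem I (by simp) h0⟩
    · rintro z ⟨hzc, hz0⟩
      have hz0' : 0 ≤ z.im := hz0
      -- Values within distance 1 of z have preimages with |w| ≤ K, so Im m_G(w) ≥ c. If moreover Im
      -- F(w) > -c/2, then Im w ≥ c/2, and the preimages stay in a compact set.
      set K : ℝ := ‖z‖ + 1 + absHalfMoment 0 with hK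
      set c : ℝ := gaussianPDFReal 0 1 (2 * K) with hc
      have hc0 : 0 < c := gaussianPDFReal_pos 0 1 _ one_ne_zero
      set Kc : Set ℂ := {w | ‖w‖ ≤ K ∧ c / 2 ≤ w.im} with hKc
      have hcomp : IsCompact Kc := by
        have : Kc = Metric.closedBall 0 K ∩ {w | c / 2 ≤ w.im} := by
          ext w; simp [hKc]
        rw [this]
        exact (isCompact_closedBall _ _).inter_right (isClosed_le continuous_const continuous_im)
      have hcont : ContinuousOn F Kc := fun w hw =>
        (hasStrictDerivAt_sub_gaussStieltjes
          ((half_pos hc0).trans_le hw.2)).hasDerivAt.continuousAt.continuousWithinAt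
      have hclosed : IsClosed (F '' Kc) := (hcomp.image_of_continuousOn hcont).isClosed
      have hnear : z ∈ closure (F '' U ∩ (Metric.ball z 1 ∩ {u | -(c / 2) < u.im})) := by
        have hn : Metric.ball z 1 ∩ {u : ℂ | -(c / 2) < u.im} ∈ 𝓝 z := by
          refine inter_mem (Metric.ball_mem_nhds z one_pos) ?_
          exact (isOpen_lt continuous_const continuous_im).mem_nhds (by
            simp only [mem_ofPred_eq]; linarith)
        rw [mem_closure_iff_nhds] at hzc ⊢
        intro t ht
        obtain ⟨u, ⟨hu1, hu2⟩, hu3⟩ := hzc _ (inter_mem ht hn)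
        exact ⟨u, hu1, hu3, hu2⟩
      have hss : F '' U ∩ (Metric.ball z 1 ∩ {u | -(c / 2) < u.im}) ⊆ F '' Kc := by
        rintro _ ⟨⟨w, hw, rfl⟩, hb, him⟩
        have hw0 : 0 < w.im := hw.1
        have hn : ‖w‖ ≤ K := by
          have h1 : ‖F w‖ ≤ ‖z‖ + 1 := by
            have := norm_le_norm_add_norm_sub' (F w) z
            rw [Metric.mem_ball, dist_eq_norm] at hb
            linarith
          have h2 : w = F w + gaussStieltjes w := by simp [hF]
          have h3 := norm_add_le (F w) (gaussStieltjes w)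
          rw [← h2] at h3
          have := norm_gaussStieltjes_le hw0
          linarith
        refine ⟨w, ⟨hn, ?_⟩, rfl⟩
        have h4 := gaussStieltjes_im_ge hw0 hn
        have h5 : -(c / 2) < (F w).im := him
        simp only [hF, sub_im] at h5
        linarith
      obtain ⟨w, hw, rfl⟩ := closure_minimal hss hclosed hnear
      exact hmem w ((half_pos hc0).trans_le hw.2) hz0'
  obtain ⟨w, hw, hwz⟩ := hsub hz
  exact ⟨w, hw.1, hwz⟩

/-- The subordination function: the solution `w` of `w - m_G(w) = z` in the upper half-plane. -/
def subord (z : ℂ) : ℂ := Classical.epsilon fun w : ℂ => 0 < w.im ∧ w - gaussStieltjes w = z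

lemma subord_spec {z : ℂ} (hz : 0 ≤ z.im) :
    0 < (subord z).im ∧ subord z - gaussStieltjes (subord z) = z :=
  Classical.epsilon_spec (exists_subordination hz)

lemma subord_im_pos {z : ℂ} (hz : 0 ≤ z.im) : 0 < (subord z).im := (subord_spec hz).1

lemma subord_eq {z : ℂ} (hz : 0 ≤ z.im) : subord z - z = gaussStieltjes (subord z) := by
  have := (subord_spec hz).2
  linear_combination this

lemma eq_subord {z w : ℂ} (hz : 0 ≤ z.im) (hw : 0 < w.im) (h : w - gaussStieltjes w = z) :
    w = subord z :=
  subordination_unique hw (subord_im_pos hz) (h.trans (subord_spec hz).2.symm) (by rw [h]; exact hz)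

lemma one_sub_deriv_subord_ne_zero {z : ℂ} (hz : 0 ≤ z.im) :
    1 - gaussStieltjesDeriv (subord z) ≠ 0 :=
  one_sub_deriv_ne_zero (subord_im_pos hz) (by rw [(subord_spec hz).2]; exact hz)

/-- Near `subord z` the local inverse of F lies in the upper half-plane and solves the equation, so
by uniqueness it is `subord` on the closed half-plane. The derivative is taken within that
half-plane so that real z are allowed. -/
lemma hasDerivWithinAt_subord {z : ℂ} (hz : 0 ≤ z.im) :
    HasDerivWithinAt subord (1 - gaussStieltjesDeriv (subord z))⁻¹ {z | 0 ≤ z.im} z := by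
  have hs := hasStrictDerivAt_sub_gaussStieltjes (subord_im_pos hz)
  have hne := one_sub_deriv_subord_ne_zero hz
  set g := hs.localInverse _ _ _ hne with hg
  have hgd : HasStrictDerivAt g (1 - gaussStieltjesDeriv (subord z))⁻¹ z := by
    have := hs.to_localInverse hne
    rwa [(subord_spec hz).2] at this
  have hgz : g z = subord z := by
    have := (hs.eventually_left_inverse hne).self_of_nhds
    rwa [(subord_spec hz).2] at this
  have hri : ∀ᶠ u in 𝓝 z, g u - gaussStieltjes (g u) = u := by
    have := hs.eventually_right_inverse hne
    rwa [(subord_spec hz).2] at this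
  have him : ∀ᶠ u in 𝓝 z, 0 < (g u).im := by
    have : g z ∈ {u : ℂ | 0 < u.im} := by rw [hgz]; exact subord_im_pos hz
    exact hgd.hasDerivAt.continuousAt.eventually (isOpen_upper.mem_nhds this)
  refine hgd.hasDerivAt.hasDerivWithinAt.congr_of_eventuallyEq ?_ hgz.symm
  filter_upwards [mem_nhdsWithin_of_mem_nhds hri, mem_nhdsWithin_of_mem_nhds him,
    self_mem_nhdsWithin] with u h1 h2 h3
  exact (eq_subord h3 h2 h1).symm

lemma continuousWithinAt_subord {z : ℂ} (hz : 0 ≤ z.im) :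
    ContinuousWithinAt subord {z | 0 ≤ z.im} z := (hasDerivWithinAt_subord hz).continuousWithinAt

/-- The Stieltjes transform of the free convolution, extended to the closed upper half-plane. -/
def freeStieltjes (z : ℂ) : ℂ := subord z - z

lemma freeStieltjes_eq {z : ℂ} (hz : 0 ≤ z.im) :
    freeStieltjes z = gaussStieltjes (subord z) := subord_eq hz

lemma norm_freeStieltjes_le {z : ℂ} (hz : 0 ≤ z.im) : ‖freeStieltjes z‖ ≤ absHalfMoment 0 := by
  rw [freeStieltjes_eq hz]; exact norm_gaussStieltjes_le (subord_im_pos hz)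

lemma gaussStieltjes_im_pos {w : ℂ} (hw : 0 < w.im) : 0 < (gaussStieltjes w).im :=
  (gaussianPDFReal_pos 0 1 _ one_ne_zero).trans_le (gaussStieltjes_im_ge hw le_rfl)

lemma freeStieltjes_im_pos {z : ℂ} (hz : 0 ≤ z.im) : 0 < (freeStieltjes z).im := by
  rw [freeStieltjes_eq hz]; exact gaussStieltjes_im_pos (subord_im_pos hz)

lemma im_le_subord_im {z : ℂ} (hz : 0 ≤ z.im) : z.im ≤ (subord z).im := by
  have := freeStieltjes_im_pos hz
  rw [freeStieltjes, sub_im] at this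
  linarith

lemma gaussStieltjes_eq_pdf (w : ℂ) :
    gaussStieltjes w = ∫ x : ℝ, (gaussianPDFReal 0 1 x : ℂ) / ((x : ℂ) - w) := by
  rw [gaussStieltjes, integral_gaussianReal_eq_integral_smul one_ne_zero]
  congr 1; ext x
  rw [real_smul, mul_one_div]

lemma norm_gaussStieltjes_le_div {w : ℂ} (hw : 0 < w.im) (h1 : 1 ≤ ‖w‖) :
    ‖gaussStieltjes w‖ ≤ (1 + (absHalfMoment 0 + absHalfMoment 2)) / ‖w‖ := by
  have h := norm_one_add_mul_gaussStieltjes_le hw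
  have h2 : ‖w * gaussStieltjes w‖ ≤ ‖1 + w * gaussStieltjes w‖ + 1 := by
    have := norm_sub_le (1 + w * gaussStieltjes w) 1
    rw [norm_one, add_sub_cancel_left] at this
    exact this
  rw [norm_mul] at h2
  rw [le_div_iff₀ (by linarith)]
  nlinarith [norm_nonneg (1 + w * gaussStieltjes w)]

/-- With w = `subord z`, the equation z = w - m_G(w) gives z m + 1 = (1 + w m) - m². -/
lemma norm_mul_freeStieltjes_add_one_le {z : ℂ} (hz : 0 ≤ z.im) (h1 : 1 ≤ ‖subord z‖) :
    ‖z * freeStieltjes z + 1‖ ≤ (absHalfMoment 0 + absHalfMoment 2 +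
      absHalfMoment 0 * (1 + (absHalfMoment 0 + absHalfMoment 2))) / ‖subord z‖ := by
  have hw := subord_im_pos hz
  have hp : 0 < ‖subord z‖ := by linarith
  have e : z * freeStieltjes z + 1 = (1 + subord z * gaussStieltjes (subord z)) -
      gaussStieltjes (subord z) * gaussStieltjes (subord z) := by
    rw [freeStieltjes_eq hz]
    have := (subord_spec hz).2
    linear_combination -gaussStieltjes (subord z) * this
  have a1 := norm_one_add_mul_gaussStieltjes_le hw
  have a2 := norm_gaussStieltjes_le_div hw h1
  have a3 := norm_gaussStieltjes_le hw
  rw [e, add_div, mul_div_assoc]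
  refine (norm_sub_le _ _).trans (add_le_add ?_ ?_)
  · rwa [le_div_iff₀ hp]
  · rw [norm_mul]
    gcongr
    exact absHalfMoment_nonneg 0

lemma norm_le_norm_subord_add {z : ℂ} (hz : 0 ≤ z.im) :
    ‖z‖ ≤ ‖subord z‖ + absHalfMoment 0 := by
  have h1 := norm_freeStieltjes_le hz
  have h2 := norm_sub_le (subord z) (freeStieltjes z)
  have e : subord z - freeStieltjes z = z := by rw [freeStieltjes]; ring
  rw [e] at h2
  linarith

lemma tendsto_norm_subord {α : Type*} {l : Filter α} {f : α → ℂ} (hf : Tendsto (fun a => ‖f a‖) l atTop)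
    (him : ∀ᶠ a in l, 0 ≤ (f a).im) : Tendsto (fun a => ‖subord (f a)‖) l atTop := by
  refine tendsto_atTop_mono' l (f₁ := fun a => ‖f a‖ - absHalfMoment 0) ?_
    (tendsto_atTop_add_const_right l _ hf)
  filter_upwards [him] with a ha
  linarith [norm_le_norm_subord_add ha]

lemma isFreeConvolutionStieltjes_freeStieltjes : IsFreeConvolutionStieltjes freeStieltjes where
  self_consistent z hz := by
    have h1 := freeStieltjes_eq hz.le
    have h2 := gaussStieltjes_eq_pdf (subord z)
    rw [h1, h2]
    congr 1; ext x
    rw [sub_sub, ← h2, ← h1, freeStieltjes, add_sub_cancel]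
  im_nonneg z hz := (freeStieltjes_im_pos hz.le).le
  asymptotic := by
    set l := comap norm atTop ⊓ 𝓟 {z : ℂ | 0 < z.im}
    have hn : Tendsto (fun z : ℂ => ‖z‖) l atTop := tendsto_comap.mono_left inf_le_left
    have him : ∀ᶠ z : ℂ in l, 0 ≤ z.im := by
      have h : {z : ℂ | 0 < z.im} ∈ l := mem_inf_of_right (mem_principal_self _)
      filter_upwards [h] with z hz using le_of_lt hz
    have hw := tendsto_norm_subord hn him
    rw [tendsto_iff_norm_sub_tendsto_zero]
    refine squeeze_zero' (Eventually.of_forall fun _ => norm_nonneg _) ?_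
      (Tendsto.div_atTop (tendsto_const_nhds (x := absHalfMoment 0 + absHalfMoment 2 +
        absHalfMoment 0 * (1 + (absHalfMoment 0 + absHalfMoment 2)))) hw)
    filter_upwards [him, hw.eventually_ge_atTop 1] with z hz h1
    have := norm_mul_freeStieltjes_add_one_le hz h1
    rwa [sub_neg_eq_add]

/-- The equation and the sign of the imaginary part place z + m in the upper half-plane as a
preimage of z under F, and that preimage is unique. -/
lemma mfc_eq {z : ℂ} (hz : 0 < z.im) : mfc z = freeStieltjes z := by
  have h : IsFreeConvolutionStieltjes mfc :=
    Classical.epsilon_spec ⟨_, isFreeConvolutionStieltjes_freeStieltjes⟩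
  have h1 := h.self_consistent z hz
  have him : 0 < (z + mfc z).im := by
    have := h.im_nonneg z hz
    rw [add_im]; linarith
  have h2 : mfc z = gaussStieltjes (z + mfc z) := by
    rw [gaussStieltjes_eq_pdf]
    simp_rw [← sub_sub]
    exact h1
  have := eq_subord hz.le him (by rw [← h2]; ring)
  rw [freeStieltjes, ← this]; ring

/-- The subordination function is continuous up to the real axis, so the inversion limit is a
boundary value. -/
lemma rhofc_eq (E : ℝ) : rhofc E = (freeStieltjes E).im / Real.pi := by
  have hE : (0 : ℝ) ≤ (E : ℂ).im := by simp
  have h1 : Tendsto (fun η : ℝ => (E : ℂ) + I * (η : ℂ)) (𝓝[>] 0) (𝓝[{z | 0 ≤ z.im}] (E : ℂ)) := by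
    refine tendsto_nhdsWithin_iff.2 ⟨?_, ?_⟩
    · have : ContinuousAt (fun η : ℝ => (E : ℂ) + I * (η : ℂ)) 0 := by fun_prop
      have h := this.tendsto
      simp only [ofReal_zero, mul_zero, add_zero] at h
      exact h.mono_left nhdsWithin_le_nhds
    · filter_upwards [self_mem_nhdsWithin] with η hη
      have : (0 : ℝ) < η := hη
      simp [this.le]
  have h2 : Tendsto freeStieltjes (𝓝[{z | 0 ≤ z.im}] (E : ℂ)) (𝓝 (freeStieltjes E)) :=
    (continuousWithinAt_subord hE).sub continuousWithinAt_id
  have h3 := (continuous_im.tendsto _).comp (h2.comp h1)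
  have h4 : Tendsto (fun η : ℝ => 1 / Real.pi * (mfc ((E : ℂ) + I * (η : ℂ))).im) (𝓝[>] 0)
      (𝓝 (1 / Real.pi * (freeStieltjes E).im)) := by
    refine (h3.const_mul (1 / Real.pi)).congr' ?_
    filter_upwards [self_mem_nhdsWithin] with η hη
    have : (0 : ℝ) < η := hη
    simp only [Function.comp]
    rw [mfc_eq (by simpa using this)]
  rw [rhofc, h4.limUnder_eq]
  ring

end Subordination

end LaplacianRigidity
end

/-! ### Logarithmic potential and distribution function of the free convolution. -/

noncomputable section
namespace LaplacianRigidity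

section Potential

open Complex Set

lemma abs_arctan_le (t : ℝ) : |Real.arctan t| ≤ |t| := by
  have key : ∀ t : ℝ, 0 ≤ t → |Real.arctan t| ≤ |t| := by
    intro t ht
    rw [abs_of_nonneg ht, abs_of_nonneg (Real.arctan_nonneg.2 ht)]
    have := Real.le_tan (Real.arctan_nonneg.2 ht) (Real.arctan_lt_pi_div_two t)
    rwa [Real.tan_arctan] at this
  rcases le_total 0 t with h | h
  · exact key t h
  · have := key (-t) (by linarith)
    rwa [Real.arctan_neg, abs_neg, abs_neg] at this

lemma arg_eq_arctan {ζ : ℂ} (h : ζ.im < 0) :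
    arg ζ = Real.arctan (ζ.re / -ζ.im) - Real.pi / 2 := by
  set t := ζ.re / -ζ.im with ht
  have hs : 0 < √(1 + t ^ 2) := Real.sqrt_pos.2 (by positivity)
  have h1 := Real.neg_pi_div_two_lt_arctan t
  have h2 := Real.arctan_lt_pi_div_two t
  have hθ : Real.arctan t - Real.pi / 2 ∈ Ioc (-Real.pi) Real.pi :=
    ⟨by linarith, by linarith [Real.pi_pos]⟩
  have hr : 0 < -ζ.im * √(1 + t ^ 2) := mul_pos (by linarith) hs
  have := arg_mul_cos_add_sin_mul_I hr hθ
  rw [← this]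
  congr 1
  have hc : Real.cos (Real.arctan t - Real.pi / 2) = t / √(1 + t ^ 2) := by
    rw [Real.cos_sub_pi_div_two, Real.sin_arctan]
  have hsn : Real.sin (Real.arctan t - Real.pi / 2) = -(1 / √(1 + t ^ 2)) := by
    rw [Real.sin_sub_pi_div_two, Real.cos_arctan]
  rw [← ofReal_cos, ← ofReal_sin, hc, hsn]
  have him : ζ.im ≠ 0 := h.ne
  apply Complex.ext
  · rw [re_ofReal_mul]
    simp only [add_re, ofReal_re, mul_re, I_re, mul_zero, ofReal_im, I_im, zero_mul, sub_zero, add_zero]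
    rw [ht]; field_simp
  · rw [im_ofReal_mul]
    simp only [add_im, ofReal_im, mul_im, I_re, mul_zero, ofReal_re, I_im, mul_one, add_zero, zero_add]
    field_simp

lemma log_im_eq (x : ℝ) {w : ℂ} (hw : 0 < w.im) :
    (log ((x : ℂ) - w)).im = Real.arctan ((x - w.re) / w.im) - Real.pi / 2 := by
  rw [log_im, arg_eq_arctan (by simp [hw])]
  simp

/-- The logarithmic potential of the standard Gaussian law. -/
def logPot (w : ℂ) : ℂ := ∫ x : ℝ, log ((x : ℂ) - w) ∂stdGauss

lemma measurable_log_sub (w : ℂ) : Measurable fun x : ℝ => log ((x : ℂ) - w) :=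
  measurable_log.comp (by fun_prop)

lemma integrable_abs_stdGauss : Integrable (fun x : ℝ => |x|) stdGauss :=
  ((memLp_id_gaussianReal (μ := 0) (v := 1) 1).integrable (by simp)).abs

lemma integrable_log_sub {w : ℂ} (hw : 0 < w.im) :
    Integrable (fun x : ℝ => log ((x : ℂ) - w)) stdGauss := by
  refine Integrable.mono' (g := fun x => |x| + (‖w‖ + 1 / w.im + Real.pi))
    (integrable_abs_stdGauss.add (integrable_const _))
    (measurable_log_sub w).aestronglyMeasurable (ae_of_all _ fun x => ?_)
  have hp := hw.trans_le (im_le_norm_ofReal_sub x hw)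
  have h1 : ‖log ((x : ℂ) - w)‖ ≤ |Real.log ‖(x : ℂ) - w‖| + Real.pi := by
    refine (norm_le_abs_re_add_abs_im _).trans ?_
    rw [log_re, log_im]
    gcongr
    exact abs_arg_le_pi _
  have h2 : |Real.log ‖(x : ℂ) - w‖| ≤ ‖(x : ℂ) - w‖ + 1 / w.im := by
    have h3 := Real.log_le_self hp.le
    have h4 := Real.one_sub_inv_le_log_of_pos hp
    have h5 : ‖(x : ℂ) - w‖⁻¹ ≤ 1 / w.im := by
      rw [← one_div]; exact one_div_le_one_div_of_le hw (im_le_norm_ofReal_sub x hw)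
    have : 0 < 1 / w.im := by positivity
    rw [abs_le]; constructor <;> linarith
  have h6 : ‖(x : ℂ) - w‖ ≤ |x| + ‖w‖ := by
    refine (norm_sub_le _ _).trans_eq ?_
    rw [norm_real, Real.norm_eq_abs]
  linarith

lemma hasDerivAt_logPot {w : ℂ} (hw : 0 < w.im) : HasDerivAt logPot (-gaussStieltjes w) w := by
  have hopen : IsOpen {u : ℂ | w.im / 2 < u.im} := isOpen_lt continuous_const continuous_im
  have := (hasDerivAt_integral_of_dominated_loc_of_deriv_le (μ := stdGauss)
    (F := fun (u : ℂ) (x : ℝ) => log ((x : ℂ) - u))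
    (F' := fun (u : ℂ) (x : ℝ) => -(1 / ((x : ℂ) - u)))
    (bound := fun _ => 1 / (w.im / 2))
    (hopen.mem_nhds (by simp [hw] : w ∈ {u : ℂ | w.im / 2 < u.im}))
    (Eventually.of_forall fun u => (measurable_log_sub u).aestronglyMeasurable)
    (integrable_log_sub hw) (Measurable.aestronglyMeasurable (by fun_prop)) ?_
    (integrable_const _) ?_).2
  · rw [integral_neg] at this
    exact this
  · refine ae_of_all _ fun x u hu => ?_
    rw [norm_neg]
    exact norm_one_div_le x (half_pos hw) (le_of_lt hu)
  · refine ae_of_all _ fun x u hu => ?_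
    have hu' : 0 < u.im := (half_pos hw).trans hu
    have := ((hasDerivAt_id u).const_sub (x : ℂ)).clog (Or.inr (by simp [hu'.ne']))
    simpa [neg_div] using this

lemma logPot_im {w : ℂ} (hw : 0 < w.im) :
    (logPot w).im = ∫ x : ℝ, (Real.arctan ((x - w.re) / w.im) - Real.pi / 2) ∂stdGauss := by
  have : (logPot w).im = ∫ x : ℝ, (log ((x : ℂ) - w)).im ∂stdGauss :=
    (integral_im (integrable_log_sub hw)).symm
  rw [this]
  simp_rw [log_im_eq _ hw]

/-- The logarithmic potential of the free convolution. -/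
def freePot (z : ℂ) : ℂ := logPot (subord z) + freeStieltjes z ^ 2 / 2

/-- The chain rule gives -m w' + m (w' - 1): the quadratic correction is there to cancel w'. -/
lemma hasDerivWithinAt_freePot {z : ℂ} (hz : 0 ≤ z.im) :
    HasDerivWithinAt freePot (-freeStieltjes z) {z | 0 ≤ z.im} z := by
  have h1 := hasDerivWithinAt_subord hz
  have h2 := (hasDerivAt_logPot (subord_im_pos hz)).comp_hasDerivWithinAt z h1
  have h3 : HasDerivWithinAt freeStieltjes ((1 - gaussStieltjesDeriv (subord z))⁻¹ - 1)
      {z | 0 ≤ z.im} z := h1.sub (hasDerivWithinAt_id z _)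
  have h4 := h2.add ((h3.pow 2).div_const 2)
  convert! h4 using 1
  rw [← freeStieltjes_eq hz]
  simp
  ring

lemma norm_freePot_sub_le {z₁ z₂ : ℂ} (h1 : 0 ≤ z₁.im) (h2 : 0 ≤ z₂.im) :
    ‖freePot z₂ - freePot z₁‖ ≤ absHalfMoment 0 * ‖z₂ - z₁‖ :=
  (convex_halfSpace_im_ge 0).norm_image_sub_le_of_norm_hasDerivWithin_le
    (fun z hz => hasDerivWithinAt_freePot hz)
    (fun z hz => by rw [norm_neg]; exact norm_freeStieltjes_le hz) h1 h2

/-- The distribution function of the free convolution. -/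
def freeCdf (E : ℝ) : ℝ := -(freePot E).im / Real.pi

lemma hasDerivAt_freeCdf (E : ℝ) : HasDerivAt freeCdf (rhofc E) E := by
  have hE : (0 : ℝ) ≤ (E : ℂ).im := by simp
  have h1 := (hasDerivWithinAt_freePot hE).scomp_hasDerivAt (h := fun x : ℝ => (x : ℂ)) E
    (hasDerivAt_id E).ofReal_comp (fun x => by simp)
  have h2 : HasDerivAt (fun x : ℝ => (freePot x).im) (-freeStieltjes E).im E := by
    have := (imCLM.hasFDerivAt.comp_hasDerivAt E h1)
    simpa using! this
  have h3 := (h2.neg).div_const Real.pi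
  rw [rhofc_eq]
  simpa using! h3

lemma rhofc_pos (E : ℝ) : 0 < rhofc E := by
  rw [rhofc_eq]
  exact div_pos (freeStieltjes_im_pos (by simp)) Real.pi_pos

lemma continuous_rhofc : Continuous rhofc := by
  have : rhofc = fun E : ℝ => (freeStieltjes E).im / Real.pi := funext rhofc_eq
  rw [this]
  have h : ContinuousOn freeStieltjes {z | 0 ≤ z.im} := fun z hz =>
    (continuousWithinAt_subord hz).sub continuousWithinAt_id
  have h2 : Continuous fun E : ℝ => freeStieltjes E :=
    h.comp_continuous continuous_ofReal (fun x => by simp)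
  exact (continuous_im.comp h2).div_const _

lemma strictMono_freeCdf : StrictMono freeCdf :=
  strictMono_of_deriv_pos fun x => by rw [(hasDerivAt_freeCdf x).deriv]; exact rhofc_pos x

lemma continuous_freeCdf : Continuous freeCdf :=
  continuous_iff_continuousAt.2 fun x => (hasDerivAt_freeCdf x).continuousAt

lemma freePot_im {z : ℂ} (hz : 0 ≤ z.im) :
    (freePot z).im = ∫ x : ℝ, (Real.arctan ((x - (subord z).re) / (subord z).im) - Real.pi / 2)
      ∂stdGauss + (freeStieltjes z ^ 2 / 2).im := by
  rw [freePot, add_im, logPot_im (subord_im_pos hz)]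

lemma abs_arctan_sub_le (t : ℝ) : ‖Real.arctan t - Real.pi / 2‖ ≤ Real.pi := by
  rw [Real.norm_eq_abs, abs_le]
  have h1 := Real.neg_pi_div_two_lt_arctan t
  have h2 := Real.arctan_lt_pi_div_two t
  constructor <;> linarith [Real.pi_pos]

/-- Limit of the potential along the real axis, given the direction of escape. -/
lemma tendsto_freePot_im {l : Filter ℝ} [l.IsCountablyGenerated]
    (hl : Tendsto (fun E : ℝ => |E|) l atTop) {L : Filter ℝ} {θ : ℝ}
    (hθ : Tendsto Real.arctan L (𝓝 θ))
    (hE : ∀ x : ℝ, Tendsto (fun E : ℝ => (x - (subord E).re) / (subord E).im) l L) :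
    Tendsto (fun E : ℝ => (freePot E).im) l (𝓝 (θ - Real.pi / 2)) := by
  have hre : ∀ E : ℝ, (0 : ℝ) ≤ (E : ℂ).im := fun E => by simp
  simp_rw [fun E : ℝ => freePot_im (hre E)]
  have hw : Tendsto (fun E : ℝ => ‖subord E‖) l atTop :=
    tendsto_norm_subord (by simpa using hl) (Eventually.of_forall hre)
  have h1 : Tendsto (fun E : ℝ => ∫ x : ℝ,
      (Real.arctan ((x - (subord E).re) / (subord E).im) - Real.pi / 2) ∂stdGauss) l
      (𝓝 (∫ _ : ℝ, (θ - Real.pi / 2) ∂stdGauss)) := by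
    refine tendsto_integral_filter_of_dominated_convergence (fun _ => Real.pi)
      (Eventually.of_forall fun E => Measurable.aestronglyMeasurable (by fun_prop))
      (Eventually.of_forall fun E => ae_of_all _ fun x => abs_arctan_sub_le _)
      (integrable_const _) (ae_of_all _ fun x => ?_)
    exact (hθ.comp (hE x)).sub_const _
  have h2 : Tendsto (fun E : ℝ => freeStieltjes E) l (𝓝 0) := by
    rw [tendsto_zero_iff_norm_tendsto_zero]
    refine squeeze_zero' (Eventually.of_forall fun _ => norm_nonneg _) ?_
      (Tendsto.div_atTop (tendsto_const_nhds
        (x := 1 + (absHalfMoment 0 + absHalfMoment 2))) hw)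
    filter_upwards [hw.eventually_ge_atTop 1] with E h1
    rw [freeStieltjes_eq (hre E)]
    exact norm_gaussStieltjes_le_div (subord_im_pos (hre E)) h1
  have h3 : Tendsto (fun E : ℝ => (freeStieltjes E ^ 2 / 2).im) l (𝓝 0) := by
    have := (continuous_im.tendsto _).comp ((h2.pow 2).div_const 2)
    rw [zero_pow two_ne_zero, zero_div, zero_im] at this
    exact this
  have := h1.add h3
  simpa using this

lemma subord_ofReal_im_le (E : ℝ) : (subord E).im ≤ absHalfMoment 0 := by
  have h := norm_freeStieltjes_le (z := E) (by simp)
  have h2 := (le_abs_self _).trans (abs_im_le_norm (freeStieltjes E))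
  rw [freeStieltjes] at h h2
  simp only [sub_im, ofReal_im, sub_zero] at h2
  linarith

lemma abs_subord_ofReal_re_sub_le (E : ℝ) : |(subord E).re - E| ≤ absHalfMoment 0 := by
  have h := norm_freeStieltjes_le (z := E) (by simp)
  have h2 := abs_re_le_norm (freeStieltjes E)
  rw [freeStieltjes] at h h2
  simp only [sub_re, ofReal_re] at h2
  linarith

lemma absHalfMoment_zero_pos : 0 < absHalfMoment 0 :=
  (subord_im_pos (z := 0) (by simp)).trans_le (by simpa using subord_ofReal_im_le 0)

/-- Re w stays within bounded distance of E and Im w is bounded, so the arctan arguments tend to +∞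
and the imaginary part of the potential tends to π/2 - π/2 = 0. -/
lemma tendsto_freeCdf_atBot : Tendsto freeCdf atBot (𝓝 0) := by
  have hπ := Real.pi_pos
  have := tendsto_freePot_im (l := atBot) (L := atTop) tendsto_abs_atBot_atTop
    (Real.tendsto_arctan_atTop.mono_right nhdsWithin_le_nhds) (fun x => ?_)
  · have := this.neg.div_const Real.pi
    simpa using! this
  · have h1 : Tendsto (fun E : ℝ => (x - absHalfMoment 0 - E) / absHalfMoment 0) atBot atTop :=
      (tendsto_atTop_add_const_left _ _ tendsto_neg_atBot_atTop).atTop_div_const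
        absHalfMoment_zero_pos
    refine tendsto_atTop_mono' _ ?_ h1
    filter_upwards [eventually_le_atBot (x - absHalfMoment 0)] with E hE
    have h2 := subord_ofReal_im_le E
    have h3 := (abs_le.1 (abs_subord_ofReal_re_sub_le E)).2
    have h4 := subord_im_pos (z := E) (by simp)
    have h5 := absHalfMoment_zero_pos
    rw [div_le_div_iff₀ h5 h4]
    exact mul_le_mul (by linarith) h2 h4.le (by linarith)

lemma tendsto_freeCdf_atTop : Tendsto freeCdf atTop (𝓝 1) := by
  have hπ := Real.pi_pos
  have := tendsto_freePot_im (l := atTop) (L := atBot) tendsto_abs_atTop_atTop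
    (Real.tendsto_arctan_atBot.mono_right nhdsWithin_le_nhds) (fun x => ?_)
  · have := this.neg.div_const Real.pi
    have e : -(-(Real.pi / 2) - Real.pi / 2) / Real.pi = 1 := by field_simp; ring
    rw [e] at this
    exact this
  · have h1 : Tendsto (fun E : ℝ => (x + absHalfMoment 0 - E) / absHalfMoment 0) atTop atBot :=
      (tendsto_atBot_add_const_left _ _ tendsto_neg_atTop_atBot).atBot_div_const
        absHalfMoment_zero_pos
    refine tendsto_atBot_mono' _ ?_ h1
    filter_upwards [eventually_ge_atTop (x + absHalfMoment 0)] with E hE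
    have h2 := subord_ofReal_im_le E
    have h3 := (abs_le.1 (abs_subord_ofReal_re_sub_le E)).1
    have h4 := subord_im_pos (z := E) (by simp)
    have h5 := absHalfMoment_zero_pos
    rw [div_le_div_iff₀ h4 h5]
    nlinarith

lemma integral_Iic_rhofc (γ : ℝ) : ∫ x in Iic γ, rhofc x = freeCdf γ := by
  have hint : ∀ a b : ℝ, ∫ x in a..b, rhofc x = freeCdf b - freeCdf a := fun a b =>
    intervalIntegral.integral_eq_sub_of_hasDerivAt (fun x _ => hasDerivAt_freeCdf x)
      (continuous_rhofc.intervalIntegrable a b)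
  have hI : IntegrableOn rhofc (Iic γ) := by
    refine integrableOn_Iic_of_intervalIntegral_norm_tendsto (l := atBot) (a := id)
      (freeCdf γ) γ (fun i => ?_) tendsto_id ?_
    · exact (continuous_rhofc.integrableOn_Icc).mono_set Ioc_subset_Icc_self
    · simp only [id, Real.norm_of_nonneg (rhofc_pos _).le, hint]
      simpa using (tendsto_const_nhds (x := freeCdf γ)).sub tendsto_freeCdf_atBot
  rw [integral_Iic_of_hasDerivAt_of_tendsto' (fun x _ => hasDerivAt_freeCdf x) hI
    tendsto_freeCdf_atBot, sub_zero]

lemma freeCdf_classicalLocation {N i : ℕ} (h0 : 0 < ((i : ℝ) - 1 / 2) / N)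
    (h1 : ((i : ℝ) - 1 / 2) / N < 1) :
    freeCdf (classicalLocation N i) = ((i : ℝ) - 1 / 2) / N := by
  have : ∃ γ, freeCdf γ = ((i : ℝ) - 1 / 2) / N := by
    obtain ⟨a, ha⟩ := (tendsto_freeCdf_atBot.eventually_lt_const h0).exists
    obtain ⟨b, hb⟩ := (tendsto_freeCdf_atTop.eventually_const_lt h1).exists
    exact mem_range_of_exists_le_of_exists_ge continuous_freeCdf ⟨a, ha.le⟩ ⟨b, hb.le⟩
  have h := Classical.epsilon_spec (p := fun γ : ℝ => ∫ x in Iic γ, rhofc x = ((i : ℝ) - 1 / 2) / N)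
    (by simpa only [integral_Iic_rhofc] using this)
  rwa [integral_Iic_rhofc] at h

/-- Lower bounds for the subordination function over a compact part of the spectrum. -/
lemma exists_subord_lower_bound (K : ℝ) : ∃ c : ℝ, 0 < c ∧ ∀ z : ℂ, |z.re| ≤ K → 0 ≤ z.im →
    c ≤ (subord z).im ∧ c ≤ ‖1 - gaussStieltjesDeriv (subord z)‖ := by
  set S : Set ℂ := Icc (-K) K ×ℂ Icc 0 2 with hS
  have hScomp : IsCompact S := isCompact_Icc.reProdIm isCompact_Icc
  have hSim : ∀ z ∈ S, 0 ≤ z.im := fun z hz => (mem_reProdIm.1 hz).2.1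
  have hcont : ContinuousOn (fun z => min (subord z).im ‖1 - gaussStieltjesDeriv (subord z)‖) S := by
    intro z hz
    have h1 := (continuousWithinAt_subord (hSim z hz)).mono (fun u hu => hSim u hu)
    have h2 := (continuousAt_gaussStieltjesDeriv (subord_im_pos (hSim z hz))).comp_continuousWithinAt
      h1
    exact (continuous_im.continuousAt.comp_continuousWithinAt h1).min
      ((continuousWithinAt_const.sub h2).norm)
  have hpos : ∀ z ∈ S, 0 < min (subord z).im ‖1 - gaussStieltjesDeriv (subord z)‖ := fun z hz =>
    lt_min (subord_im_pos (hSim z hz))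
      (norm_pos_iff.2 (one_sub_deriv_subord_ne_zero (hSim z hz)))
  -- At height 2 and above the derivative of m_G is at most 1/4, so compactness is needed only for a
  -- rectangle.
  have hbig : ∀ z : ℂ, 2 ≤ z.im → (1 / 2 : ℝ) ≤ (subord z).im ∧
      (1 / 2 : ℝ) ≤ ‖1 - gaussStieltjesDeriv (subord z)‖ := by
    intro z hz
    have h1 := im_le_subord_im (z := z) (by linarith)
    have h2 : ‖gaussStieltjesDeriv (subord z)‖ ≤ 1 / 4 := by
      have : ‖gaussStieltjesDeriv (subord z)‖ ≤ 1 / 4 * stdGauss.real univ := by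
        refine norm_integral_le_of_norm_le_const (ae_of_all _ fun x => ?_)
        rw [← one_div_pow, norm_pow]
        have := norm_one_div_le x (c := 2) two_pos (hz.trans h1)
        calc _ ≤ (1 / 2 : ℝ) ^ 2 := pow_le_pow_left₀ (norm_nonneg _) this 2
          _ = 1 / 4 := by norm_num
      simpa using this
    have h3 := norm_sub_norm_le (1 : ℂ) (gaussStieltjesDeriv (subord z))
    rw [norm_one] at h3
    exact ⟨by linarith, by linarith⟩
  have hsplit : ∀ z : ℂ, |z.re| ≤ K → 0 ≤ z.im → z ∈ S ∨ 2 ≤ z.im := by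
    intro z hr hi
    rcases le_total z.im 2 with h | h
    · exact Or.inl (mem_reProdIm.2 ⟨abs_le.1 hr, hi, h⟩)
    · exact Or.inr h
  -- A negative K makes the rectangle empty, and no minimizer exists.
  rcases S.eq_empty_or_nonempty with he | hne
  · refine ⟨1 / 2, by norm_num, fun z hr hi => ?_⟩
    rcases hsplit z hr hi with h | h
    · rw [he] at h; exact absurd h (notMem_empty z)
    · exact hbig z h
  · obtain ⟨z₀, hz₀, hmin⟩ := hScomp.exists_isMinOn hne hcont
    refine ⟨min (1 / 2) (min (subord z₀).im ‖1 - gaussStieltjesDeriv (subord z₀)‖),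
      lt_min (by norm_num) (hpos z₀ hz₀), fun z hr hi => ?_⟩
    rcases hsplit z hr hi with h | h
    · have := hmin h
      simp only [mem_ofPred_eq, le_min_iff] at this
      exact ⟨(min_le_right _ _).trans this.1, (min_le_right _ _).trans this.2⟩
    · have := hbig z h
      exact ⟨(min_le_left _ _).trans this.1, (min_le_left _ _).trans this.2⟩

lemma norm_subord_sub_le {K c : ℝ} (hc : 0 < c)
    (h : ∀ z : ℂ, |z.re| ≤ K → 0 ≤ z.im → c ≤ ‖1 - gaussStieltjesDeriv (subord z)‖)
    {z₁ z₂ : ℂ} (h1 : |z₁.re| ≤ K) (h1' : 0 ≤ z₁.im) (h2 : |z₂.re| ≤ K) (h2' : 0 ≤ z₂.im) :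
    ‖subord z₂ - subord z₁‖ ≤ 1 / c * ‖z₂ - z₁‖ := by
  have hconv : Convex ℝ {z : ℂ | |z.re| ≤ K ∧ 0 ≤ z.im} := by
    have : {z : ℂ | |z.re| ≤ K ∧ 0 ≤ z.im} =
        ({z | -K ≤ z.re} ∩ {z | z.re ≤ K}) ∩ {z | 0 ≤ z.im} := by
      ext z; simp [abs_le]
    rw [this]
    exact ((convex_halfSpace_re_ge _).inter (convex_halfSpace_re_le _)).inter
      (convex_halfSpace_im_ge _)
  refine hconv.norm_image_sub_le_of_norm_hasDerivWithin_le
    (fun z hz => (hasDerivWithinAt_subord hz.2).mono fun u hu => hu.2)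
    (fun z hz => ?_) ⟨h1, h1'⟩ ⟨h2, h2'⟩
  rw [norm_inv, ← one_div]
  exact one_div_le_one_div_of_le hc (h z hz.1 hz.2)

/-- The Gaussian mean of `|x|`. -/
def gaussAbsMean : ℝ := ∫ x : ℝ, |x| ∂stdGauss

/-- High above the axis every arctan is O(1/y), which leaves the constant -π/2. This is the value at
the top of the vertical integration. -/
lemma abs_freePot_im_add_le {E y : ℝ} (hy : 1 ≤ y) :
    |(freePot (E + y * I)).im + Real.pi / 2| ≤
      (gaussAbsMean + (|E| + absHalfMoment 0) + 1) / y := by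
  set z : ℂ := E + y * I with hz
  have hzi : z.im = y := by simp [hz]
  have hzr : z.re = E := by simp [hz]
  have hz0 : 0 ≤ z.im := by rw [hzi]; linarith
  have hy0 : 0 < y := by linarith
  have hwi : y ≤ (subord z).im := by rw [← hzi]; exact im_le_subord_im hz0
  have hwr : |(subord z).re| ≤ |E| + absHalfMoment 0 := by
    have h1 := abs_re_le_norm (freeStieltjes z)
    have h2 := norm_freeStieltjes_le hz0
    have e : (subord z).re = E + (freeStieltjes z).re := by
      rw [freeStieltjes, sub_re, hzr]; ring
    rw [e]
    exact (abs_add_le _ _).trans (by linarith)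
  have hm : ‖freeStieltjes z‖ ≤ 1 / y := by
    rw [freeStieltjes_eq hz0]
    have : ‖gaussStieltjes (subord z)‖ ≤ 1 / y * stdGauss.real univ :=
      norm_integral_le_of_norm_le_const (ae_of_all _ fun x => norm_one_div_le x hy0 hwi)
    simpa using this
  have hiarc : Integrable (fun x : ℝ => Real.arctan ((x - (subord z).re) / (subord z).im))
      stdGauss := by
    refine Integrable.of_bound (C := Real.pi) (Measurable.aestronglyMeasurable (by fun_prop))
      (ae_of_all _ fun x => ?_)
    rw [Real.norm_eq_abs, abs_le]
    have h1 := Real.neg_pi_div_two_lt_arctan ((x - (subord z).re) / (subord z).im)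
    have h2 := Real.arctan_lt_pi_div_two ((x - (subord z).re) / (subord z).im)
    constructor <;> linarith [Real.pi_pos]
  have e : (freePot z).im + Real.pi / 2 =
      ∫ x : ℝ, Real.arctan ((x - (subord z).re) / (subord z).im) ∂stdGauss +
        (freeStieltjes z ^ 2 / 2).im := by
    rw [freePot_im hz0, integral_sub hiarc (integrable_const _)]
    simp
    ring
  rw [e]
  have h1 : |∫ x : ℝ, Real.arctan ((x - (subord z).re) / (subord z).im) ∂stdGauss| ≤
      (gaussAbsMean + (|E| + absHalfMoment 0)) / y := by
    refine abs_integral_le_integral_abs.trans ?_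
    have : (gaussAbsMean + (|E| + absHalfMoment 0)) / y =
        ∫ x : ℝ, (|x| + (|E| + absHalfMoment 0)) / y ∂stdGauss := by
      rw [integral_div, integral_add integrable_abs_stdGauss (integrable_const _), gaussAbsMean]
      simp
    rw [this]
    refine integral_mono hiarc.abs ((integrable_abs_stdGauss.add (integrable_const _)).div_const _)
      fun x => ?_
    refine (abs_arctan_le _).trans ?_
    rw [abs_div, abs_of_pos (hy0.trans_le hwi)]
    have : |x - (subord z).re| ≤ |x| + (|E| + absHalfMoment 0) :=
      (abs_sub _ _).trans (by linarith)
    have h0 := (abs_nonneg _).trans this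
    gcongr
  have h2 : |(freeStieltjes z ^ 2 / 2).im| ≤ 1 / y := by
    refine (abs_im_le_norm _).trans ?_
    rw [norm_div, norm_pow]
    have h3 : ‖freeStieltjes z‖ ^ 2 ≤ (1 / y) ^ 2 := pow_le_pow_left₀ (norm_nonneg _) hm 2
    have h4 : (1 / y) ^ 2 ≤ 1 / y := by
      rw [pow_two]
      exact mul_le_of_le_one_left (by positivity) (by rw [div_le_one hy0]; exact hy)
    have h5 : 0 ≤ ‖freeStieltjes z‖ ^ 2 := by positivity
    simp only [RCLike.norm_ofNat]
    linarith
  calc _ ≤ _ := abs_add_le _ _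
    _ ≤ _ := add_le_add h1 h2
    _ = _ := by ring

end Potential

end LaplacianRigidity
end

/-! ### Entries of the matrix as sparse families; ordering of the edges. -/

noncomputable section
namespace LaplacianRigidity

section Model

variable {Ω : Type*} [MeasurableSpace Ω] {μ : Measure Ω} {N : ℕ} {β q : ℝ} {c : ℕ → ℝ}
  {H : Ω → Matrix (Fin (N + 1)) (Fin (N + 1)) ℝ}

/-- Moment constants of the entries of a Laplacian-type matrix. -/
def entryConst (c : ℕ → ℝ) (r : ℕ) : ℝ := |c r| + 1

lemma IsRandomLaplacianType.q_pos (hH : IsRandomLaplacianType μ N β q c H) (hN : 0 < N) : 0 < q :=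
  lt_of_lt_of_le (by positivity) hH.le_sparsity

lemma IsRandomLaplacianType.one_le_q (hH : IsRandomLaplacianType μ N β q c H) (hN : 0 < N)
    (hβ : 0 < β) : 1 ≤ q :=
  le_trans (Real.one_le_rpow (by exact_mod_cast hN) hβ.le) hH.le_sparsity

lemma IsRandomLaplacianType.q_sq_le (hH : IsRandomLaplacianType μ N β q c H) (hN : 0 < N) :
    q ^ 2 ≤ N := by
  have h := pow_le_pow_left₀ (hH.q_pos hN).le hH.sparsity_le 2
  rwa [← Real.rpow_natCast ((N : ℝ) ^ (1 / 2 : ℝ)), ← Real.rpow_mul (by positivity),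
    Nat.cast_ofNat, one_div_mul_cancel two_ne_zero, Real.rpow_one] at h

lemma IsRandomLaplacianType.allMoments [IsProbabilityMeasure μ]
    (hH : IsRandomLaplacianType μ N β q c H) {i j : Fin (N + 1)} (hij : i ≠ j) :
    AllMoments (fun ω => H ω i j) μ :=
  allMoments_of_integrable_pow (hH.measurable i j) fun p hp => (hH.moment p hp i j hij).1

/-- Entries along an injective family of edges form a sparse family. -/
lemma IsRandomLaplacianType.sparseFamily [IsProbabilityMeasure μ]
    (hH : IsRandomLaplacianType μ N β q c H) (hN : 0 < N) {ι : Type*}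
    (e : ι → {e : Fin (N + 1) × Fin (N + 1) // e.1 < e.2}) (he : Function.Injective e) :
    SparseFamily (fun k ω => H ω (e k).1.1 (e k).1.2) μ N q (entryConst c) where
  meas k := hH.measurable _ _
  indep := hH.indep.precomp he
  mean k := hH.mean _ _ (e k).2.ne
  var k := by
    rw [← hH.variance _ _ (e k).2.ne, variance_of_integral_eq_zero (hH.measurable _ _).aemeasurable
      (hH.mean _ _ (e k).2.ne)]
  allMoments k := hH.allMoments (e k).2.ne
  moment k r hr := by
    have hq := hH.q_pos hN
    have hN' : (0 : ℝ) < N := by exact_mod_cast hN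
    -- For r = 2 the moment is the variance, which the constants `c` do not govern; the summand 1 in
    -- `entryConst` covers it.
    rcases hr.eq_or_lt with rfl | hr3
    · have h1 : ∫ ω, |H ω (e k).1.1 (e k).1.2| ^ 2 ∂μ = 1 / N := by
        rw [← hH.variance _ _ (e k).2.ne,
          variance_of_integral_eq_zero (hH.measurable _ _).aemeasurable (hH.mean _ _ (e k).2.ne)]
        simp_rw [sq_abs]
      rw [h1]
      simp only [Nat.sub_self, pow_zero, mul_one]
      have : 1 ≤ entryConst c 2 := by unfold entryConst; linarith [abs_nonneg (c 2)]
      exact le_mul_of_one_le_left (by positivity) this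
    · refine (hH.moment r hr3 _ _ (e k).2.ne).2.trans ?_
      have h2 : c r ≤ entryConst c r := by
        unfold entryConst; linarith [le_abs_self (c r)]
      have h3 : c r / (q ^ (r - 2) * N) = c r * (1 / q) ^ (r - 2) * (1 / N) := by
        rw [one_div_pow]; field_simp
      rw [h3]
      gcongr
  const_nonneg r := by unfold entryConst; positivity
  pos := hH.q_pos hN
  sq_le := hH.q_sq_le hN

/-- The pair `{i, j}` as an edge. -/
def mkEdge {i j : Fin (N + 1)} (h : i ≠ j) : {e : Fin (N + 1) × Fin (N + 1) // e.1 < e.2} :=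
  ⟨(min i j, max i j), min_lt_max.2 h⟩

lemma IsRandomLaplacianType.apply_mkEdge (hH : IsRandomLaplacianType μ N β q c H)
    {i j : Fin (N + 1)} (h : i ≠ j) (ω : Ω) :
    H ω (mkEdge h).1.1 (mkEdge h).1.2 = H ω i j := by
  rcases le_total i j with hij | hij
  · simp [mkEdge, hij]
  · simp [mkEdge, hij, hH.symm ω j i]

lemma IsRandomLaplacianType.row_sparseFamily [IsProbabilityMeasure μ]
    (hH : IsRandomLaplacianType μ N β q c H) (hN : 0 < N) (i : Fin (N + 1)) :
    SparseFamily (fun (k : Fin N) ω => H ω i (i.succAbove k)) μ N q (entryConst c) := by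
  have h := hH.sparseFamily hN (fun k : Fin N => mkEdge (Fin.succAbove_ne i k).symm) (by
    intro k l hkl
    have h1 := congrArg (fun e => e.1) hkl
    simp only [mkEdge, Prod.mk.injEq] at h1
    refine Fin.succAbove_right_injective (p := i) ?_
    have hk := Fin.succAbove_ne i k
    have hl := Fin.succAbove_ne i l
    rcases le_total i (i.succAbove k) with a | a <;> rcases le_total i (i.succAbove l) with b | b
    · simpa [a, b] using h1.2
    · simp only [a, b, min_eq_left, min_eq_right, max_eq_left, max_eq_right] at h1
      exact absurd h1.1.symm hl
    · simp only [a, b, min_eq_left, min_eq_right, max_eq_left, max_eq_right] at h1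
      exact absurd h1.1 hk
    · simpa [a, b] using h1.1)
  simpa only [hH.apply_mkEdge] using h

/-- Edges in lexicographic order. -/
abbrev LexEdge (N : ℕ) : Type :=
  {e : Fin (N + 1) ×ₗ Fin (N + 1) // (ofLex e).1 < (ofLex e).2}

/-- The matrix entry on an edge. -/
def edgeEntry (H : Ω → Matrix (Fin (N + 1)) (Fin (N + 1)) ℝ) (e : LexEdge N) (ω : Ω) : ℝ :=
  H ω (ofLex e.1).1 (ofLex e.1).2

lemma IsRandomLaplacianType.edge_sparseFamily [IsProbabilityMeasure μ]
    (hH : IsRandomLaplacianType μ N β q c H) (hN : 0 < N) :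
    SparseFamily (edgeEntry H) μ N q (entryConst c) :=
  hH.sparseFamily hN (fun e : LexEdge N => ⟨ofLex e.1, e.2⟩) (by
    intro a b hab
    simp only [Subtype.mk.injEq] at hab
    exact Subtype.ext (ofLex.injective hab))

/-- Each edge belongs to the rows of both its endpoints, so a sum over rows becomes a single sum
over edges. -/
lemma sum_lexEdge {M : Type*} [AddCommMonoid M] (f : Fin (N + 1) → Fin (N + 1) → M) :
    ∑ i, ∑ j ∈ Finset.univ.filter (· ≠ i), f i j =
      ∑ e : LexEdge N, (f (ofLex e.1).1 (ofLex e.1).2 + f (ofLex e.1).2 (ofLex e.1).1) := by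
  have h1 : ∀ g : Fin (N + 1) → Fin (N + 1) → M,
      ∑ e : LexEdge N, g (ofLex e.1).1 (ofLex e.1).2 =
        ∑ i, ∑ j, if i < j then g i j else 0 := by
    intro g
    rw [← Fintype.sum_prod_type', ← Finset.sum_filter]
    rw [Finset.sum_subtype (p := fun e : Fin (N + 1) × Fin (N + 1) => e.1 < e.2)
      (f := fun e => g e.1 e.2) _ (fun x => by simp)]
    rfl
  rw [Finset.sum_add_distrib, h1, h1 (fun i j => f j i), Finset.sum_comm (γ := Fin (N + 1))
    (f := fun i j => if i < j then f j i else 0), ← Finset.sum_add_distrib]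
  refine Finset.sum_congr rfl fun i _ => ?_
  rw [← Finset.sum_add_distrib, Finset.sum_filter]
  refine Finset.sum_congr rfl fun j _ => ?_
  rcases lt_trichotomy i j with h | h | h
  · simp [h, h.ne', h.not_gt]
  · simp [h]
  · simp [h, h.ne, h.not_gt]

lemma card_lexEdge_le : Fintype.card (LexEdge N) ≤ (N + 1) ^ 2 := by
  refine (Fintype.card_subtype_le _).trans_eq ?_
  rw [Fintype.card_lex, Fintype.card_prod, Fintype.card_fin, pow_two]

/-- Entries of row `a` or `b` to the left of the edge `(a, b)` belong to its past. -/
lemma IsRandomLaplacianType.measurable_past_edge (hH : IsRandomLaplacianType μ N β q c H)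
    (e : LexEdge N) {i j j' : Fin (N + 1)}
    (hij : (i = (ofLex e.1).1 ∧ j = (ofLex e.1).2) ∨ (i = (ofLex e.1).2 ∧ j = (ofLex e.1).1))
    (hj : j' < j) (hne : j' ≠ i) :
    Measurable[past (edgeEntry H) e] fun ω => H ω i j' := by
  obtain ⟨e, he⟩ := e
  rcases lt_or_gt_of_ne hne with h | h
  · have hlt : (⟨toLex (j', i), h⟩ : LexEdge N) < ⟨e, he⟩ := by
      rw [← Subtype.coe_lt_coe, Prod.Lex.lt_iff]
      simp only [ofLex_toLex] at hij ⊢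
      rcases hij with ⟨rfl, rfl⟩ | ⟨rfl, rfl⟩
      · exact Or.inl h
      · exact Or.inl hj
    have e' : (fun ω => H ω i j') = edgeEntry H ⟨toLex (j', i), h⟩ := by
      ext ω
      exact (hH.symm ω _ _)
    rw [e']
    exact measurable_past (edgeEntry H) hlt
  · have hlt : (⟨toLex (i, j'), h⟩ : LexEdge N) < ⟨e, he⟩ := by
      rw [← Subtype.coe_lt_coe, Prod.Lex.lt_iff]
      simp only [ofLex_toLex] at hij ⊢
      rcases hij with ⟨rfl, rfl⟩ | ⟨rfl, rfl⟩
      · exact Or.inr ⟨rfl, hj⟩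
      · exact absurd (hj.trans he) h.not_gt
    exact measurable_past (edgeEntry H) hlt

end Model

end LaplacianRigidity
end

/-! ### Fourier integrals and one step of the Gaussian replacement. -/

noncomputable section
namespace LaplacianRigidity

section ExpIntegral

open Complex Set

/-- `G` is a weight on the half-line whose absolute moments of order at most four are at
most `K`. -/
structure WeightBound (G : ℝ → ℂ) (K : ℝ) : Prop where
  meas : Measurable G
  integrable : ∀ k ≤ 4, IntegrableOn (fun t : ℝ => t ^ k * ‖G t‖) (Ioi 0)
  bound : ∀ k ≤ 4, ∫ t in Ioi (0 : ℝ), t ^ k * ‖G t‖ ≤ K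

/-- `∫₀^∞ G(t) e^{ist} dt`. -/
def expInt (G : ℝ → ℂ) (s : ℝ) : ℂ := ∫ t in Ioi (0 : ℝ), G t * cexp (I * t * s)

lemma norm_cexp_I_mul_ofReal_mul (t s : ℝ) : ‖cexp (I * t * s)‖ = 1 := by
  have : I * t * s = ((t * s : ℝ) : ℂ) * I := by push_cast; ring
  rw [this, norm_exp_ofReal_mul_I]

lemma WeightBound.integrableOn_expInt {G : ℝ → ℂ} {K : ℝ} (hG : WeightBound G K) (s : ℝ) :
    IntegrableOn (fun t : ℝ => G t * cexp (I * t * s)) (Ioi 0) := by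
  have hm := hG.meas
  refine Integrable.mono' (hG.integrable 0 (by norm_num))
    (Measurable.aestronglyMeasurable (by fun_prop)) (ae_of_all _ fun t => ?_)
  rw [norm_mul, norm_cexp_I_mul_ofReal_mul, mul_one, pow_zero, one_mul]

lemma norm_expInt_le {G : ℝ → ℂ} {b : ℝ → ℝ} (hb : IntegrableOn b (Ioi 0))
    (h : ∀ t, 0 < t → ‖G t‖ ≤ b t) (s : ℝ) : ‖expInt G s‖ ≤ ∫ t in Ioi (0 : ℝ), b t := by
  refine norm_integral_le_of_norm_le hb ((ae_restrict_mem measurableSet_Ioi).mono fun t ht => ?_)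
  rw [norm_mul, norm_cexp_I_mul_ofReal_mul, mul_one]
  exact h t ht

lemma continuous_expInt {G : ℝ → ℂ} (hm : Measurable G) {b : ℝ → ℝ} (hb : IntegrableOn b (Ioi 0))
    (h : ∀ t, 0 < t → ‖G t‖ ≤ b t) : Continuous (expInt G) := by
  refine continuous_of_dominated (bound := b)
    (fun s => Measurable.aestronglyMeasurable (by fun_prop))
    (fun s => (ae_restrict_mem measurableSet_Ioi).mono fun t ht => ?_) hb
    (ae_of_all _ fun t => by fun_prop)
  rw [norm_mul, norm_cexp_I_mul_ofReal_mul, mul_one]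
  exact h t ht

/-- The factor `e^{-t²/(2N)}`. -/
def gaussFactor (N : ℕ) (t : ℝ) : ℝ := Real.exp (-(t ^ 2 / (2 * N)))

lemma gaussFactor_pos (N : ℕ) (t : ℝ) : 0 < gaussFactor N t := Real.exp_pos _

lemma gaussFactor_le_one (N : ℕ) (t : ℝ) : gaussFactor N t ≤ 1 :=
  Real.exp_le_one_iff.2 (neg_nonpos.2 (by positivity))

lemma continuous_gaussFactor (N : ℕ) : Continuous (gaussFactor N) := by
  unfold gaussFactor; fun_prop

lemma WeightBound.mul_gaussFactor {G : ℝ → ℂ} {K : ℝ} (hG : WeightBound G K) (N k : ℕ) :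
    WeightBound (fun t => G t * (gaussFactor N t : ℂ) ^ k) K := by
  have hm := hG.meas
  have hc := (continuous_gaussFactor N).measurable
  have hle : ∀ t, ‖G t * (gaussFactor N t : ℂ) ^ k‖ ≤ ‖G t‖ := fun t => by
    rw [norm_mul, norm_pow, norm_real, Real.norm_of_nonneg (gaussFactor_pos N t).le]
    exact mul_le_of_le_one_right (norm_nonneg _)
      (pow_le_one₀ (gaussFactor_pos N t).le (gaussFactor_le_one N t))
  have hI : ∀ j ≤ 4, IntegrableOn (fun t : ℝ => t ^ j * ‖G t * (gaussFactor N t : ℂ) ^ k‖) (Ioi 0) := by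
    intro j hj
    refine Integrable.mono (hG.integrable j hj)
      (Measurable.aestronglyMeasurable (by fun_prop)) (ae_of_all _ fun t => ?_)
    rw [norm_mul (t ^ j), norm_mul (t ^ j), norm_norm, norm_norm]
    exact mul_le_mul_of_nonneg_left (hle t) (norm_nonneg _)
  refine ⟨by fun_prop, hI, fun j hj => le_trans ?_ (hG.bound j hj)⟩
  refine setIntegral_mono_on (hI j hj) (hG.integrable j hj) measurableSet_Ioi fun t ht => ?_
  have : (0 : ℝ) < t := ht
  exact mul_le_mul_of_nonneg_left (hle t) (by positivity)

lemma norm_cexp_sub_quadratic_le (x : ℝ) :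
    ‖cexp (I * x) - 1 - I * x + x ^ 2 / 2‖ ≤ 4 * |x| ^ 3 := by
  have hn : ‖(I * x : ℂ)‖ = |x| := by rw [norm_mul, norm_I, one_mul, norm_real, Real.norm_eq_abs]
  rcases le_total |x| 1 with h | h
  · have := Complex.exp_bound (x := I * x) (by rw [hn]; exact h) (n := 3) (by norm_num)
    rw [hn] at this
    have e : cexp (I * x) - 1 - I * x + x ^ 2 / 2 =
        cexp (I * x) - ∑ m ∈ Finset.range 3, (I * x : ℂ) ^ m / (m.factorial : ℂ) := by
      simp [Finset.sum_range_succ, Nat.factorial, mul_pow]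
      ring
    rw [e]
    refine this.trans ?_
    rw [mul_comm]
    refine mul_le_mul_of_nonneg_right ?_ (by positivity)
    norm_num [Nat.factorial]
  · have h1 : ‖cexp (I * x)‖ = 1 := by rw [mul_comm, norm_exp_ofReal_mul_I]
    have h2 : ‖((x : ℂ) ^ 2 / 2)‖ = |x| ^ 2 / 2 := by
      rw [norm_div, norm_pow, norm_real, Real.norm_eq_abs]; norm_num
    have h3 : |x| ≤ |x| ^ 3 := le_self_pow₀ h (by norm_num)
    have h4 : |x| ^ 2 ≤ |x| ^ 3 := pow_le_pow_right₀ h (by norm_num)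
    calc _ ≤ ‖cexp (I * x) - 1 - I * x‖ + ‖((x : ℂ) ^ 2 / 2)‖ := norm_add_le _ _
      _ ≤ (‖cexp (I * x) - 1‖ + ‖(I * x : ℂ)‖) + ‖((x : ℂ) ^ 2 / 2)‖ := by
        gcongr; exact norm_sub_le _ _
      _ ≤ ((‖cexp (I * x)‖ + ‖(1 : ℂ)‖) + ‖(I * x : ℂ)‖) + ‖((x : ℂ) ^ 2 / 2)‖ := by
        gcongr; exact norm_sub_le _ _
      _ = 1 + 1 + |x| + |x| ^ 2 / 2 := by rw [h1, hn, h2, norm_one]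
      _ ≤ _ := by linarith

lemma abs_exp_neg_sub_linear_le {a : ℝ} (ha : 0 ≤ a) : |Real.exp (-a) - 1 + a| ≤ a ^ 2 := by
  rw [abs_of_nonneg (by linarith [Real.add_one_le_exp (-a)])]
  have h1 : Real.exp (-a) ≤ 1 / (1 + a) := by
    rw [Real.exp_neg, ← one_div]
    exact one_div_le_one_div_of_le (by linarith) (by linarith [Real.add_one_le_exp a])
  have h2 : 1 / (1 + a) ≤ 1 - a + a ^ 2 := by
    rw [div_le_iff₀ (by linarith)]
    nlinarith [pow_nonneg ha 3]
  linarith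

/-- The oscillating exponential is expanded to second order and the Gaussian factor to first order
in t²/N. Their quadratic terms combine into the centred square h² - 1/N, and the remainders are
cubic in h and of order t⁴/N². -/
lemma norm_cexp_sub_gaussFactor_le {N : ℕ} (hN : 0 < N) (h : ℝ) {t : ℝ} (ht : 0 < t) :
    ‖cexp (I * t * h) - gaussFactor N t - h * (I * t) - (h ^ 2 - 1 / N) * (-(t ^ 2 / 2))‖ ≤
      t ^ 3 * (4 * |h| ^ 3) + t ^ 4 * (1 / (N : ℝ) ^ 2) := by
  have hN' : (0 : ℝ) < N := by exact_mod_cast hN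
  have h1 := norm_cexp_sub_quadratic_le (t * h)
  have h2 := abs_exp_neg_sub_linear_le (a := t ^ 2 / (2 * N)) (by positivity)
  have e : cexp (I * t * h) - gaussFactor N t - h * (I * t) - (h ^ 2 - 1 / N) * (-(t ^ 2 / 2)) =
      (cexp (I * (t * h : ℝ)) - 1 - I * (t * h : ℝ) + ((t * h : ℝ) : ℂ) ^ 2 / 2) -
        ((gaussFactor N t - 1 + t ^ 2 / (2 * N) : ℝ) : ℂ) := by
    have : (N : ℂ) ≠ 0 := by exact_mod_cast hN.ne'
    have e1 : cexp (I * (t * h : ℝ)) = cexp (I * t * h) := by congr 1; push_cast; ring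
    rw [e1]
    push_cast
    field_simp
    ring
  rw [e]
  refine (norm_sub_le _ _).trans (add_le_add (h1.trans_eq ?_) ?_)
  · rw [abs_mul, abs_of_pos ht]; ring
  · rw [norm_real, Real.norm_eq_abs]
    refine h2.trans ?_
    rw [div_pow, mul_pow, div_eq_mul_one_div, ← pow_mul]
    gcongr
    nlinarith [sq_nonneg (N : ℝ)]

/-- Second-order expansion of `expInt` under a shift, compared with a Gaussian shift of variance
`1 / N`. -/
lemma WeightBound.norm_expInt_add_sub_le {G : ℝ → ℂ} {K : ℝ} (hG : WeightBound G K) {N : ℕ}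
    (hN : 0 < N) (s h : ℝ) :
    ‖expInt G (s + h) - expInt (fun t => G t * gaussFactor N t) s -
      h * expInt (fun t => G t * (I * t)) s -
      (h ^ 2 - 1 / N : ℝ) * expInt (fun t => G t * (-(t ^ 2 / 2))) s‖ ≤
      K * (4 * |h| ^ 3 + 1 / (N : ℝ) ^ 2) := by
  have hm := hG.meas
  have i0 := hG.integrableOn_expInt (s + h)
  have i1 : IntegrableOn (fun t : ℝ => G t * gaussFactor N t * cexp (I * t * s)) (Ioi 0) := by
    simpa using (hG.mul_gaussFactor N 1).integrableOn_expInt s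
  have i2 : IntegrableOn (fun t : ℝ => G t * (I * t) * cexp (I * t * s)) (Ioi 0) := by
    refine Integrable.mono (hG.integrable 1 (by norm_num))
      (Measurable.aestronglyMeasurable (by fun_prop)) (ae_of_all _ fun t => le_of_eq ?_)
    rw [norm_mul, norm_cexp_I_mul_ofReal_mul]
    simp [mul_comm]
  have i3 : IntegrableOn (fun t : ℝ => G t * (-(t ^ 2 / 2)) * cexp (I * t * s)) (Ioi 0) := by
    refine Integrable.mono (hG.integrable 2 (by norm_num))
      (Measurable.aestronglyMeasurable (by fun_prop)) (ae_of_all _ fun t => ?_)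
    rw [norm_mul, norm_cexp_I_mul_ofReal_mul]
    simp
    nlinarith [norm_nonneg (G t), sq_nonneg t, mul_nonneg (norm_nonneg (G t)) (sq_nonneg t)]
  have key : ∫ t in Ioi (0 : ℝ), (G t * cexp (I * t * (s + h : ℝ)) -
        G t * gaussFactor N t * cexp (I * t * s) -
        h * (G t * (I * t) * cexp (I * t * s)) -
        (h ^ 2 - 1 / N : ℝ) * (G t * (-(t ^ 2 / 2)) * cexp (I * t * s))) =
      expInt G (s + h) - expInt (fun t => G t * gaussFactor N t) s -
      h * expInt (fun t => G t * (I * t)) s -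
      (h ^ 2 - 1 / N : ℝ) * expInt (fun t => G t * (-(t ^ 2 / 2))) s := by
    rw [integral_sub, integral_sub, integral_sub i0 i1, integral_const_mul, integral_const_mul]
    · rfl
    · exact i0.sub i1
    · exact i2.const_mul _
    · exact (i0.sub i1).sub (i2.const_mul _)
    · exact i3.const_mul _
  rw [← key]
  have hb : IntegrableOn (fun t : ℝ => t ^ 3 * ‖G t‖ * (4 * |h| ^ 3) +
      t ^ 4 * ‖G t‖ * (1 / (N : ℝ) ^ 2)) (Ioi 0) :=
    Integrable.add ((hG.integrable 3 (by norm_num)).mul_const _)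
      ((hG.integrable 4 (by norm_num)).mul_const _)
  refine (norm_integral_le_of_norm_le hb
    ((ae_restrict_mem measurableSet_Ioi).mono fun t ht => ?_)).trans ?_
  · have := norm_cexp_sub_gaussFactor_le hN h ht
    have e : G t * cexp (I * t * (s + h : ℝ)) - G t * gaussFactor N t * cexp (I * t * s) -
        h * (G t * (I * t) * cexp (I * t * s)) -
        (h ^ 2 - 1 / N : ℝ) * (G t * (-(t ^ 2 / 2)) * cexp (I * t * s)) =
        G t * cexp (I * t * s) * (cexp (I * t * h) - gaussFactor N t - h * (I * t) -
          (h ^ 2 - 1 / N) * (-(t ^ 2 / 2))) := by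
      have : cexp (I * t * (s + h : ℝ)) = cexp (I * t * s) * cexp (I * t * h) := by
        rw [← Complex.exp_add]; congr 1; push_cast; ring
      rw [this]; push_cast; ring
    refine le_trans (le_of_eq (congrArg norm e)) ?_
    rw [norm_mul, norm_mul, norm_cexp_I_mul_ofReal_mul, mul_one]
    refine (mul_le_mul_of_nonneg_left this (norm_nonneg _)).trans_eq ?_
    ring
  · rw [integral_add ((hG.integrable 3 (by norm_num)).mul_const _)
      ((hG.integrable 4 (by norm_num)).mul_const _), integral_mul_const, integral_mul_const, mul_add]
    have h3 := hG.bound 3 (by norm_num)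
    have h4 := hG.bound 4 (by norm_num)
    gcongr

/-- Telescoping along the sorted index set. The first argument of Φ counts the indices already
exposed, which determines how many Gaussian factors remain. -/
lemma sum_sub_filter_lt {ι : Type*} [LinearOrder ι] {M E : Type*} [AddCommMonoid M]
    [AddCommGroup E] (Φ : ℕ → M → E) (h : ι → M) (t : Finset ι) :
    ∑ j ∈ t, (Φ ((t.filter (· < j)).card + 1) (∑ l ∈ t.filter (· < j), h l + h j) -
      Φ (t.filter (· < j)).card (∑ l ∈ t.filter (· < j), h l)) =
      Φ t.card (∑ j ∈ t, h j) - Φ 0 0 := by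
  induction t using Finset.induction_on_max with
  | empty => simp
  | insert a s hlt ih =>
    have ha : a ∉ s := fun h => lt_irrefl _ (hlt a h)
    have e1 : (insert a s).filter (· < a) = s := by
      rw [Finset.filter_insert, if_neg (lt_irrefl a), Finset.filter_true_of_mem hlt]
    have e2 : ∀ j ∈ s, (insert a s).filter (· < j) = s.filter (· < j) := fun j hj => by
      rw [Finset.filter_insert, if_neg (hlt j hj).not_gt]
    rw [Finset.sum_insert ha, e1, Finset.sum_insert ha, Finset.card_insert_of_notMem ha]
    have : ∀ j ∈ s, (Φ (((insert a s).filter (· < j)).card + 1)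
        (∑ l ∈ (insert a s).filter (· < j), h l + h j) -
        Φ ((insert a s).filter (· < j)).card (∑ l ∈ (insert a s).filter (· < j), h l)) =
        (Φ ((s.filter (· < j)).card + 1) (∑ l ∈ s.filter (· < j), h l + h j) -
      Φ (s.filter (· < j)).card (∑ l ∈ s.filter (· < j), h l)) := fun j hj => by rw [e2 j hj]
    rw [Finset.sum_congr rfl this, ih, add_comm (h a)]
    abel

end ExpIntegral

end LaplacianRigidity
end

/-! ### Concentration of averages over row sums. -/

noncomputable section
namespace LaplacianRigidity

section Empirical

open Complex Set

variable {Ω : Type*} [MeasurableSpace Ω] {μ : Measure Ω}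

lemma measureReal_lt_norm_le [IsFiniteMeasure μ] {Z : Ω → ℂ} {a P : ℝ}
    (hre : μ.real {ω | a < |(Z ω).re|} ≤ P) (him : μ.real {ω | a < |(Z ω).im|} ≤ P) :
    μ.real {ω | 2 * a < ‖Z ω‖} ≤ 2 * P := by
  have hsub : {ω | 2 * a < ‖Z ω‖} ⊆ {ω | a < |(Z ω).re|} ∪ {ω | a < |(Z ω).im|} := by
    intro ω hω
    by_contra hcon
    simp only [Set.mem_union, Set.mem_ofPred_eq, not_or, not_lt] at hcon hω
    linarith [Complex.norm_le_abs_re_add_abs_im (Z ω), hcon.1, hcon.2]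
  calc _ ≤ _ := measureReal_mono hsub
    _ ≤ _ := measureReal_union_le _ _
    _ ≤ _ := by linarith

variable {ι : Type*} {X : ι → Ω → ℝ} {Nr q : ℝ} {m : ℕ → ℝ}

lemma SparseFamily.tail_linear_complex [IsProbabilityMeasure μ] [LinearOrder ι]
    (h : SparseFamily X μ Nr q m)
    {Y : ι → Ω → ℂ} (hY : ∀ i, Measurable[past X i] (Y i)) {α : ι → ℝ}
    (hα : ∀ i, 0 ≤ α i) (hYα : ∀ i ω, ‖Y i ω‖ ≤ α i) (p : ℕ) (t : Finset ι) {V B lam : ℝ}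
    (hB : ∀ i, α i / q ≤ B) (hV0 : 0 ≤ V) (hV : (∑ i ∈ t, α i ^ 2) / Nr + B ^ 2 ≤ V ^ 2)
    (hlam : 0 < lam) :
    μ.real {ω | 2 * (lam * V) < ‖∑ i ∈ t, Y i ω * X i ω‖} ≤
      2 * (momentConst m p / lam ^ (2 * p)) := by
  refine measureReal_lt_norm_le ?_ ?_
  · have := h.tail_linear (Y := fun i ω => (Y i ω).re)
      (fun i => Complex.measurable_re.comp (hY i)) hα
      (fun i ω => (Complex.abs_re_le_norm _).trans (hYα i ω)) p t hB hV0 hV hlam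
    simpa only [Complex.re_sum, Complex.re_mul_ofReal] using this
  · have := h.tail_linear (Y := fun i ω => (Y i ω).im)
      (fun i => Complex.measurable_im.comp (hY i)) hα
      (fun i ω => (Complex.abs_im_le_norm _).trans (hYα i ω)) p t hB hV0 hV hlam
    simpa only [Complex.im_sum, Complex.im_mul_ofReal] using this

lemma SparseFamily.tail_square_complex [IsProbabilityMeasure μ] [LinearOrder ι]
    (h : SparseFamily X μ Nr q m)
    {Y : ι → Ω → ℂ} (hY : ∀ i, Measurable[past X i] (Y i)) {α : ι → ℝ}
    (hα : ∀ i, 0 ≤ α i) (hYα : ∀ i ω, ‖Y i ω‖ ≤ α i) (p : ℕ) (t : Finset ι) {V B lam : ℝ}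
    (hB : ∀ i, α i / q ^ 2 ≤ B) (hV0 : 0 ≤ V)
    (hV : (∑ i ∈ t, α i ^ 2) / (q ^ 2 * Nr) + B ^ 2 ≤ V ^ 2) (hlam : 0 < lam) :
    μ.real {ω | 2 * (lam * V) < ‖∑ i ∈ t, Y i ω * (X i ω ^ 2 - 1 / Nr : ℝ)‖} ≤
      2 * (momentConst (squareConst m) p / lam ^ (2 * p)) := by
  refine measureReal_lt_norm_le ?_ ?_
  · have := h.tail_square (Y := fun i ω => (Y i ω).re)
      (fun i => Complex.measurable_re.comp (hY i)) hα
      (fun i ω => (Complex.abs_re_le_norm _).trans (hYα i ω)) p t hB hV0 hV hlam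
    simpa only [Complex.re_sum, Complex.re_mul_ofReal] using this
  · have := h.tail_square (Y := fun i ω => (Y i ω).im)
      (fun i => Complex.measurable_im.comp (hY i)) hα
      (fun i ω => (Complex.abs_im_le_norm _).trans (hYα i ω)) p t hB hV0 hV hlam
    simpa only [Complex.im_sum, Complex.im_mul_ofReal] using this

/-- Indices different from `i` and smaller than `j`. -/
def before {N : ℕ} (i j : Fin (N + 1)) : Finset (Fin (N + 1)) :=
  (Finset.univ.filter (· ≠ i)).filter (· < j)

lemma card_filter_ne {N : ℕ} (i : Fin (N + 1)) :
    (Finset.univ.filter (· ≠ i)).card = N := by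
  rw [Finset.filter_ne', Finset.card_erase_of_mem (Finset.mem_univ _)]; simp

lemma card_before_lt {N : ℕ} {i j : Fin (N + 1)} (h : j ≠ i) : (before i j).card < N := by
  conv_rhs => rw [← card_filter_ne i]
  refine Finset.card_lt_card ⟨Finset.filter_subset _ _, fun hs => ?_⟩
  have := hs (Finset.mem_filter.2 ⟨Finset.mem_univ j, h⟩)
  simp [before] at this

/-- Coefficient of `h i j` in the telescoping expansion of row `i`. -/
def linCoeff {N : ℕ} (G : ℝ → ℂ) (h : Fin (N + 1) → ℝ) (i j : Fin (N + 1)) : ℂ :=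
  expInt (fun t => G t * (gaussFactor N t : ℂ) ^ (N - (before i j).card - 1) * (I * t))
    (∑ l ∈ before i j, h l)

/-- Coefficient of `h i j ^ 2 - 1 / N` in the telescoping expansion of row `i`. -/
def sqCoeff {N : ℕ} (G : ℝ → ℂ) (h : Fin (N + 1) → ℝ) (i j : Fin (N + 1)) : ℂ :=
  expInt (fun t => G t * (gaussFactor N t : ℂ) ^ (N - (before i j).card - 1) * (-(t ^ 2 / 2)))
    (∑ l ∈ before i j, h l)

lemma WeightBound.nonneg {G : ℝ → ℂ} {K : ℝ} (hG : WeightBound G K) : 0 ≤ K :=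
  le_trans (setIntegral_nonneg measurableSet_Ioi fun t _ => by positivity) (hG.bound 0 (by norm_num))

lemma WeightBound.norm_mul_I_mul {G : ℝ → ℂ} {t : ℝ} (ht : 0 < t) :
    ‖G t * (I * t)‖ = t ^ 1 * ‖G t‖ := by
  rw [norm_mul, norm_mul, norm_I, norm_real, Real.norm_of_nonneg ht.le]; ring

lemma WeightBound.norm_mul_sq_le {G : ℝ → ℂ} {t : ℝ} :
    ‖G t * (-((t : ℂ) ^ 2 / 2))‖ ≤ t ^ 2 * ‖G t‖ := by
  rw [norm_mul, norm_neg, norm_div, norm_pow, norm_real, Real.norm_eq_abs, sq_abs]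
  norm_num
  nlinarith [mul_nonneg (norm_nonneg (G t)) (sq_nonneg t)]

lemma WeightBound.norm_linCoeff_le {G : ℝ → ℂ} {K : ℝ} (hG : WeightBound G K) {N : ℕ}
    (h : Fin (N + 1) → ℝ) (i j : Fin (N + 1)) : ‖linCoeff G h i j‖ ≤ K := by
  have hG' := hG.mul_gaussFactor N (N - (before i j).card - 1)
  exact (norm_expInt_le (hG'.integrable 1 (by norm_num))
    (fun t ht => (WeightBound.norm_mul_I_mul
      (G := fun t => G t * (gaussFactor N t : ℂ) ^ (N - (before i j).card - 1)) ht).le) _).trans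
    (hG'.bound 1 (by norm_num))

lemma WeightBound.norm_sqCoeff_le {G : ℝ → ℂ} {K : ℝ} (hG : WeightBound G K) {N : ℕ}
    (h : Fin (N + 1) → ℝ) (i j : Fin (N + 1)) : ‖sqCoeff G h i j‖ ≤ K := by
  have hG' := hG.mul_gaussFactor N (N - (before i j).card - 1)
  exact (norm_expInt_le (hG'.integrable 2 (by norm_num))
    (fun t _ => WeightBound.norm_mul_sq_le
      (G := fun t => G t * (gaussFactor N t : ℂ) ^ (N - (before i j).card - 1))) _).trans
    (hG'.bound 2 (by norm_num))

lemma WeightBound.norm_row_expansion_le {G : ℝ → ℂ} {K : ℝ} (hG : WeightBound G K) {N : ℕ}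
    (hN : 0 < N) (h : Fin (N + 1) → ℝ) (i : Fin (N + 1)) :
    ‖expInt G (∑ j ∈ Finset.univ.filter (· ≠ i), h j) -
        expInt (fun t => G t * (gaussFactor N t : ℂ) ^ N) 0 -
        ∑ j ∈ Finset.univ.filter (· ≠ i),
          (linCoeff G h i j * h j + sqCoeff G h i j * (h j ^ 2 - 1 / N : ℝ))‖ ≤
      ∑ j ∈ Finset.univ.filter (· ≠ i), K * (4 * |h j| ^ 3 + 1 / (N : ℝ) ^ 2) := by
  -- After c entries are exposed, N - c Gaussian factors stand for the rest: c = 0 is the Gaussian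
  -- value and c = N the actual row sum.
  have tel := sum_sub_filter_lt (fun c s => expInt (fun t => G t * (gaussFactor N t : ℂ) ^ (N - c)) s)
    h (Finset.univ.filter (· ≠ i))
  rw [card_filter_ne] at tel
  simp only [Nat.sub_self, pow_zero, mul_one, Nat.sub_zero] at tel
  change _ = expInt G _ - _ at tel
  rw [← tel, ← Finset.sum_sub_distrib]
  refine norm_sum_le_of_le _ fun j hj => ?_
  -- Fewer than N entries precede j, so the subtraction N - c - 1 does not truncate and one more
  -- Gaussian factor restores the exponent N - c.
  have hlt := card_before_lt (Finset.mem_filter.1 hj).2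
  have := (hG.mul_gaussFactor N (N - (before i j).card - 1)).norm_expInt_add_sub_le hN
    (∑ l ∈ before i j, h l) (h j)
  refine le_trans (le_of_eq (congrArg norm ?_)) this
  have e : (fun t => G t * (gaussFactor N t : ℂ) ^ (N - (before i j).card - 1) *
      (gaussFactor N t : ℂ)) = fun t => G t * (gaussFactor N t : ℂ) ^ (N - (before i j).card) := by
    ext t
    rw [mul_assoc, ← pow_succ, Nat.sub_add_cancel (by omega)]
  rw [e, linCoeff, sqCoeff, ← Nat.sub_sub]
  simp only [before]
  ring

variable {N : ℕ} {β : ℝ} {c : ℕ → ℝ} {H : Ω → Matrix (Fin (N + 1)) (Fin (N + 1)) ℝ}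

lemma IsRandomLaplacianType.measurable_partial_sum (hH : IsRandomLaplacianType μ N β q c H)
    (e : LexEdge N) {i j : Fin (N + 1)}
    (hij : (i = (ofLex e.1).1 ∧ j = (ofLex e.1).2) ∨ (i = (ofLex e.1).2 ∧ j = (ofLex e.1).1)) :
    Measurable[past (edgeEntry H) e] fun ω => ∑ l ∈ before i j, H ω i l := by
  refine Finset.measurable_fun_sum _ fun l hl => ?_
  simp only [before, Finset.mem_filter, Finset.mem_univ, true_and] at hl
  exact hH.measurable_past_edge e hij hl.2 hl.1

lemma IsRandomLaplacianType.measurable_linCoeff (hH : IsRandomLaplacianType μ N β q c H)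
    {G : ℝ → ℂ} {K : ℝ} (hG : WeightBound G K) (e : LexEdge N) {i j : Fin (N + 1)}
    (hij : (i = (ofLex e.1).1 ∧ j = (ofLex e.1).2) ∨ (i = (ofLex e.1).2 ∧ j = (ofLex e.1).1)) :
    Measurable[past (edgeEntry H) e] fun ω => linCoeff G (H ω i) i j := by
  have hG' := hG.mul_gaussFactor N (N - (before i j).card - 1)
  have hm := hG'.meas
  exact (continuous_expInt (by fun_prop) (hG'.integrable 1 (by norm_num))
    (fun t ht => (WeightBound.norm_mul_I_mul
      (G := fun t => G t * (gaussFactor N t : ℂ) ^ (N - (before i j).card - 1)) ht).le)).measurable.comp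
    (hH.measurable_partial_sum e hij)

lemma IsRandomLaplacianType.measurable_sqCoeff (hH : IsRandomLaplacianType μ N β q c H)
    {G : ℝ → ℂ} {K : ℝ} (hG : WeightBound G K) (e : LexEdge N) {i j : Fin (N + 1)}
    (hij : (i = (ofLex e.1).1 ∧ j = (ofLex e.1).2) ∨ (i = (ofLex e.1).2 ∧ j = (ofLex e.1).1)) :
    Measurable[past (edgeEntry H) e] fun ω => sqCoeff G (H ω i) i j := by
  have hG' := hG.mul_gaussFactor N (N - (before i j).card - 1)
  have hm := hG'.meas
  exact (continuous_expInt (by fun_prop) (hG'.integrable 2 (by norm_num))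
    (fun t _ => WeightBound.norm_mul_sq_le
      (G := fun t => G t * (gaussFactor N t : ℂ) ^ (N - (before i j).card - 1)))).measurable.comp
    (hH.measurable_partial_sum e hij)

/-- Constants in the tail bound for the empirical distribution of the diagonal. -/
def empiricalConst (m : ℕ → ℝ) (p : ℕ) : ℝ :=
  2 * momentConst m p + 3 * momentConst (squareConst m) p + m (2 * p)

/-- Summing the row expansions, the coefficients from both endpoints multiply the same entry.
Grouped by edge, they are predictable in the lexicographic order, so the linear and the square parts
are each one martingale. -/
lemma IsRandomLaplacianType.norm_sum_expInt_sub_le (hH : IsRandomLaplacianType μ N β q c H)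
    (hN : 0 < N) {G : ℝ → ℂ} {K : ℝ} (hG : WeightBound G K) (ω : Ω) :
    ‖∑ i, (expInt G (∑ j ∈ Finset.univ.filter (· ≠ i), H ω i j) -
        expInt (fun t => G t * (gaussFactor N t : ℂ) ^ N) 0)‖ ≤
      ‖∑ e : LexEdge N, (linCoeff G (H ω (ofLex e.1).1) (ofLex e.1).1 (ofLex e.1).2 +
        linCoeff G (H ω (ofLex e.1).2) (ofLex e.1).2 (ofLex e.1).1) * edgeEntry H e ω‖ +
      ‖∑ e : LexEdge N, (sqCoeff G (H ω (ofLex e.1).1) (ofLex e.1).1 (ofLex e.1).2 +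
        sqCoeff G (H ω (ofLex e.1).2) (ofLex e.1).2 (ofLex e.1).1) *
          (edgeEntry H e ω ^ 2 - 1 / N : ℝ)‖ +
      ∑ e : LexEdge N, 2 * (K * (4 * |edgeEntry H e ω| ^ 3 + 1 / (N : ℝ) ^ 2)) := by
  have h1 := norm_sum_le_of_le Finset.univ
    (fun i _ => hG.norm_row_expansion_le hN (H ω i) i)
  rw [Finset.sum_sub_distrib, sum_lexEdge, sum_lexEdge] at h1
  have e1 : ∀ e : LexEdge N, H ω (ofLex e.1).2 (ofLex e.1).1 = edgeEntry H e ω := fun e =>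
    hH.symm ω _ _
  have e2 : ∀ e : LexEdge N, H ω (ofLex e.1).1 (ofLex e.1).2 = edgeEntry H e ω := fun e => rfl
  simp only [e1, e2] at h1
  have e3 : ∀ e : LexEdge N,
      linCoeff G (H ω (ofLex e.1).1) (ofLex e.1).1 (ofLex e.1).2 * edgeEntry H e ω +
        sqCoeff G (H ω (ofLex e.1).1) (ofLex e.1).1 (ofLex e.1).2 *
          (edgeEntry H e ω ^ 2 - 1 / N : ℝ) +
      (linCoeff G (H ω (ofLex e.1).2) (ofLex e.1).2 (ofLex e.1).1 * edgeEntry H e ω +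
        sqCoeff G (H ω (ofLex e.1).2) (ofLex e.1).2 (ofLex e.1).1 *
          (edgeEntry H e ω ^ 2 - 1 / N : ℝ)) =
      (linCoeff G (H ω (ofLex e.1).1) (ofLex e.1).1 (ofLex e.1).2 +
        linCoeff G (H ω (ofLex e.1).2) (ofLex e.1).2 (ofLex e.1).1) * edgeEntry H e ω +
      (sqCoeff G (H ω (ofLex e.1).1) (ofLex e.1).1 (ofLex e.1).2 +
        sqCoeff G (H ω (ofLex e.1).2) (ofLex e.1).2 (ofLex e.1).1) *
          (edgeEntry H e ω ^ 2 - 1 / N : ℝ) := fun e => by ring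
  simp only [e3, Finset.sum_add_distrib (f := fun e : LexEdge N =>
    (linCoeff G (H ω (ofLex e.1).1) (ofLex e.1).1 (ofLex e.1).2 +
        linCoeff G (H ω (ofLex e.1).2) (ofLex e.1).2 (ofLex e.1).1) * (edgeEntry H e ω : ℂ)),
    ← two_mul] at h1
  have h2 := norm_add_le_of_le h1 (norm_add_le
    (∑ e : LexEdge N, (linCoeff G (H ω (ofLex e.1).1) (ofLex e.1).1 (ofLex e.1).2 +
        linCoeff G (H ω (ofLex e.1).2) (ofLex e.1).2 (ofLex e.1).1) * (edgeEntry H e ω : ℂ))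
    (∑ e : LexEdge N, (sqCoeff G (H ω (ofLex e.1).1) (ofLex e.1).1 (ofLex e.1).2 +
        sqCoeff G (H ω (ofLex e.1).2) (ofLex e.1).2 (ofLex e.1).1) *
          ((edgeEntry H e ω ^ 2 - 1 / N : ℝ) : ℂ)))
  rw [sub_add_cancel] at h2
  linarith

set_option maxHeartbeats 1000000 in
/-- Concentration of the empirical average of `expInt G` over the row sums. -/
theorem IsRandomLaplacianType.tail_expInt [IsProbabilityMeasure μ]
    (hH : IsRandomLaplacianType μ N β q c H) (hN : 0 < N) (hq : 1 ≤ q) {G : ℝ → ℂ} {K : ℝ}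
    (hG : WeightBound G K) (p : ℕ) (hp : 1 ≤ p) {lam : ℝ} (hlam : 1 ≤ lam) (hlq : lam ≤ q) :
    μ.real {ω | 60 * K * (lam / q) <
        ‖(∑ i, expInt G (∑ j ∈ Finset.univ.filter (· ≠ i), H ω i j)) / (N + 1) -
          expInt (fun t => G t * (gaussFactor N t : ℂ) ^ N) 0‖} ≤
      ((N : ℝ) + 1) ^ 2 * (empiricalConst (entryConst c) p / lam ^ (2 * p)) := by
  have hS := hH.edge_sparseFamily hN
  have hK := hG.nonneg
  have hN' : (1 : ℝ) ≤ N := by exact_mod_cast hN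
  have hN0 : (0 : ℝ) < N := by linarith
  have hq0 : 0 < q := by linarith
  have hqN := hH.q_sq_le hN
  have hlam0 : 0 < lam := by linarith
  set m := entryConst c with hm
  have hcard : ((Finset.univ : Finset (LexEdge N)).card : ℝ) ≤ ((N : ℝ) + 1) ^ 2 := by
    have := card_lexEdge_le (N := N)
    rw [Finset.card_univ]
    exact_mod_cast this
  have hcN : ((Finset.univ : Finset (LexEdge N)).card : ℝ) / N ≤ 2 * ((N : ℝ) + 1) := by
    rw [div_le_iff₀ hN0]
    nlinarith
  have hsN : √((N : ℝ) + 1) ^ 2 = N + 1 := Real.sq_sqrt (by linarith)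
  -- This makes the martingale size λ√(N + 1), divided by N + 1, at most λ/q.
  have hsqrt : q ≤ √((N : ℝ) + 1) := Real.le_sqrt_of_sq_le (by linarith)
  set s := √((N : ℝ) + 1) with hs
  have hs0 : 0 ≤ s := Real.sqrt_nonneg _
  have hls : lam * s ≤ lam / q * (N + 1) := by
    rw [← hsN, pow_two, div_mul_eq_mul_div, le_div_iff₀ hq0]
    nlinarith [mul_le_mul_of_nonneg_left hsqrt (mul_nonneg hlam0.le hs0)]
  have hinv : 1 / q ≤ 1 := by rw [div_le_one hq0]; exact hq
  -- the linear part
  have t1 := hS.tail_linear_complex (lam := lam)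
    (Y := fun e ω => linCoeff G (H ω (ofLex e.1).1) (ofLex e.1).1 (ofLex e.1).2 +
        linCoeff G (H ω (ofLex e.1).2) (ofLex e.1).2 (ofLex e.1).1)
    (fun e => (hH.measurable_linCoeff hG e (Or.inl ⟨rfl, rfl⟩)).add
      (hH.measurable_linCoeff hG e (Or.inr ⟨rfl, rfl⟩)))
    (α := fun _ => 2 * K) (fun _ => by positivity)
    (fun e ω => (norm_add_le_of_le (hG.norm_linCoeff_le _ _ _) (hG.norm_linCoeff_le _ _ _)).trans
      (two_mul K).ge) p Finset.univ (V := 4 * K * s) (B := 2 * K) (fun e => by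
        rw [div_eq_mul_one_div]; exact mul_le_of_le_one_right (by positivity) hinv)
    (by positivity) (by
      rw [Finset.sum_const, nsmul_eq_mul, mul_pow _ s, hsN, mul_comm, mul_div_assoc]
      nlinarith [mul_le_mul_of_nonneg_left hcN (sq_nonneg (2 * K)), sq_nonneg K,
        mul_nonneg (sq_nonneg K) hN0.le]) hlam0
  -- the quadratic part
  have hinv2 : 1 / q ^ 2 ≤ 1 := by
    rw [div_le_one (by positivity)]; exact one_le_pow₀ hq
  have hqN1 : ∀ {x : ℝ}, 0 ≤ x → x / (q ^ 2 * N) ≤ x / N := fun {x} hx =>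
    div_le_div_of_nonneg_left hx hN0 (le_mul_of_one_le_left hN0.le (one_le_pow₀ hq))
  have t2 := hS.tail_square_complex (lam := lam)
    (Y := fun e ω => sqCoeff G (H ω (ofLex e.1).1) (ofLex e.1).1 (ofLex e.1).2 +
        sqCoeff G (H ω (ofLex e.1).2) (ofLex e.1).2 (ofLex e.1).1)
    (fun e => (hH.measurable_sqCoeff hG e (Or.inl ⟨rfl, rfl⟩)).add
      (hH.measurable_sqCoeff hG e (Or.inr ⟨rfl, rfl⟩)))
    (α := fun _ => 2 * K) (fun _ => by positivity)
    (fun e ω => (norm_add_le_of_le (hG.norm_sqCoeff_le _ _ _) (hG.norm_sqCoeff_le _ _ _)).trans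
      (two_mul K).ge) p Finset.univ (V := 4 * K * s) (B := 2 * K) (fun e => by
        rw [div_eq_mul_one_div]; exact mul_le_of_le_one_right (by positivity) hinv2)
    (by positivity) (by
      refine (add_le_add_left (hqN1 (by positivity)) _).trans ?_
      rw [Finset.sum_const, nsmul_eq_mul, mul_pow _ s, hsN, mul_comm, mul_div_assoc]
      nlinarith [mul_le_mul_of_nonneg_left hcN (sq_nonneg (2 * K)), sq_nonneg K,
        mul_nonneg (sq_nonneg K) hN0.le]) hlam0
  -- the sum of squares
  have t3 := hS.tail_square (lam := lam) (Y := fun _ _ => 1) (fun _ => measurable_const)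
    (α := fun _ => 1) (fun _ => zero_le_one) (fun _ _ => by simp) p Finset.univ
    (V := 2 * s) (B := 1) (fun _ => hinv2) (by positivity) (by
      refine (add_le_add_left (hqN1 (by positivity)) _).trans ?_
      rw [Finset.sum_const, nsmul_eq_mul, mul_pow _ s, hsN]
      norm_num
      rw [Finset.card_univ] at hcN
      linarith) hlam0
  have t4 := measureReal_biUnion_finset_le (μ := μ) (Finset.univ : Finset (LexEdge N))
    (fun e => {ω | lam / q < |edgeEntry H e ω|})
  have t4' : ∑ e : LexEdge N, μ.real {ω | lam / q < |edgeEntry H e ω|} ≤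
      ((N : ℝ) + 1) ^ 2 * (m (2 * p) / lam ^ (2 * p)) := by
    refine (Finset.sum_le_sum fun e _ => hS.tail_entry e p hp hlam0).trans ?_
    rw [Finset.sum_const, nsmul_eq_mul]
    have := hS.const_nonneg (2 * p)
    gcongr
  have hM := momentConst_nonneg hS.const_nonneg p
  have hM2 := momentConst_nonneg hS.squareConst_nonneg p
  refine (measureReal_mono (s₂ := (({ω | 2 * (lam * (4 * K * s)) < ‖∑ e : LexEdge N,
      (linCoeff G (H ω (ofLex e.1).1) (ofLex e.1).1 (ofLex e.1).2 +
        linCoeff G (H ω (ofLex e.1).2) (ofLex e.1).2 (ofLex e.1).1) * edgeEntry H e ω‖} ∪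
      {ω | 2 * (lam * (4 * K * s)) < ‖∑ e : LexEdge N,
      (sqCoeff G (H ω (ofLex e.1).1) (ofLex e.1).1 (ofLex e.1).2 +
        sqCoeff G (H ω (ofLex e.1).2) (ofLex e.1).2 (ofLex e.1).1) *
        (edgeEntry H e ω ^ 2 - 1 / N : ℝ)‖}) ∪
      {ω | lam * (2 * s) < |∑ e : LexEdge N, 1 * (edgeEntry H e ω ^ 2 - 1 / N)|}) ∪
      ⋃ e ∈ (Finset.univ : Finset (LexEdge N)), {ω | lam / q < |edgeEntry H e ω|}) ?_).trans ?_
  · intro ω hω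
    by_contra hcon
    simp only [Set.mem_union, Set.mem_iUnion, Set.mem_ofPred_eq, not_or, not_exists, not_lt,
      Finset.mem_univ, exists_prop, true_and, one_mul] at hcon hω
    obtain ⟨⟨⟨c1, c2⟩, c3⟩, c4⟩ := hcon
    have key := hH.norm_sum_expInt_sub_le hN hG ω
    have hsq : ∑ e : LexEdge N, edgeEntry H e ω ^ 2 ≤ 4 * ((N : ℝ) + 1) := by
      have h1 := (abs_le.1 c3).2
      rw [Finset.sum_sub_distrib, Finset.sum_const, nsmul_eq_mul, mul_one_div] at h1
      have h2 : lam / q ≤ 1 := by rw [div_le_one hq0]; exact hlq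
      nlinarith
    -- Entries are at most λ/q, so |h|³ ≤ (λ/q) h², and the cubic remainder costs only the sum of
    -- squares, which is of order N.
    have hcub : ∑ e : LexEdge N, 2 * (K * (4 * |edgeEntry H e ω| ^ 3 + 1 / (N : ℝ) ^ 2)) ≤
        36 * K * (lam / q) * (N + 1) := by
      have h1 : ∀ e : LexEdge N, 2 * (K * (4 * |edgeEntry H e ω| ^ 3 + 1 / (N : ℝ) ^ 2)) ≤
          8 * K * (lam / q) * edgeEntry H e ω ^ 2 + 2 * K * (1 / (N : ℝ) ^ 2) := fun e => by
        have : |edgeEntry H e ω| ^ 3 ≤ lam / q * edgeEntry H e ω ^ 2 := by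
          rw [pow_succ', sq_abs]
          exact mul_le_mul_of_nonneg_right (c4 e) (sq_nonneg _)
        nlinarith
      refine (Finset.sum_le_sum fun e _ => h1 e).trans ?_
      rw [Finset.sum_add_distrib, ← Finset.mul_sum, Finset.sum_const, nsmul_eq_mul]
      have h2 : ((Finset.univ : Finset (LexEdge N)).card : ℝ) * (1 / (N : ℝ) ^ 2) ≤
          2 * (lam / q * (N + 1)) := by
        have h3 : 1 / (N : ℝ) ≤ lam / q := by
          rw [div_le_div_iff₀ hN0 hq0]
          nlinarith
        have h4 : ((Finset.univ : Finset (LexEdge N)).card : ℝ) * (1 / (N : ℝ) ^ 2) =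
            (Finset.univ : Finset (LexEdge N)).card / N * (1 / N) := by field_simp
        rw [h4]
        calc _ ≤ 2 * ((N : ℝ) + 1) * (lam / q) := by gcongr
          _ = _ := by ring
      have h3 : 0 ≤ 8 * K * (lam / q) := by positivity
      nlinarith [mul_le_mul_of_nonneg_left hsq h3, mul_le_mul_of_nonneg_left h2 hK]
    rw [Finset.sum_sub_distrib, Finset.sum_const, nsmul_eq_mul, Finset.card_univ,
      Fintype.card_fin] at key
    have hN1 : (0 : ℝ) < N + 1 := by linarith
    have hN1c : ((N : ℂ) + 1) ≠ 0 := by exact_mod_cast hN1.ne'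
    have e : (∑ i, expInt G (∑ j ∈ Finset.univ.filter (· ≠ i), H ω i j)) / ((N : ℂ) + 1) -
        expInt (fun t => G t * (gaussFactor N t : ℂ) ^ N) 0 =
        (∑ i, expInt G (∑ j ∈ Finset.univ.filter (· ≠ i), H ω i j) -
          ((N + 1 : ℕ) : ℂ) * expInt (fun t => G t * (gaussFactor N t : ℂ) ^ N) 0) /
          ((N + 1 : ℝ) : ℂ) := by
      push_cast; field_simp
    rw [e, norm_div, norm_real, Real.norm_of_nonneg hN1.le, lt_div_iff₀ hN1] at hω
    have hpos : 0 ≤ K * (lam / q * (N + 1)) := by positivity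
    have hle := mul_le_mul_of_nonneg_left hls hK
    -- The two martingales contribute 8 each and the remainder 36, in total 52 ≤ 60.
    have e16 : 2 * (lam * (4 * K * s)) = 8 * (K * (lam * s)) := by ring
    have e36 : 36 * K * (lam / q) * (N + 1) = 36 * (K * (lam / q * (N + 1))) := by ring
    have e60 : 60 * K * (lam / q) * (N + 1) = 60 * (K * (lam / q * (N + 1))) := by ring
    rw [e16] at c1 c2
    rw [e36] at hcub
    rw [e60] at hω
    linarith
  · refine (measureReal_union_le _ _).trans ?_
    have u1 := measureReal_union_le (μ := μ) ({ω | 2 * (lam * (4 * K * s)) < ‖∑ e : LexEdge N,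
      (linCoeff G (H ω (ofLex e.1).1) (ofLex e.1).1 (ofLex e.1).2 +
        linCoeff G (H ω (ofLex e.1).2) (ofLex e.1).2 (ofLex e.1).1) * edgeEntry H e ω‖} ∪
      {ω | 2 * (lam * (4 * K * s)) < ‖∑ e : LexEdge N,
      (sqCoeff G (H ω (ofLex e.1).1) (ofLex e.1).1 (ofLex e.1).2 +
        sqCoeff G (H ω (ofLex e.1).2) (ofLex e.1).2 (ofLex e.1).1) *
        (edgeEntry H e ω ^ 2 - 1 / N : ℝ)‖})
      {ω | lam * (2 * s) < |∑ e : LexEdge N, 1 * (edgeEntry H e ω ^ 2 - 1 / N)|}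
    have u2 := measureReal_union_le (μ := μ) {ω | 2 * (lam * (4 * K * s)) < ‖∑ e : LexEdge N,
      (linCoeff G (H ω (ofLex e.1).1) (ofLex e.1).1 (ofLex e.1).2 +
        linCoeff G (H ω (ofLex e.1).2) (ofLex e.1).2 (ofLex e.1).1) * edgeEntry H e ω‖}
      {ω | 2 * (lam * (4 * K * s)) < ‖∑ e : LexEdge N,
      (sqCoeff G (H ω (ofLex e.1).1) (ofLex e.1).1 (ofLex e.1).2 +
        sqCoeff G (H ω (ofLex e.1).2) (ofLex e.1).2 (ofLex e.1).1) *
        (edgeEntry H e ω ^ 2 - 1 / N : ℝ)‖}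
    have hone : (1 : ℝ) ≤ ((N : ℝ) + 1) ^ 2 := one_le_pow₀ (by linarith)
    set P1 := momentConst m p / lam ^ (2 * p)
    set P2 := momentConst (squareConst m) p / lam ^ (2 * p)
    have hP1 : 0 ≤ P1 := by positivity
    have hP2 : 0 ≤ P2 := by positivity
    have e : empiricalConst m p / lam ^ (2 * p) = 2 * P1 + 3 * P2 + m (2 * p) / lam ^ (2 * p) := by
      unfold empiricalConst; ring
    rw [e, mul_add]
    have : 2 * P1 + 3 * P2 ≤ ((N : ℝ) + 1) ^ 2 * (2 * P1 + 3 * P2) :=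
      le_mul_of_one_le_left (by positivity) hone
    linarith

end Empirical

end LaplacianRigidity
end

/-! ### The empirical measure of the diagonal is nearly Gaussian. -/

noncomputable section
namespace LaplacianRigidity

section DiagonalConcentration

open Complex Set

lemma integrableOn_pow_mul_exp_neg (k : ℕ) {v : ℝ} (hv : 0 < v) :
    IntegrableOn (fun t : ℝ => t ^ k * Real.exp (-(v * t))) (Ioi 0) := by
  have hk : (-1 : ℝ) < k := by
    have : (0 : ℝ) ≤ k := by positivity
    linarith
  have := integrableOn_rpow_mul_exp_neg_mul_rpow (p := 1) (s := k) (b := v) hk one_pos hv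
  simpa [Real.rpow_natCast] using this

lemma integral_pow_mul_exp_neg (k : ℕ) {v : ℝ} (hv : 0 < v) :
    ∫ t in Ioi (0 : ℝ), t ^ k * Real.exp (-(v * t)) = (1 / v) ^ (k + 1) * k.factorial := by
  have := Real.integral_rpow_mul_exp_neg_mul_Ioi (a := k + 1) (r := v) (by positivity) hv
  rw [Real.Gamma_nat_eq_factorial] at this
  rw [show (k : ℝ) + 1 = ((k + 1 : ℕ) : ℝ) by push_cast; ring, Real.rpow_natCast] at this
  rw [← this]
  refine setIntegral_congr_fun measurableSet_Ioi fun t _ => ?_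
  simp [Real.rpow_natCast]

/-- Constant in the moment bounds of `t ^ j e^{iwt}`, `j ≤ 1`, for `c ≤ Im w`. -/
def weightConst (c : ℝ) : ℝ := 120 * (1 + 1 / c) ^ 5

lemma weightBound_pow_mul_cexp {c : ℝ} (hc : 0 < c) {w : ℂ} (hw : c ≤ w.im) (a : ℂ) (ha : ‖a‖ = 1)
    {j : ℕ} (hj : j ≤ 1) :
    WeightBound (fun t => a * (t : ℂ) ^ j * cexp (I * w * t)) (weightConst c / w.im) := by
  have hw0 : 0 < w.im := hc.trans_le hw
  have hn : ∀ k : ℕ, ∀ t ∈ Ioi (0 : ℝ), t ^ k * ‖a * (t : ℂ) ^ j * cexp (I * w * t)‖ =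
      t ^ (k + j) * Real.exp (-(w.im * t)) := by
    intro k t ht
    have ht : (0 : ℝ) < t := ht
    rw [norm_mul, norm_mul, ha, one_mul, norm_pow, norm_real, Real.norm_of_nonneg ht.le, norm_exp,
      pow_add]
    have : (I * w * t).re = -(w.im * t) := by simp
    rw [this, mul_assoc]
  refine ⟨by fun_prop, fun k _ => ?_, fun k hk => ?_⟩
  · exact (integrableOn_pow_mul_exp_neg (k + j) hw0).congr_fun (fun t ht => (hn k t ht).symm)
      measurableSet_Ioi
  · rw [setIntegral_congr_fun measurableSet_Ioi (hn k), integral_pow_mul_exp_neg _ hw0, weightConst,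
      pow_succ]
    -- Here k + j ≤ 5, which accounts for the fifth power and for 120 = 5!. One factor 1/Im w is
    -- kept so that the bound decays with the height.
    have h1 : (1 / w.im) ^ (k + j) ≤ (1 + 1 / c) ^ 5 := by
      have h2 : 1 / w.im ≤ 1 + 1 / c := by
        have := one_div_le_one_div_of_le hc hw
        linarith
      have h3 : 1 ≤ 1 + 1 / c := by
        have : 0 < 1 / c := by positivity
        linarith
      calc _ ≤ (1 + 1 / c) ^ (k + j) := pow_le_pow_left₀ (by positivity) h2 _
        _ ≤ _ := pow_le_pow_right₀ h3 (by omega)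
    have h2 : ((k + j).factorial : ℝ) ≤ 120 := by
      have : (k + j).factorial ≤ (5).factorial := Nat.factorial_le (by omega)
      exact_mod_cast this
    calc (1 / w.im) ^ (k + j) * (1 / w.im) * ((k + j).factorial : ℝ) ≤
        (1 + 1 / c) ^ 5 * (1 / w.im) * 120 := by gcongr
      _ = _ := by ring

/-- The derivative in w of the Laplace representation, obtained from an explicit primitive of t
e^{bt}. -/
lemma one_div_sq_eq (x : ℝ) {w : ℂ} (hw : 0 < w.im) :
    1 / ((x : ℂ) - w) ^ 2 = -∫ t in Ioi (0 : ℝ), t * cexp (I * (w - x) * t) := by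
  set b : ℂ := I * (w - x) with hb
  have hre : b.re = -w.im := by simp [hb]
  have h1 := ofReal_sub_ne_zero x hw
  have hb0 : b ≠ 0 := by
    intro h
    rw [h] at hre
    simp only [zero_re] at hre
    linarith
  have hd : ∀ t ∈ Ici (0 : ℝ), HasDerivAt (fun t : ℝ => ((t : ℂ) / b - 1 / b ^ 2) * cexp (b * t))
      (t * cexp (b * t)) t := by
    intro t _
    have h2 : HasDerivAt (fun s : ℂ => (s / b - 1 / b ^ 2) * cexp (b * s)) (t * cexp (b * t)) (t : ℂ) := by
      have := (((hasDerivAt_id (t : ℂ)).div_const b).sub_const (1 / b ^ 2)).mul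
        (((hasDerivAt_id (t : ℂ)).const_mul b).cexp)
      convert! this using 1
      simp only [id]
      field_simp
      ring
    exact h2.comp_ofReal
  have hnorm : ∀ t : ℝ, ‖cexp (b * t)‖ = Real.exp (-(w.im * t)) := fun t => by
    rw [norm_exp]; simp [hre]
  have hint : IntegrableOn (fun t : ℝ => (t : ℂ) * cexp (b * t)) (Ioi 0) := by
    refine Integrable.mono' (integrableOn_pow_mul_exp_neg 1 hw) (by fun_prop)
      ((ae_restrict_mem measurableSet_Ioi).mono fun t ht => le_of_eq ?_)
    have ht : (0 : ℝ) < t := ht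
    rw [norm_mul, hnorm, norm_real, Real.norm_of_nonneg ht.le, pow_one]
  have hscale : Tendsto (fun t : ℝ => w.im * t) atTop atTop := tendsto_id.const_mul_atTop hw
  have hlim : Tendsto (fun t : ℝ => ((t : ℂ) / b - 1 / b ^ 2) * cexp (b * t)) atTop (𝓝 0) := by
    have l1 := ((Real.tendsto_pow_mul_exp_neg_atTop_nhds_zero 1).comp hscale).const_mul
      (1 / w.im * ‖1 / b‖)
    have l0 := ((Real.tendsto_pow_mul_exp_neg_atTop_nhds_zero 0).comp hscale).const_mul
      ‖1 / b ^ 2‖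
    have l := l1.add l0
    simp only [mul_zero, add_zero] at l
    refine squeeze_zero_norm' ?_ l
    filter_upwards [eventually_gt_atTop 0] with t ht
    rw [norm_mul, hnorm]
    refine (mul_le_mul_of_nonneg_right (norm_sub_le _ _) (Real.exp_pos _).le).trans_eq ?_
    rw [norm_div, norm_real, Real.norm_of_nonneg ht.le, norm_div 1 b, norm_one]
    simp only [Function.comp, pow_one, pow_zero]
    field_simp
  rw [integral_Ioi_of_hasDerivAt_of_tendsto' hd hint hlim]
  simp only [ofReal_zero, zero_div, mul_zero, exp_zero, mul_one, zero_sub, neg_neg]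
  rw [hb, mul_pow, I_sq]
  have h4 : (w - x) ^ 2 = ((x : ℂ) - w) ^ 2 := by ring
  rw [h4]
  field_simp

lemma gaussFactor_pow {N : ℕ} (hN : 0 < N) (t : ℝ) :
    (gaussFactor N t : ℂ) ^ N = cexp (-(t ^ 2 / 2)) := by
  have hN' : (N : ℝ) ≠ 0 := by exact_mod_cast hN.ne'
  rw [← ofReal_pow, gaussFactor, ← Real.exp_nat_mul]
  have : (N : ℝ) * -(t ^ 2 / (2 * N)) = -(t ^ 2 / 2) := by field_simp
  rw [this]
  push_cast
  rfl

/-- Derivative of `diagStieltjes`. -/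
def diagStieltjesDeriv {n : ℕ} (H : Matrix (Fin (n + 1)) (Fin (n + 1)) ℝ) (w : ℂ) : ℂ :=
  (∑ i, 1 / ((H i i : ℂ) - w) ^ 2) / (n + 1 : ℝ)

variable {Ω : Type*} [MeasurableSpace Ω] {μ : Measure Ω} {N : ℕ} {β q : ℝ} {c : ℕ → ℝ}
  {H : Ω → Matrix (Fin (N + 1)) (Fin (N + 1)) ℝ}

lemma IsRandomLaplacianType.sum_row (hH : IsRandomLaplacianType μ N β q c H) (ω : Ω)
    (i : Fin (N + 1)) : ∑ j ∈ Finset.univ.filter (· ≠ i), H ω i j = -H ω i i := by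
  rw [hH.diag ω i, neg_neg, Finset.filter_ne']

/-- For the weight i e^{iwt}, the Fourier integral at the row sum -H_ii is 1/(H_ii - w), and the N
Gaussian factors multiply to e^{-t²/2}, which gives m_G(w). -/
theorem IsRandomLaplacianType.tail_diagStieltjes [IsProbabilityMeasure μ]
    (hH : IsRandomLaplacianType μ N β q c H) (hN : 0 < N) (hq : 1 ≤ q) {a : ℝ} (ha : 0 < a)
    {w : ℂ} (hw : a ≤ w.im) (p : ℕ) (hp : 1 ≤ p) {lam : ℝ} (hlam : 1 ≤ lam) (hlq : lam ≤ q) :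
    μ.real {ω | 60 * (weightConst a / w.im) * (lam / q) <
        ‖diagStieltjes (H ω) w - gaussStieltjes w‖} ≤
      ((N : ℝ) + 1) ^ 2 * (empiricalConst (entryConst c) p / lam ^ (2 * p)) := by
  have hw0 : 0 < w.im := ha.trans_le hw
  have hG := weightBound_pow_mul_cexp ha hw I norm_I zero_le_one
  have key := hH.tail_expInt hN hq hG p hp hlam hlq
  have e1 : ∀ ω i, expInt (fun t => I * (t : ℂ) ^ 0 * cexp (I * w * t))
      (∑ j ∈ Finset.univ.filter (· ≠ i), H ω i j) = 1 / ((H ω i i : ℂ) - w) := by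
    intro ω i
    rw [hH.sum_row, one_div_ofReal_sub_eq _ hw0, expInt, ← integral_const_mul]
    refine setIntegral_congr_fun measurableSet_Ioi fun t _ => ?_
    simp only [pow_zero, mul_one]
    rw [mul_assoc, ← Complex.exp_add]
    congr 2
    push_cast
    ring
  have e2 : expInt (fun t => I * (t : ℂ) ^ 0 * cexp (I * w * t) * (gaussFactor N t : ℂ) ^ N) 0 =
      gaussStieltjes w := by
    rw [gaussStieltjes_eq hw0, halfMoment, expInt, ← integral_const_mul]
    refine setIntegral_congr_fun measurableSet_Ioi fun t _ => ?_
    simp only [pow_zero, mul_one, gaussFactor_pow hN, ofReal_zero, mul_zero, exp_zero, one_mul]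
    rw [mul_assoc, ← Complex.exp_add]
    congr 2
  simp only [e1, e2] at key
  simpa only [diagStieltjes, ofReal_add, ofReal_natCast, ofReal_one] using key

/-- The same with the weight -t e^{iwt}. The derivative enters the linearization in the stability
estimate. -/
theorem IsRandomLaplacianType.tail_diagStieltjesDeriv [IsProbabilityMeasure μ]
    (hH : IsRandomLaplacianType μ N β q c H) (hN : 0 < N) (hq : 1 ≤ q) {a : ℝ} (ha : 0 < a)
    {w : ℂ} (hw : a ≤ w.im) (p : ℕ) (hp : 1 ≤ p) {lam : ℝ} (hlam : 1 ≤ lam) (hlq : lam ≤ q) :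
    μ.real {ω | 60 * (weightConst a / w.im) * (lam / q) <
        ‖diagStieltjesDeriv (H ω) w - gaussStieltjesDeriv w‖} ≤
      ((N : ℝ) + 1) ^ 2 * (empiricalConst (entryConst c) p / lam ^ (2 * p)) := by
  have hw0 : 0 < w.im := ha.trans_le hw
  have hG := weightBound_pow_mul_cexp ha hw (-1) (by simp) le_rfl
  have key := hH.tail_expInt hN hq hG p hp hlam hlq
  have e1 : ∀ ω i, expInt (fun t => (-1) * (t : ℂ) ^ 1 * cexp (I * w * t))
      (∑ j ∈ Finset.univ.filter (· ≠ i), H ω i j) = 1 / ((H ω i i : ℂ) - w) ^ 2 := by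
    intro ω i
    rw [hH.sum_row, one_div_sq_eq _ hw0, expInt, ← integral_neg]
    refine setIntegral_congr_fun measurableSet_Ioi fun t _ => ?_
    simp only [pow_one]
    rw [mul_assoc, ← Complex.exp_add, neg_one_mul, neg_mul]
    congr 3
    push_cast
    ring
  have e2 : expInt (fun t => (-1) * (t : ℂ) ^ 1 * cexp (I * w * t) * (gaussFactor N t : ℂ) ^ N) 0 =
      gaussStieltjesDeriv w := by
    rw [gaussStieltjesDeriv_eq hw0, halfMoment, expInt, ← integral_neg]
    refine setIntegral_congr_fun measurableSet_Ioi fun t _ => ?_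
    simp only [pow_one, gaussFactor_pow hN, ofReal_zero, mul_zero, exp_zero, mul_one]
    rw [mul_assoc, ← Complex.exp_add, neg_one_mul, neg_mul]
    congr 3
  simp only [e1, e2] at key
  simpa only [diagStieltjesDeriv, ofReal_add, ofReal_natCast, ofReal_one] using key

end DiagonalConcentration

end LaplacianRigidity
end

/-! ### Independence of a row from the graph without its vertex. -/

noncomputable section
namespace LaplacianRigidity

section RowIndependence

open Matrix

variable {Ω : Type*} [MeasurableSpace Ω] {μ : Measure Ω}

/-- Fubini: a uniform bound on the sections of a set bounds its probability. -/
lemma measureReal_prodMk_le [IsProbabilityMeasure μ] {S T : Type*} [MeasurableSpace S]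
    [MeasurableSpace T] {U : Ω → S} {V : Ω → T} (hU : Measurable U) (hV : Measurable V)
    (hUV : IndepFun U V μ) {B : Set (S × T)} (hB : MeasurableSet B) {δ : ℝ} (hδ : 0 ≤ δ)
    (h : ∀ a, μ.real {ω | (a, V ω) ∈ B} ≤ δ) : μ.real {ω | (U ω, V ω) ∈ B} ≤ δ := by
  have hle : ∀ a, μ {ω | (a, V ω) ∈ B} ≤ ENNReal.ofReal δ := fun a => by
    rw [← ENNReal.ofReal_toReal (measure_ne_top μ {ω | (a, V ω) ∈ B})]
    exact ENNReal.ofReal_le_ofReal (h a)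
  have hmap := (indepFun_iff_map_prod_eq_prod_map_map hU.aemeasurable hV.aemeasurable).1 hUV
  have := Measure.isProbabilityMeasure_map (μ := μ) hU.aemeasurable
  have := Measure.isProbabilityMeasure_map (μ := μ) hV.aemeasurable
  have key : μ {ω | (U ω, V ω) ∈ B} ≤ ENNReal.ofReal δ := by
    have e1 : μ {ω | (U ω, V ω) ∈ B} = (μ.map fun ω => (U ω, V ω)) B :=
      (Measure.map_apply (hU.prodMk hV) hB).symm
    rw [e1, hmap, Measure.prod_apply hB]
    calc _ ≤ ∫⁻ _, ENNReal.ofReal δ ∂(μ.map U) := by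
          refine lintegral_mono fun a => ?_
          rw [Measure.map_apply hV (measurable_prodMk_left hB)]
          exact hle a
      _ = _ := by simp
  exact ENNReal.toReal_le_of_le_ofReal hδ key

/-- Cramer's formula with the inverse of 0 set to 0 holds for every matrix, singular or not, so
measurability needs no restriction. -/
lemma measurable_resolvent_apply {n : Type*} [Fintype n] [DecidableEq n] (z : ℂ) (k l : n) :
    Measurable fun A : n → n → ℝ => resolvent (Matrix.of A) z k l := by
  have hs : Continuous fun A : n → n → ℝ => shifted (Matrix.of A) z := by
    unfold shifted
    refine Continuous.sub ?_ continuous_const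
    refine continuous_matrix fun i j => ?_
    simp only [map_apply, of_apply]
    fun_prop
  have e : (fun A : n → n → ℝ => resolvent (Matrix.of A) z k l) = fun A =>
      ((shifted (Matrix.of A) z).det)⁻¹ * (shifted (Matrix.of A) z).adjugate k l := by
    ext A
    rw [resolvent, Matrix.inv_def, Ring.inverse_eq_inv', Matrix.smul_apply, smul_eq_mul]
  rw [e]
  exact (hs.matrix_det.measurable.inv).mul ((hs.matrix_adjugate.matrix_elem k l).measurable)

variable {N : ℕ} {β q : ℝ} {c : ℕ → ℝ} {H : Ω → Matrix (Fin (N + 1)) (Fin (N + 1)) ℝ}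

/-- The Laplacian of the graph with vertex `i` removed. -/
def reducedMinor (H : Matrix (Fin (N + 1)) (Fin (N + 1)) ℝ) (i : Fin (N + 1)) :
    Matrix (Fin N) (Fin N) ℝ := minor H i + diagonal (offRow H i)

lemma reducedMinor_isSymm {H : Matrix (Fin (N + 1)) (Fin (N + 1)) ℝ} (hH : H.IsSymm)
    (i : Fin (N + 1)) : (reducedMinor H i).IsSymm :=
  (minor_isSymm hH i).add (isSymm_diagonal _)

lemma IsRandomLaplacianType.isSymm (hH : IsRandomLaplacianType μ N β q c H) (ω : Ω) :
    (H ω).IsSymm := Matrix.ext fun i j => hH.symm ω j i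

/-- The `σ`-algebra of the entries on the edges in `s`. -/
@[reducible] def edgeSigma (H : Ω → Matrix (Fin (N + 1)) (Fin (N + 1)) ℝ)
    (s : Set {e : Fin (N + 1) × Fin (N + 1) // e.1 < e.2}) : MeasurableSpace Ω :=
  ⨆ e ∈ s, MeasurableSpace.comap (fun ω => H ω e.1.1 e.1.2) inferInstance

lemma IsRandomLaplacianType.measurable_edgeSigma (hH : IsRandomLaplacianType μ N β q c H)
    {s : Set {e : Fin (N + 1) × Fin (N + 1) // e.1 < e.2}} {i j : Fin (N + 1)} (h : i ≠ j)
    (hs : mkEdge h ∈ s) : Measurable[edgeSigma H s] fun ω => H ω i j := by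
  have h1 : MeasurableSpace.comap (fun ω => H ω (mkEdge h).1.1 (mkEdge h).1.2) inferInstance ≤
      edgeSigma H s :=
    le_iSup₂ (f := fun (e : {e : Fin (N + 1) × Fin (N + 1) // e.1 < e.2}) (_ : e ∈ s) =>
      MeasurableSpace.comap (fun ω => H ω e.1.1 e.1.2) inferInstance) (mkEdge h) hs
  simp only [hH.apply_mkEdge] at h1
  exact Measurable.of_comap_le h1

/-- Edges having `i` as an endpoint. -/
def incidentEdges (i : Fin (N + 1)) : Set {e : Fin (N + 1) × Fin (N + 1) // e.1 < e.2} :=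
  {e | e.1.1 = i ∨ e.1.2 = i}

lemma mkEdge_mem_incidentEdges {i j : Fin (N + 1)} (h : i ≠ j) : mkEdge h ∈ incidentEdges i := by
  rcases le_total i j with hij | hij <;> simp [incidentEdges, mkEdge, hij]

lemma mkEdge_mem_compl {i j k : Fin (N + 1)} (h : j ≠ k) (hj : j ≠ i) (hk : k ≠ i) :
    mkEdge h ∈ (incidentEdges i)ᶜ := by
  rcases le_total j k with hij | hij <;> simp [incidentEdges, mkEdge, hij, hj, hk]

/-- The added diagonal cancels exactly the edge to i in the row-sum condition. -/
lemma reducedMinor_diag_apply (hH : IsRandomLaplacianType μ N β q c H) (ω : Ω) (i : Fin (N + 1))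
    (k : Fin N) : reducedMinor (H ω) i k k =
      -∑ l ∈ Finset.univ.erase k, H ω (i.succAbove k) (i.succAbove l) := by
  have h1 := hH.diag ω (i.succAbove k)
  have h2 : ∑ j ∈ Finset.univ.erase (i.succAbove k), H ω (i.succAbove k) j =
      H ω (i.succAbove k) i + ∑ l ∈ Finset.univ.erase k, H ω (i.succAbove k) (i.succAbove l) := by
    have e1 := Finset.sum_erase_eq_sub (f := fun j => H ω (i.succAbove k) j)
      (Finset.mem_univ (i.succAbove k))
    have e2 := Finset.sum_erase_eq_sub (f := fun l => H ω (i.succAbove k) (i.succAbove l))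
      (Finset.mem_univ k)
    rw [e1, e2, Fin.sum_univ_succAbove _ i]
    ring
  rw [reducedMinor, Matrix.add_apply, diagonal_apply_eq, minor, submatrix_apply, offRow, h1, h2,
    hH.symm ω i]
  ring

/-- The two sides use complementary sets of edges: those avoiding i and those incident to i. -/
lemma IsRandomLaplacianType.indepFun_reducedMinor_offRow
    (hH : IsRandomLaplacianType μ N β q c H) (i : Fin (N + 1)) :
    IndepFun (fun ω (k l : Fin N) => reducedMinor (H ω) i k l) (fun ω => offRow (H ω) i) μ := by
  have hind := indep_iSup_of_disjoint
    (fun e : {e : Fin (N + 1) × Fin (N + 1) // e.1 < e.2} =>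
      (hH.measurable e.1.1 e.1.2).comap_le) hH.indep.iIndep
    (Set.disjoint_compl_left_iff_subset.2 (Set.Subset.refl (incidentEdges i)))
  have hU : Measurable[edgeSigma H (incidentEdges i)ᶜ]
      (fun ω (k l : Fin N) => reducedMinor (H ω) i k l) := by
    refine @measurable_pi_lambda _ _ _ (edgeSigma H (incidentEdges i)ᶜ) _ _ fun k =>
      @measurable_pi_lambda _ _ _ (edgeSigma H (incidentEdges i)ᶜ) _ _ fun l => ?_
    have hoff : ∀ {k l : Fin N}, k ≠ l → Measurable[edgeSigma H (incidentEdges i)ᶜ]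
        fun ω => H ω (i.succAbove k) (i.succAbove l) := fun {k l} hkl =>
      hH.measurable_edgeSigma (fun h => hkl (Fin.succAbove_right_injective h))
        (mkEdge_mem_compl _ (Fin.succAbove_ne i k) (Fin.succAbove_ne i l))
    by_cases hkl : k = l
    · subst hkl
      simp only [reducedMinor_diag_apply hH]
      refine Measurable.neg (Finset.measurable_fun_sum _ fun l hl => ?_)
      exact hoff (Finset.ne_of_mem_erase hl).symm
    · have : (fun ω => reducedMinor (H ω) i k l) =
          fun ω => H ω (i.succAbove k) (i.succAbove l) := by
        ext ω
        rw [reducedMinor, Matrix.add_apply, diagonal_apply_ne _ hkl, add_zero, minor,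
          submatrix_apply]
      rw [this]
      exact hoff hkl
  have hV : Measurable[edgeSigma H (incidentEdges i)] (fun ω => offRow (H ω) i) := by
    refine @measurable_pi_lambda _ _ _ (edgeSigma H (incidentEdges i)) _ _ fun k => ?_
    exact hH.measurable_edgeSigma (Fin.succAbove_ne i k).symm (mkEdge_mem_incidentEdges _)
  rw [IndepFun_iff_Indep]
  exact indep_of_indep_of_le_left (indep_of_indep_of_le_right hind hV.comap_le) hU.comap_le

lemma form_eq_sum {n : ℕ} (G : Matrix (Fin n) (Fin n) ℂ) (x : Fin n → ℝ) :
    cvec x ⬝ᵥ G *ᵥ cvec x = ∑ k, ∑ l, (x k : ℂ) * G k l * x l := by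
  simp only [dotProduct, mulVec, cvec, Finset.mul_sum, mul_assoc]

/-- Deviation of the quadratic form of a fixed resolvent in a sparse row. -/
lemma SparseFamily.tail_resolvent_form [IsProbabilityMeasure μ] {m : ℕ → ℝ}
    {X : Fin N → Ω → ℝ} (h : SparseFamily X μ N q m) {A : Matrix (Fin N) (Fin N) ℝ}
    (hA : A.IsSymm) {z : ℂ} (hz : 1 / q ≤ z.im) (p : ℕ) {lam : ℝ} (hlam : 1 ≤ lam) :
    μ.real {ω | 12 * lam ^ 2 / (q * z.im) * ((resolvent A z).trace.im / N + z.im) <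
        ‖cvec (fun k => X k ω) ⬝ᵥ resolvent A z *ᵥ cvec (fun k => X k ω) -
          (resolvent A z).trace / (N : ℝ)‖} ≤
      2 * (((N + 1) * momentConst m p + momentConst (squareConst m) p) / lam ^ (2 * p)) := by
  have hq := h.pos
  have hN := h.N_pos
  have hz0 : 0 < z.im := lt_of_lt_of_le (by positivity) hz
  set T := (resolvent A z).trace.im with hT
  have hT0 : 0 ≤ T := im_trace_resolvent_nonneg hA hz0
  have hsum : ∑ k, ∑ l, ‖resolvent A z k l‖ ^ 2 = T / z.im := by
    rw [hT, im_trace_resolvent hA hz0]; field_simp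
  have hrow : ∀ k, ∑ l, ‖resolvent A z k l‖ ^ 2 ≤ (1 / z.im) ^ 2 := fun k => by
    have := resolvent_col_sq_le hA hz0 k
    simp_rw [resolvent_symm hA z k]
    exact this
  set F := √(T / z.im) with hF
  have hF0 : 0 ≤ F := Real.sqrt_nonneg _
  have hFsq : F ^ 2 = T / z.im := Real.sq_sqrt (by positivity)
  -- By the Ward identity F² = T/η, so the arithmetic–geometric mean inequality bounds η F/√N by
  -- half of T/N + η; the other term uses 1/q ≤ η. The factor 2 accounts for treating real and
  -- imaginary parts separately.
  have hthr : 4 * lam ^ 2 * (F / (q * √N) + 1 / z.im / q ^ 2) * 2 ≤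
      12 * lam ^ 2 / (q * z.im) * (T / N + z.im) := by
    have e1 : F / √N * z.im ≤ (T / N + z.im) / 2 := by
      have hs : (F / √N) ^ 2 * z.im = T / N := by
        rw [div_pow, Real.sq_sqrt hN.le, hFsq]; field_simp
      have : F / √N * z.im * 2 ≤ (F / √N) ^ 2 * z.im + z.im := by
        nlinarith [sq_nonneg (F / √N - 1)]
      linarith
    have e2 : 1 / q ≤ T / N + z.im := by
      have : 0 ≤ T / N := by positivity
      linarith
    have e3 : F / (q * √N) + 1 / z.im / q ^ 2 =
        (F / √N * z.im + 1 / q) / (q * z.im) := by field_simp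
    rw [e3]
    have e4 : 12 * lam ^ 2 / (q * z.im) * (T / N + z.im) =
      4 * lam ^ 2 * ((3 / 2 * (T / N + z.im)) / (q * z.im)) * 2 := by ring
    rw [e4]
    gcongr
    linarith
  refine le_trans (measureReal_mono fun ω hω => ?_) (measureReal_lt_norm_le
    (Z := fun ω => cvec (fun k => X k ω) ⬝ᵥ resolvent A z *ᵥ cvec (fun k => X k ω) -
          (resolvent A z).trace / (N : ℝ))
    (a := 4 * lam ^ 2 * (F / (q * √N) + 1 / z.im / q ^ 2)) ?_ ?_)
  · simp only [Set.mem_ofPred_eq] at hω ⊢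
    linarith
  · have := h.tail_quadratic (fun k l => (resolvent A z k l).re)
      (fun k l => by rw [resolvent_symm hA z k l]) (F := F) (R := 1 / z.im) hF0
      (by
        rw [hFsq, ← hsum]
        refine Finset.sum_le_sum fun k _ => Finset.sum_le_sum fun l _ => ?_
        rw [← sq_abs]
        exact pow_le_pow_left₀ (abs_nonneg _) (Complex.abs_re_le_norm _) 2) (by positivity)
      (fun k => by
        refine le_trans (Finset.sum_le_sum fun l _ => ?_) (hrow k)
        rw [← sq_abs]
        exact pow_le_pow_left₀ (abs_nonneg _) (Complex.abs_re_le_norm _) 2) hlam p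
    simp only [form_eq_sum, Complex.sub_re, Complex.re_sum, Complex.div_ofReal_re,
      Matrix.trace, Matrix.diag_apply, Complex.re_mul_ofReal, Complex.re_ofReal_mul]
    exact this
  · have := h.tail_quadratic (fun k l => (resolvent A z k l).im)
      (fun k l => by rw [resolvent_symm hA z k l]) (F := F) (R := 1 / z.im) hF0
      (by
        rw [hFsq, ← hsum]
        refine Finset.sum_le_sum fun k _ => Finset.sum_le_sum fun l _ => ?_
        rw [← sq_abs]
        exact pow_le_pow_left₀ (abs_nonneg _) (Complex.abs_im_le_norm _) 2) (by positivity)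
      (fun k => by
        refine le_trans (Finset.sum_le_sum fun l _ => ?_) (hrow k)
        rw [← sq_abs]
        exact pow_le_pow_left₀ (abs_nonneg _) (Complex.abs_im_le_norm _) 2) hlam p
    simp only [form_eq_sum, Complex.sub_im, Complex.im_sum, Complex.div_ofReal_im,
      Matrix.trace, Matrix.diag_apply, Complex.im_mul_ofReal, Complex.im_ofReal_mul]
    exact this

/-- Deviation of the quadratic form of row `i` in the resolvent of the reduced minor. -/
theorem IsRandomLaplacianType.tail_row_form [IsProbabilityMeasure μ]
    (hH : IsRandomLaplacianType μ N β q c H) (hN : 0 < N) (i : Fin (N + 1)) {z : ℂ}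
    (hz : 1 / q ≤ z.im) (p : ℕ) {lam : ℝ} (hlam : 1 ≤ lam) :
    μ.real {ω | 12 * lam ^ 2 / (q * z.im) *
          ((resolvent (reducedMinor (H ω) i) z).trace.im / N + z.im) <
        ‖cvec (offRow (H ω) i) ⬝ᵥ resolvent (reducedMinor (H ω) i) z *ᵥ cvec (offRow (H ω) i) -
          (resolvent (reducedMinor (H ω) i) z).trace / (N : ℝ)‖} ≤
      2 * (((N + 1) * momentConst (entryConst c) p +
        momentConst (squareConst (entryConst c)) p) / lam ^ (2 * p)) := by
  have hS := hH.row_sparseFamily hN i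
  have hV : Measurable (fun ω => offRow (H ω) i) := measurable_pi_lambda _ fun k =>
    hH.measurable _ _
  have hU : Measurable (fun ω (k l : Fin N) => reducedMinor (H ω) i k l) := by
    refine measurable_pi_lambda _ fun k => measurable_pi_lambda _ fun l => ?_
    simp only [reducedMinor, Matrix.add_apply, minor, submatrix_apply, diagonal_apply]
    refine (hH.measurable _ _).add ?_
    split_ifs
    · exact hH.measurable _ _
    · exact measurable_const
  have hM := momentConst_nonneg hS.const_nonneg p
  have hM2 := momentConst_nonneg hS.squareConst_nonneg p
  have hr : ∀ k l : Fin N, Measurable fun x : (Fin N → Fin N → ℝ) × (Fin N → ℝ) =>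
      resolvent (Matrix.of x.1) z k l := fun k l =>
    (measurable_resolvent_apply z k l).comp measurable_fst
  have htr : Measurable fun x : (Fin N → Fin N → ℝ) × (Fin N → ℝ) =>
      (resolvent (Matrix.of x.1) z).trace := by
    simp only [Matrix.trace, Matrix.diag_apply]
    exact Finset.measurable_fun_sum _ fun k _ => hr k k
  have hx : ∀ k : Fin N, Measurable fun x : (Fin N → Fin N → ℝ) × (Fin N → ℝ) =>
      ((x.2 k : ℝ) : ℂ) := fun k => by fun_prop
  have hform : Measurable fun x : (Fin N → Fin N → ℝ) × (Fin N → ℝ) =>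
      cvec x.2 ⬝ᵥ resolvent (Matrix.of x.1) z *ᵥ cvec x.2 := by
    simp only [form_eq_sum]
    exact Finset.measurable_fun_sum _ fun k _ => Finset.measurable_fun_sum _ fun l _ =>
      ((hx k).mul (hr k l)).mul (hx l)
  -- Symmetry is made part of the set because the bound for a frozen matrix needs it; sections at
  -- nonsymmetric matrices are then empty.
  have hB : MeasurableSet {x : (Fin N → Fin N → ℝ) × (Fin N → ℝ) | (∀ k l, x.1 k l = x.1 l k) ∧
      12 * lam ^ 2 / (q * z.im) * ((resolvent (Matrix.of x.1) z).trace.im / N + z.im) <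
        ‖cvec x.2 ⬝ᵥ resolvent (Matrix.of x.1) z *ᵥ cvec x.2 -
          (resolvent (Matrix.of x.1) z).trace / (N : ℝ)‖} := by
    refine MeasurableSet.inter ?_ ?_
    · have : {x : (Fin N → Fin N → ℝ) × (Fin N → ℝ) | ∀ k l, x.1 k l = x.1 l k} =
          ⋂ k, ⋂ l, {x | x.1 k l = x.1 l k} := by ext x; simp
      change MeasurableSet {x : (Fin N → Fin N → ℝ) × (Fin N → ℝ) | ∀ k l, x.1 k l = x.1 l k}
      rw [this]
      exact MeasurableSet.iInter fun k => MeasurableSet.iInter fun l =>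
        measurableSet_eq_fun (by fun_prop) (by fun_prop)
    · exact measurableSet_lt
        ((((Complex.measurable_im.comp htr).div_const _).add_const _).const_mul _)
        (hform.sub (htr.div_const _)).norm
  have key := measureReal_prodMk_le hU hV (hH.indepFun_reducedMinor_offRow i) hB
    (δ := 2 * (((N + 1) * momentConst (entryConst c) p +
        momentConst (squareConst (entryConst c)) p) / lam ^ (2 * p))) (by positivity) fun A => ?_
  · refine le_trans (measureReal_mono fun ω hω => ?_) key
    simp only [Set.mem_ofPred_eq] at hω ⊢
    refine ⟨fun k l => (reducedMinor_isSymm (hH.isSymm ω) i).apply l k, hω⟩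
  · by_cases hA : ∀ k l, A k l = A l k
    · refine le_trans (measureReal_mono fun ω hω => ?_)
        (hS.tail_resolvent_form (A := Matrix.of A) (Matrix.ext fun k l => hA l k) hz p hlam)
      exact hω.2
    · have : {ω | (A, offRow (H ω) i) ∈ {x : (Fin N → Fin N → ℝ) × (Fin N → ℝ) |
          (∀ k l, x.1 k l = x.1 l k) ∧
      12 * lam ^ 2 / (q * z.im) * ((resolvent (Matrix.of x.1) z).trace.im / N + z.im) <
        ‖cvec x.2 ⬝ᵥ resolvent (Matrix.of x.1) z *ᵥ cvec x.2 -
          (resolvent (Matrix.of x.1) z).trace / (N : ℝ)‖}} = ∅ := by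
        ext ω
        simp only [Set.mem_ofPred_eq, Set.mem_empty_iff_false, iff_false]
        exact fun h => hA h.1
      rw [this, measureReal_empty]
      positivity

end RowIndependence

end LaplacianRigidity
end

/-! ### Stability of the self-consistent equation. -/

noncomputable section
namespace LaplacianRigidity

section Stability

open Matrix

variable {N : ℕ}

/-- The matrix entries, quadratic forms and diagonal statistics entering the self-consistent
equation at `z` do not deviate much from their expectations. -/
structure RegularAt (A : Matrix (Fin (N + 1)) (Fin (N + 1)) ℝ) (C lam q : ℝ) (z : ℂ) : Prop where
  entry : ∀ i k, |offRow A i k| ≤ lam / q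
  form : ∀ i, ‖cvec (offRow A i) ⬝ᵥ resolvent (reducedMinor A i) z *ᵥ cvec (offRow A i) -
      (resolvent (reducedMinor A i) z).trace / (N : ℝ)‖ ≤
    12 * lam ^ 2 / (q * z.im) * ((resolvent (reducedMinor A i) z).trace.im / N + z.im)
  diag : ‖diagStieltjes A (subord z) - gaussStieltjes (subord z)‖ ≤
    C / (subord z).im * (lam / q)
  diagDeriv : ‖diagStieltjesDeriv A (subord z) - gaussStieltjesDeriv (subord z)‖ ≤
    C / (subord z).im * (lam / q)

lemma norm_diagStieltjes_le (A : Matrix (Fin (N + 1)) (Fin (N + 1)) ℝ) {w : ℂ} {c : ℝ}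
    (hc : 0 < c) (hw : c ≤ w.im) : ‖diagStieltjes A w‖ ≤ 1 / c := by
  have hN : (0 : ℝ) < N + 1 := by positivity
  rw [diagStieltjes, norm_div, Complex.norm_real, Real.norm_of_nonneg hN.le, div_le_iff₀ hN]
  refine (norm_sum_le_of_le _ fun i _ => norm_one_div_le (A i i) hc hw).trans_eq ?_
  simp [mul_comm]

/-- Second-order Taylor bound for `diagStieltjes`. -/
lemma norm_diagStieltjes_taylor_le (A : Matrix (Fin (N + 1)) (Fin (N + 1)) ℝ) {w w₀ : ℂ}
    {a b : ℝ} (ha : 0 < a) (hw : a ≤ w.im) (hb : 0 < b) (hw₀ : b ≤ w₀.im) :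
    ‖diagStieltjes A w - diagStieltjes A w₀ - (w - w₀) * diagStieltjesDeriv A w₀‖ ≤
      ‖w - w₀‖ ^ 2 * (1 / a * (1 / b) ^ 2) := by
  have hN : (0 : ℝ) < N + 1 := by positivity
  have e : diagStieltjes A w - diagStieltjes A w₀ - (w - w₀) * diagStieltjesDeriv A w₀ =
      (∑ i, (w - w₀) ^ 2 * (1 / ((A i i : ℂ) - w) * (1 / ((A i i : ℂ) - w₀)) ^ 2)) /
        ((N + 1 : ℝ) : ℂ) := by
    rw [diagStieltjes, diagStieltjes, diagStieltjesDeriv, mul_div_assoc', ← sub_div, ← sub_div,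
      Finset.mul_sum, ← Finset.sum_sub_distrib, ← Finset.sum_sub_distrib]
    congr 1
    refine Finset.sum_congr rfl fun i _ => ?_
    have h1 := ofReal_sub_ne_zero (A i i) (ha.trans_le hw)
    have h2 := ofReal_sub_ne_zero (A i i) (hb.trans_le hw₀)
    field_simp
    ring
  rw [e, norm_div, Complex.norm_real, Real.norm_of_nonneg hN.le, div_le_iff₀ hN]
  refine (norm_sum_le_of_le _ (f := fun i => (w - w₀) ^ 2 * (1 / ((A i i : ℂ) - w) *
    (1 / ((A i i : ℂ) - w₀)) ^ 2)) (fun i _ => ?_)).trans_eq (b := ∑ _i : Fin (N + 1),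
      ‖w - w₀‖ ^ 2 * (1 / a * (1 / b) ^ 2)) ?_
  · rw [norm_mul, norm_pow, norm_mul, norm_pow]
    have h1 := norm_one_div_le (A i i) ha hw
    have h2 := norm_one_div_le (A i i) hb hw₀
    gcongr
  · simp [mul_comm]

/-- Constant in the stability estimate. -/
def stabConst (c C : ℝ) : ℝ := 2 / c * (64 / c + C)

/-- Stability of the self-consistent equation: a rough bound improves to an optimal one. -/
theorem norm_stieltjes_sub_freeStieltjes_le {A : Matrix (Fin (N + 1)) (Fin (N + 1)) ℝ}
    (hA : A.IsSymm) (hN : 0 < N) {c C lam q : ℝ} {z : ℂ} (hc : 0 < c) (hc1 : c ≤ 1) (hC : 0 ≤ C)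
    (hlam : 1 ≤ lam) (hq : 1 ≤ q) (hqN : q ^ 2 ≤ N) (hzq : 1 / q ≤ z.im)
    (hε : 12 * lam ^ 2 / (q * z.im) ≤ 1 / 100) (hCq : C / c * (lam / q) ≤ c / 4)
    (hreg : RegularAt A C lam q z) (h1 : c ≤ (subord z).im)
    (h2 : c ≤ ‖1 - gaussStieltjesDeriv (subord z)‖)
    (hr : ‖stieltjes A z - freeStieltjes z‖ ≤ c ^ 4 / 8) :
    ‖stieltjes A z - freeStieltjes z‖ ≤ stabConst c C * (12 * lam ^ 2 / (q * z.im)) := by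
  have hq0 : 0 < q := by linarith
  have hlam0 : 0 < lam := by linarith
  have hz : 0 < z.im := lt_of_lt_of_le (by positivity) hzq
  have hN0 : (0 : ℝ) < N := by exact_mod_cast hN
  set ε := 12 * lam ^ 2 / (q * z.im) with hεdef
  have hε0 : 0 ≤ ε := by positivity
  have hll : lam ≤ lam ^ 2 := by nlinarith
  have hlε : lam / q / z.im ≤ ε := by
    rw [hεdef, div_div]
    gcongr
    nlinarith
  have hself := norm_stieltjes_sub_diagStieltjes_le hA hN hz hε0 hε hreg.entry hlε (by
    have e : ε * z.im = 12 * lam ^ 2 / q := by rw [hεdef]; field_simp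
    rw [e, div_le_div_iff₀ (by positivity) hq0]
    have h3 : 1 ≤ z.im * q := by rwa [div_le_iff₀ hq0] at hzq
    have h4 : 1 * q ≤ (z.im * q) * (N * 1) := by
      have : q ≤ N := by nlinarith
      nlinarith
    have h5 : N * z.im ≤ 12 * lam ^ 2 * (N * z.im) :=
      le_mul_of_one_le_left (by positivity) (by nlinarith)
    nlinarith) hreg.form
  set w := z + stieltjes A z with hw
  set w₀ := subord z with hw₀
  have hfree : w₀ = z + freeStieltjes z := by rw [freeStieltjes]; ring
  have hJ : freeStieltjes z = gaussStieltjes w₀ := freeStieltjes_eq hz.le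
  have hΔ : stieltjes A z - freeStieltjes z = w - w₀ := by rw [hfree, hw]; ring
  have hw₀im : 0 < w₀.im := hc.trans_le h1
  rw [hΔ] at hr ⊢
  set Δ := ‖w - w₀‖ with hΔdef
  have hΔ0 : 0 ≤ Δ := norm_nonneg _
  -- The rough bound thus keeps Im w ≥ c/2, so that `diagStieltjes` and its Taylor remainder are
  -- controlled at w.
  have hc4 : c ^ 4 / 8 ≤ c / 2 := by
    have : c ^ 4 ≤ c := pow_le_of_le_one hc.le hc1 (by norm_num)
    linarith
  have hwim : c / 2 ≤ w.im := by
    have h3 := (abs_le.1 (Complex.abs_im_le_norm (w - w₀))).1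
    rw [Complex.sub_im] at h3
    linarith
  have hM := norm_diagStieltjes_le A (half_pos hc) hwim
  have hIm : (diagStieltjes A w).im ≤ 2 / c := by
    refine ((le_abs_self _).trans (Complex.abs_im_le_norm _)).trans (hM.trans_eq ?_)
    field_simp
  have t1 : ‖stieltjes A z - diagStieltjes A w‖ ≤ 64 / c * ε := by
    refine hself.trans ?_
    calc 32 * ε * (diagStieltjes A w).im ≤ 32 * ε * (2 / c) := by gcongr
      _ = _ := by ring
  have t2 := norm_diagStieltjes_taylor_le A (half_pos hc) hwim hc h1
  -- The factor 1/Im w₀ in the regularity event is at most 1/Im z, and therefore matches the decay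
  -- of ε in the height.
  have hsub : C / w₀.im * (lam / q) ≤ C * ε := by
    have h3 : z.im ≤ w₀.im := im_le_subord_im hz.le
    calc C / w₀.im * (lam / q) ≤ C / z.im * (lam / q) := by gcongr
      _ = C * (lam / q / z.im) := by ring
      _ ≤ _ := by gcongr
  have t3 : ‖diagStieltjes A w₀ - gaussStieltjes w₀‖ ≤ C * ε := hreg.diag.trans hsub
  have t4 : ‖diagStieltjesDeriv A w₀ - gaussStieltjesDeriv w₀‖ ≤ c / 4 := by
    refine hreg.diagDeriv.trans (le_trans ?_ hCq)
    gcongr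
  -- Linearization at w₀. The four terms are the Schur error, the Taylor remainder, and the
  -- deviations of the diagonal statistic and of its derivative.
  have key : (w - w₀) * (1 - gaussStieltjesDeriv w₀) =
      (stieltjes A z - diagStieltjes A w) +
        (diagStieltjes A w - diagStieltjes A w₀ - (w - w₀) * diagStieltjesDeriv A w₀) +
        (diagStieltjes A w₀ - gaussStieltjes w₀) +
        (w - w₀) * (diagStieltjesDeriv A w₀ - gaussStieltjesDeriv w₀) := by
    rw [hJ] at hΔ
    linear_combination -hΔ
  have hn := congrArg norm key
  rw [norm_mul] at hn
  have hle : Δ * ‖1 - gaussStieltjesDeriv w₀‖ ≤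
      64 / c * ε + Δ ^ 2 * (1 / (c / 2) * (1 / c) ^ 2) + C * ε + Δ * (c / 4) := by
    rw [hn]
    refine norm_add_le_of_le (norm_add_le_of_le (norm_add_le_of_le t1 t2) t3) ?_
    rw [norm_mul]
    gcongr
  have h5 : Δ * c ≤ Δ * ‖1 - gaussStieltjesDeriv w₀‖ := by gcongr
  -- The threshold c⁴/8 is calibrated so that the quadratic term is at most Δc/4. With the
  -- derivative error Δc/4, half of the factor c survives.
  have h6 : Δ ^ 2 * (1 / (c / 2) * (1 / c) ^ 2) ≤ Δ * (c / 4) := by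
    have e : Δ ^ 2 * (1 / (c / 2) * (1 / c) ^ 2) = Δ * (Δ * (2 / c ^ 3)) := by field_simp
    rw [e]
    have : Δ * (2 / c ^ 3) ≤ c ^ 4 / 8 * (2 / c ^ 3) := by gcongr
    have e2 : c ^ 4 / 8 * (2 / c ^ 3) = c / 4 := by field_simp; norm_num
    rw [e2] at this
    gcongr
  have h7 : Δ * (c / 2) ≤ (64 / c + C) * ε := by linarith
  rw [stabConst]
  have e8 : 2 / c * (64 / c + C) * ε = ((64 / c + C) * ε) / (c / 2) := by field_simp
  rw [e8, le_div_iff₀ (half_pos hc)]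
  exact h7

lemma norm_gaussStieltjes_le_one_div {w : ℂ} (hw : 0 < w.im) : ‖gaussStieltjes w‖ ≤ 1 / w.im := by
  have := norm_integral_le_of_norm_le_const (μ := stdGauss) (f := fun x : ℝ => 1 / ((x : ℂ) - w))
    (ae_of_all _ fun x => norm_one_div_le x hw le_rfl)
  simpa [gaussStieltjes] using this

/-- Start of the descent: at great height both transforms are small. -/
lemma norm_stieltjes_sub_freeStieltjes_le_of_im {A : Matrix (Fin (N + 1)) (Fin (N + 1)) ℝ}
    (hA : A.IsSymm) {z : ℂ} (hz : 0 < z.im) :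
    ‖stieltjes A z - freeStieltjes z‖ ≤ 2 / z.im := by
  have h1 := norm_stieltjes_le hA hz
  have h2 : ‖freeStieltjes z‖ ≤ 1 / z.im := by
    rw [freeStieltjes_eq hz.le]
    exact (norm_gaussStieltjes_le_one_div (subord_im_pos hz.le)).trans
      (one_div_le_one_div_of_le hz (im_le_subord_im hz.le))
  refine (norm_sub_le _ _).trans ((add_le_add h1 h2).trans_eq ?_)
  ring

end Stability

end LaplacianRigidity
end

/-! ### Spectral representation of the trace and crude eigenvalue bounds. -/

noncomputable section
namespace LaplacianRigidity

section Spectral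

open Matrix

variable {n : Type*} [Fintype n] [DecidableEq n]

lemma isHermitian_of_isSymm {m : Type*} {A : Matrix m m ℝ} (hA : A.IsSymm) : A.IsHermitian := by
  rw [Matrix.IsHermitian, conjTranspose_eq_transpose_of_trivial]; exact hA

/-- The trace of the resolvent as a sum over eigenvalues. -/
lemma trace_resolvent_eq {A : Matrix n n ℝ} (hA : A.IsSymm) {z : ℂ} (hz : 0 < z.im) :
    (resolvent A z).trace =
      ∑ i, 1 / (((isHermitian_of_isSymm hA).eigenvalues i : ℂ) - z) := by
  set hH := isHermitian_of_isSymm hA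
  set U : Matrix n n ℝ := (hH.eigenvectorUnitary).1 with hU
  have h1 : U * star U = 1 := Unitary.coe_mul_star_self _
  have h2 : star U * U = 1 := Unitary.coe_star_mul_self _
  have hspec : A = U * diagonal hH.eigenvalues * star U := by
    conv_lhs => rw [hH.spectral_theorem, Unitary.conjStarAlgAut_apply]
    rfl
  set f : Matrix n n ℝ →+* Matrix n n ℂ := RingHom.mapMatrix (algebraMap ℝ ℂ) with hf
  set Uc := f U
  set Vc := f (star U)
  have c1 : Uc * Vc = 1 := by rw [← map_mul, h1, map_one]
  have c2 : Vc * Uc = 1 := by rw [← map_mul, h2, map_one]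
  have hd : f (diagonal hH.eigenvalues) = diagonal fun i => (hH.eigenvalues i : ℂ) := by
    ext i j
    by_cases hij : i = j
    · subst hij; simp [hf]
    · simp [hf, hij]
  have hAc : f A = Uc * (diagonal fun i => (hH.eigenvalues i : ℂ)) * Vc := by
    rw [← hd, ← map_mul, ← map_mul, ← hspec]
  have hs : shifted A z = Uc * (diagonal fun i => (hH.eigenvalues i : ℂ) - z) * Vc := by
    have e : (diagonal fun i => (hH.eigenvalues i : ℂ) - z) =
        (diagonal fun i => (hH.eigenvalues i : ℂ)) - z • (1 : Matrix n n ℂ) := by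
      rw [← diagonal_one, ← diagonal_smul, diagonal_sub]
      congr 1; ext i; simp
    rw [e, mul_sub, sub_mul, ← hAc, Matrix.mul_smul, Matrix.smul_mul, mul_one, c1]
    rfl
  have hinv : resolvent A z = Uc * (diagonal fun i => 1 / ((hH.eigenvalues i : ℂ) - z)) * Vc := by
    refine Matrix.inv_eq_right_inv ?_
    have e : (diagonal fun i => (hH.eigenvalues i : ℂ) - z) *
        (diagonal fun i => 1 / ((hH.eigenvalues i : ℂ) - z)) = 1 := by
      rw [diagonal_mul_diagonal, ← diagonal_one]
      congr 1; ext i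
      exact mul_one_div_cancel (ofReal_sub_ne_zero _ hz)
    calc shifted A z * (Uc * (diagonal fun i => 1 / ((hH.eigenvalues i : ℂ) - z)) * Vc)
        = Uc * (diagonal fun i => (hH.eigenvalues i : ℂ) - z) * (Vc * Uc) *
          (diagonal fun i => 1 / ((hH.eigenvalues i : ℂ) - z)) * Vc := by
          rw [hs]; simp only [mul_assoc]
      _ = 1 := by rw [c2, mul_one, mul_assoc Uc, e, mul_one, c1]
  rw [hinv, trace_mul_comm, ← mul_assoc, c2, one_mul, trace_diagonal]

/-- Gershgorin bound for the eigenvalues. -/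
lemma abs_eigenvalues_le {A : Matrix n n ℝ} (hA : A.IsHermitian) {R : ℝ}
    (h : ∀ i, ∑ j, |A i j| ≤ R) (i : n) : |hA.eigenvalues i| ≤ R := by
  have hev : Module.End.HasEigenvalue (Matrix.toLin' A) (hA.eigenvalues i) := by
    refine Module.End.hasEigenvalue_of_hasEigenvector (x := ⇑(hA.eigenvectorBasis i)) ⟨?_, ?_⟩
    · rw [Module.End.mem_eigenspace_iff, Matrix.toLin'_apply, hA.mulVec_eigenvectorBasis]
    · intro h0
      refine hA.eigenvectorBasis.toBasis.ne_zero i ?_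
      ext j
      exact congrFun h0 j
  obtain ⟨k, hk⟩ := eigenvalue_mem_ball hev
  rw [Metric.mem_closedBall, Real.dist_eq] at hk
  have h1 := abs_sub_abs_le_abs_sub (hA.eigenvalues i) (A k k)
  have h2 := Finset.add_sum_erase (Finset.univ) (fun j => |A k j|) (Finset.mem_univ k)
  simp only [Real.norm_eq_abs] at hk
  linarith [h k]

variable {N : ℕ}

lemma stieltjes_eq_sum {A : Matrix (Fin (N + 1)) (Fin (N + 1)) ℝ} (hA : A.IsSymm) {z : ℂ}
    (hz : 0 < z.im) : stieltjes A z =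
      (∑ i, 1 / (((isHermitian_of_isSymm hA).eigenvalues i : ℂ) - z)) / (N + 1 : ℝ) := by
  rw [stieltjes, trace_resolvent_eq hA hz]

lemma norm_stieltjes_sub_le {A : Matrix (Fin (N + 1)) (Fin (N + 1)) ℝ} (hA : A.IsSymm) {η : ℝ}
    (hη : 0 < η) {z₁ z₂ : ℂ} (h1 : η ≤ z₁.im) (h2 : η ≤ z₂.im) :
    ‖stieltjes A z₁ - stieltjes A z₂‖ ≤ (1 / η) ^ 2 * ‖z₁ - z₂‖ := by
  have hN : (0 : ℝ) < N + 1 := by positivity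
  rw [stieltjes_eq_sum hA (hη.trans_le h1), stieltjes_eq_sum hA (hη.trans_le h2), ← sub_div,
    ← Finset.sum_sub_distrib, norm_div, Complex.norm_real, Real.norm_of_nonneg hN.le,
    div_le_iff₀ hN]
  refine (norm_sum_le_of_le _ (f := fun i =>
    1 / (((isHermitian_of_isSymm hA).eigenvalues i : ℂ) - z₁) -
      1 / (((isHermitian_of_isSymm hA).eigenvalues i : ℂ) - z₂))
    (fun i _ => ?_)).trans_eq (b := ∑ _i : Fin (N + 1), (1 / η) ^ 2 * ‖z₁ - z₂‖) ?_
  · set x := (isHermitian_of_isSymm hA).eigenvalues i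
    have e : 1 / ((x : ℂ) - z₁) - 1 / ((x : ℂ) - z₂) =
        1 / ((x : ℂ) - z₁) * (1 / ((x : ℂ) - z₂)) * (z₁ - z₂) := by
      have e1 := ofReal_sub_ne_zero x (hη.trans_le h1)
      have e2 := ofReal_sub_ne_zero x (hη.trans_le h2)
      field_simp
      ring
    rw [e, norm_mul, norm_mul, pow_two]
    have e1 := norm_one_div_le x hη h1
    have e2 := norm_one_div_le x hη h2
    gcongr
  · simp [mul_comm]

end Spectral

end LaplacianRigidity
end

/-! ### The local law on vertical lines. -/

noncomputable section
namespace LaplacianRigidity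

section LocalLaw

variable {N : ℕ}

/-- `c` is a lower bound for the imaginary part of the subordination function and for the
derivative of its inverse over the strip `|Re z| ≤ K`. -/
def IsStabilityBound (K c : ℝ) : Prop :=
  ∀ z : ℂ, |z.re| ≤ K → 0 ≤ z.im → c ≤ (subord z).im ∧ c ≤ ‖1 - gaussStieltjesDeriv (subord z)‖

/-- The point `E + iy`. -/
def vert (E y : ℝ) : ℂ := E + y * Complex.I

@[simp] lemma vert_re (E y : ℝ) : (vert E y).re = E := by simp [vert]

@[simp] lemma vert_im (E y : ℝ) : (vert E y).im = y := by simp [vert]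

lemma norm_vert_sub (E y y' : ℝ) : ‖vert E y - vert E y'‖ = |y - y'| := by
  have : vert E y - vert E y' = ((y - y' : ℝ) : ℂ) * Complex.I := by
    simp only [vert]; push_cast; ring
  rw [this, norm_mul, Complex.norm_I, mul_one, Complex.norm_real, Real.norm_eq_abs]

/-- At height at least η the matrix transform is Lipschitz with constant η⁻² and the subordination
function with constant 1/c; the last 1 comes from subtracting z. -/
lemma norm_stieltjes_error_sub_le {A : Matrix (Fin (N + 1)) (Fin (N + 1)) ℝ} (hA : A.IsSymm)
    {K c E η y y' : ℝ} (hc : 0 < c) (hK : IsStabilityBound K c) (hE : |E| ≤ K) (hη : 0 < η)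
    (hy : η ≤ y) (hy' : η ≤ y') :
    ‖stieltjes A (vert E y) - freeStieltjes (vert E y)‖ ≤
      ‖stieltjes A (vert E y') - freeStieltjes (vert E y')‖ +
        ((1 / η) ^ 2 + 1 / c + 1) * |y - y'| := by
  have h1 := norm_stieltjes_sub_le hA hη (z₁ := vert E y) (z₂ := vert E y') (by simpa) (by simpa)
  have h2 := norm_subord_sub_le hc (fun z a b => (hK z a b).2) (z₁ := vert E y')
    (z₂ := vert E y) (by simpa) (by simpa using hη.le.trans hy') (by simpa)
    (by simpa using hη.le.trans hy)
  rw [norm_vert_sub] at h1 h2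
  have e : stieltjes A (vert E y) - freeStieltjes (vert E y) =
      (stieltjes A (vert E y') - freeStieltjes (vert E y')) +
        (stieltjes A (vert E y) - stieltjes A (vert E y')) -
        (subord (vert E y) - subord (vert E y')) + (vert E y - vert E y') := by
    simp only [freeStieltjes]; ring
  rw [e]
  refine (norm_add_le _ _).trans ?_
  rw [norm_vert_sub]
  have h3 := norm_sub_le ((stieltjes A (vert E y') - freeStieltjes (vert E y')) +
        (stieltjes A (vert E y) - stieltjes A (vert E y'))) (subord (vert E y) - subord (vert E y'))
  have h4 := norm_add_le (stieltjes A (vert E y') - freeStieltjes (vert E y'))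
        (stieltjes A (vert E y) - stieltjes A (vert E y'))
  linarith

/-- Local law on a vertical grid. -/
lemma local_law_grid {A : Matrix (Fin (N + 1)) (Fin (N + 1)) ℝ} (hA : A.IsSymm) (hN : 0 < N)
    {K c C E lam q η δ : ℝ} {n : ℕ} (hc : 0 < c) (hc1 : c ≤ 1) (hC : 0 ≤ C)
    (hK : IsStabilityBound K c) (hE : |E| ≤ K) (hlam : 1 ≤ lam) (hq : 1 ≤ q) (hqN : q ^ 2 ≤ N)
    (hηq : 1 / q ≤ η) (hε : 12 * lam ^ 2 / (q * η) ≤ 1 / 100) (hCq : C / c * (lam / q) ≤ c / 4)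
    (hsmall : stabConst c C * (12 * lam ^ 2 / (q * η)) ≤ c ^ 4 / 16) (hδ : 0 < δ)
    (hLδ : ((1 / η) ^ 2 + 1 / c + 1) * δ ≤ c ^ 4 / 16) (htop : 2 / (η + n * δ) ≤ c ^ 4 / 8)
    (hreg : ∀ k ≤ n, RegularAt A C lam q (vert E (η + k * δ))) (k : ℕ) (hk : k ≤ n) :
    ‖stieltjes A (vert E (η + k * δ)) - freeStieltjes (vert E (η + k * δ))‖ ≤
      stabConst c C * (12 * lam ^ 2 / (q * (η + k * δ))) := by
  have hq0 : 0 < q := by linarith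
  have hη : 0 < η := lt_of_lt_of_le (by positivity) hηq
  have hsc : 0 ≤ stabConst c C := by unfold stabConst; positivity
  have hyη : ∀ k : ℕ, η ≤ η + k * δ := fun k => by
    have : 0 ≤ k * δ := by positivity
    linarith
  have hεk : ∀ k : ℕ, 12 * lam ^ 2 / (q * (η + k * δ)) ≤ 12 * lam ^ 2 / (q * η) := fun k => by
    have := hyη k
    gcongr
  have step : ∀ k ≤ n, ‖stieltjes A (vert E (η + k * δ)) - freeStieltjes (vert E (η + k * δ))‖ ≤
      c ^ 4 / 8 → ‖stieltjes A (vert E (η + k * δ)) - freeStieltjes (vert E (η + k * δ))‖ ≤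
      stabConst c C * (12 * lam ^ 2 / (q * (η + k * δ))) := by
    intro k hk h
    have h0 := hyη k
    have hs := hK (vert E (η + k * δ)) (by simpa) (by simpa using hη.le.trans h0)
    have := norm_stieltjes_sub_freeStieltjes_le hA hN (z := vert E (η + k * δ)) hc hc1 hC hlam hq hqN
      (by simpa using hηq.trans h0) (by simpa using (hεk k).trans hε) hCq (hreg k hk) hs.1 hs.2 h
    simpa using this
  -- Descent from the top. The improved bound at the point above is at most c⁴/16 and one grid step
  -- adds at most c⁴/16, so the rough bound c⁴/8 holds at the next point and improves again.
  induction hk using Nat.decreasingInduction with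
  | self =>
    refine step n le_rfl (le_trans ?_ htop)
    have := norm_stieltjes_sub_freeStieltjes_le_of_im hA (z := vert E (η + n * δ))
      (by simpa using hη.trans_le (hyη n))
    simpa using this
  | of_succ k hk ih =>
    refine step k hk.le ?_
    have h1 := norm_stieltjes_error_sub_le hA hc hK hE hη (hyη k) (hyη (k + 1))
    have e : |η + k * δ - (η + (k + 1 : ℕ) * δ)| = δ := by
      rw [show η + k * δ - (η + (k + 1 : ℕ) * δ) = -δ by push_cast; ring, abs_neg, abs_of_pos hδ]
    rw [e] at h1
    have h2 : stabConst c C * (12 * lam ^ 2 / (q * (η + (k + 1 : ℕ) * δ))) ≤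
        stabConst c C * (12 * lam ^ 2 / (q * η)) := by
      have := hεk (k + 1)
      gcongr
    linarith

/-- Local law on a vertical segment. -/
theorem local_law_of_regular {A : Matrix (Fin (N + 1)) (Fin (N + 1)) ℝ} (hA : A.IsSymm)
    (hN : 0 < N)
    {K c C E lam q η δ : ℝ} {n : ℕ} (hc : 0 < c) (hc1 : c ≤ 1) (hC : 0 ≤ C)
    (hK : IsStabilityBound K c) (hE : |E| ≤ K) (hlam : 1 ≤ lam) (hq : 1 ≤ q) (hqN : q ^ 2 ≤ N)
    (hηq : 1 / q ≤ η) (hε : 12 * lam ^ 2 / (q * η) ≤ 1 / 100) (hCq : C / c * (lam / q) ≤ c / 4)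
    (hsmall : stabConst c C * (12 * lam ^ 2 / (q * η)) ≤ c ^ 4 / 16) (hδ : 0 < δ)
    (hLδ : ((1 / η) ^ 2 + 1 / c + 1) * δ ≤ c ^ 4 / 16) (htop : 2 / (η + n * δ) ≤ c ^ 4 / 8)
    (hreg : ∀ k ≤ n, RegularAt A C lam q (vert E (η + k * δ))) {y : ℝ} (hy : η ≤ y)
    (hyn : y ≤ η + n * δ) :
    ‖stieltjes A (vert E y) - freeStieltjes (vert E y)‖ ≤
      stabConst c C * (12 * lam ^ 2 / (q * y)) + ((1 / η) ^ 2 + 1 / c + 1) * δ := by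
  have hη : 0 < η := lt_of_lt_of_le (by positivity) hηq
  have hsc : 0 ≤ stabConst c C := by unfold stabConst; positivity
  -- The grid point is taken at or above y, where the bound is no larger than the one claimed at y.
  set k := ⌈(y - η) / δ⌉₊ with hk
  have hkn : k ≤ n := by
    refine Nat.ceil_le.2 ?_
    rw [div_le_iff₀ hδ]; linarith
  have h1 : y ≤ η + k * δ := by
    have := Nat.le_ceil ((y - η) / δ)
    rw [div_le_iff₀ hδ] at this
    linarith
  have h2 : η + k * δ ≤ y + δ := by
    have := (Nat.ceil_lt_add_one (a := (y - η) / δ) (div_nonneg (by linarith) hδ.le)).le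
    have h3 := mul_le_mul_of_nonneg_right this hδ.le
    rw [add_mul, div_mul_cancel₀ _ hδ.ne'] at h3
    linarith
  have hgrid := local_law_grid hA hN hc hc1 hC hK hE hlam hq hqN hηq hε hCq hsmall hδ hLδ htop
    hreg k hkn
  have hlip := norm_stieltjes_error_sub_le hA hc hK hE hη hy (hy.trans h1)
  have h4 : |y - (η + k * δ)| ≤ δ := abs_le.2 ⟨by linarith, by linarith⟩
  have hL0 : 0 ≤ (1 / η) ^ 2 + 1 / c + 1 := by positivity
  refine hlip.trans (add_le_add (hgrid.trans ?_) (mul_le_mul_of_nonneg_left h4 hL0))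
  have hq0 : 0 < q := by linarith
  have hy0 : 0 < y := by linarith
  gcongr

end LocalLaw

end LaplacianRigidity
end

/-! ### From the local law to the eigenvalue counting function. -/

noncomputable section
namespace LaplacianRigidity

section Counting

open Set

/-- Both B log y - f and B log y + f are monotone; no integrability of the derivative is needed. -/
lemma abs_sub_le_mul_log {f f' : ℝ → ℝ} {a b B : ℝ} (ha : 0 < a) (hab : a ≤ b)
    (hf : ∀ y ∈ Icc a b, HasDerivAt f (f' y) y) (hB : ∀ y ∈ Icc a b, |f' y| ≤ B / y) :
    |f b - f a| ≤ B * Real.log (b / a) := by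
  have hlog : ∀ y ∈ Icc a b, HasDerivAt (fun y => B * Real.log y) (B / y) y := fun y hy => by
    have := (Real.hasDerivAt_log (ha.trans_le hy.1).ne').const_mul B
    simpa [div_eq_mul_inv] using this
  have h1 : MonotoneOn (fun y => B * Real.log y - f y) (Icc a b) :=
    monotoneOn_of_hasDerivWithinAt_nonneg (convex_Icc a b)
      (fun y hy => ((hlog y hy).sub (hf y hy)).continuousAt.continuousWithinAt)
      (fun y hy => ((hlog y (interior_subset hy)).sub (hf y (interior_subset hy))).hasDerivWithinAt)
      (fun y hy => by
        have := (abs_le.1 (hB y (interior_subset hy))).2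
        linarith)
  have h2 : MonotoneOn (fun y => B * Real.log y + f y) (Icc a b) :=
    monotoneOn_of_hasDerivWithinAt_nonneg (convex_Icc a b)
      (fun y hy => ((hlog y hy).add (hf y hy)).continuousAt.continuousWithinAt)
      (fun y hy => ((hlog y (interior_subset hy)).add (hf y (interior_subset hy))).hasDerivWithinAt)
      (fun y hy => by
        have := (abs_le.1 (hB y (interior_subset hy))).1
        linarith)
  have m1 := h1 (left_mem_Icc.2 hab) (right_mem_Icc.2 hab) hab
  have m2 := h2 (left_mem_Icc.2 hab) (right_mem_Icc.2 hab) hab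
  simp only at m1 m2
  rw [Real.log_div (ha.trans_le hab).ne' ha.ne', abs_le]
  constructor <;> nlinarith

lemma hasDerivAt_arctan_div (x E : ℝ) {y : ℝ} (hy : 0 < y) :
    HasDerivAt (fun y => Real.arctan ((x - E) / y)) (-(1 / ((x : ℂ) - vert E y)).re) y := by
  have h := ((hasDerivAt_inv hy.ne').const_mul (x - E)).arctan
  simp only [← div_eq_mul_inv] at h
  convert! h using 1
  have e : (x : ℂ) - vert E y = ⟨x - E, -y⟩ := by
    apply Complex.ext <;> simp
  rw [e, one_div, Complex.inv_re, Complex.normSq_mk]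
  have h1 : 0 < (x - E) * (x - E) + -y * -y := by nlinarith [sq_nonneg (x - E), sq_pos_of_pos hy]
  have h2 : 0 < 1 + ((x - E) / y) ^ 2 := by positivity
  field_simp
  ring

lemma hasDerivAt_freePot_im (E : ℝ) {y : ℝ} (hy : 0 < y) :
    HasDerivAt (fun y => (freePot (vert E y)).im) (-(freeStieltjes (vert E y)).re) y := by
  have h1 : HasDerivAt freePot (-freeStieltjes (vert E y)) (vert E y) :=
    (hasDerivWithinAt_freePot (by simpa using hy.le)).hasDerivAt
      (Filter.mem_of_superset (isOpen_upper.mem_nhds (by simpa using hy : vert E y ∈ {u : ℂ | 0 < u.im}))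
        fun u (hu : 0 < u.im) => show 0 ≤ u.im from hu.le)
  have h2 : HasDerivAt (vert E) Complex.I y := by
    have := ((hasDerivAt_id y).ofReal_comp.mul_const Complex.I).const_add (E : ℂ)
    rw [Complex.ofReal_one, one_mul] at this
    exact this
  have h3 := h1.scomp y h2
  have h4 := (Complex.imCLM.hasFDerivAt.comp_hasDerivAt y h3)
  convert! h4 using 1
  simp

/-- The kernel `min(1, η / |u|)`. -/
def tailKernel (η u : ℝ) : ℝ := η / max η |u|

lemma tailKernel_le_one {η : ℝ} (hη : 0 < η) (u : ℝ) : tailKernel η u ≤ 1 :=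
  div_le_one_of_le₀ (le_max_left _ _) (hη.le.trans (le_max_left _ _))

/-- For |u| ≥ 2η the kernel at η is exactly half the one at 2η. For |u| ≤ 2η the Poisson kernel is
at least 1/5, and 3/5 + 1/2 ≥ 1. -/
lemma tailKernel_le {η : ℝ} (hη : 0 < η) (u : ℝ) :
    tailKernel η u ≤ 3 * (η ^ 2 / (u ^ 2 + η ^ 2)) + 1 / 2 * tailKernel (2 * η) u := by
  have hp : 0 ≤ 3 * (η ^ 2 / (u ^ 2 + η ^ 2)) := by positivity
  rcases le_total (2 * η) |u| with h | h
  · rw [tailKernel, tailKernel, max_eq_right h, max_eq_right (by linarith)]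
    have : 1 / 2 * (2 * η / |u|) = η / |u| := by ring
    linarith
  · have h1 := tailKernel_le_one hη u
    have h2 : tailKernel (2 * η) u = 1 := by
      rw [tailKernel, max_eq_left h, div_self (by positivity)]
    have h3 : u ^ 2 ≤ (2 * η) ^ 2 := by
      rw [← sq_abs]; exact pow_le_pow_left₀ (abs_nonneg u) h 2
    have h4 : 1 / 5 ≤ η ^ 2 / (u ^ 2 + η ^ 2) := by
      rw [div_le_div_iff₀ (by norm_num) (by positivity)]
      nlinarith
    linarith

lemma pi_div_two_sub_arctan_le {t : ℝ} (ht : 0 ≤ t) :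
    |(Real.pi / 2 - Real.arctan t) / Real.pi| ≤ 1 / max 1 t := by
  have hpi := Real.pi_gt_three
  have h0 : 0 ≤ Real.arctan t := Real.arctan_nonneg.2 ht
  have h1 := Real.arctan_lt_pi_div_two t
  rw [abs_of_nonneg (div_nonneg (by linarith) (by linarith)), div_le_iff₀ (by linarith)]
  rcases le_total t 1 with h | h
  · rw [max_eq_left h]; linarith
  · rw [max_eq_right h, ← Real.arctan_inv_of_pos (by linarith), one_div]
    have h2 := (le_abs_self _).trans (abs_arctan_le t⁻¹)
    have h3 : 0 < t⁻¹ := by positivity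
    rw [abs_of_pos h3] at h2
    nlinarith

/-- On either side of 0 the error is (π/2 - arctan(|u|/η))/π, which `pi_div_two_sub_arctan_le`
bounds by the kernel. -/
lemma abs_indicator_sub_arctan_le {η : ℝ} (hη : 0 < η) (u : ℝ) :
    |(if u ≤ 0 then (1 : ℝ) else 0) - (1 / 2 - Real.arctan (u / η) / Real.pi)| ≤
      tailKernel η u := by
  have hpi := Real.pi_pos
  have e : tailKernel η u = 1 / max 1 (|u| / η) := by
    rw [tailKernel, one_div, ← div_self hη.ne', max_div_div_right hη.le, inv_div]
  rw [e]
  split_ifs with h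
  · have := pi_div_two_sub_arctan_le (t := |u| / η) (by positivity)
    rw [abs_of_nonpos h, neg_div, Real.arctan_neg] at this
    rw [abs_of_nonpos h, neg_div]
    refine le_trans (le_of_eq ?_) this
    congr 1
    field_simp
    ring
  · have h' : 0 < u := not_le.1 h
    have := pi_div_two_sub_arctan_le (t := |u| / η) (by positivity)
    rw [abs_of_pos h'] at this ⊢
    refine le_trans (le_of_eq ?_) this
    rw [zero_sub, abs_neg]
    congr 1
    field_simp

variable {N : ℕ}

/-- The average of a function over the eigenvalues of a symmetric matrix. -/
def eigAvg {A : Matrix (Fin (N + 1)) (Fin (N + 1)) ℝ} (hA : A.IsSymm) (f : ℝ → ℝ) : ℝ :=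
  (∑ i, f ((isHermitian_of_isSymm hA).eigenvalues i)) / (N + 1)

section

variable {A : Matrix (Fin (N + 1)) (Fin (N + 1)) ℝ} (hA : A.IsSymm)

lemma eigAvg_mono {f g : ℝ → ℝ}
    (h : ∀ i, f ((isHermitian_of_isSymm hA).eigenvalues i) ≤
      g ((isHermitian_of_isSymm hA).eigenvalues i)) : eigAvg hA f ≤ eigAvg hA g := by
  unfold eigAvg
  gcongr with i
  exact h i

lemma eigAvg_add (f g : ℝ → ℝ) : eigAvg hA (fun x => f x + g x) = eigAvg hA f + eigAvg hA g := by
  simp only [eigAvg, Finset.sum_add_distrib, add_div]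

lemma eigAvg_sub (f g : ℝ → ℝ) : eigAvg hA (fun x => f x - g x) = eigAvg hA f - eigAvg hA g := by
  simp only [eigAvg, Finset.sum_sub_distrib, sub_div]

lemma eigAvg_const_mul (a : ℝ) (f : ℝ → ℝ) : eigAvg hA (fun x => a * f x) = a * eigAvg hA f := by
  simp only [eigAvg, ← Finset.mul_sum, mul_div_assoc]

lemma eigAvg_const (a : ℝ) : eigAvg hA (fun _ => a) = a := by
  have : (N : ℝ) + 1 ≠ 0 := by positivity
  simp only [eigAvg, Finset.sum_const, Finset.card_univ, Fintype.card_fin, nsmul_eq_mul]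
  push_cast
  field_simp

lemma abs_eigAvg_le {f g : ℝ → ℝ}
    (h : ∀ i, |f ((isHermitian_of_isSymm hA).eigenvalues i)| ≤
      g ((isHermitian_of_isSymm hA).eigenvalues i)) : |eigAvg hA f| ≤ eigAvg hA g := by
  have hN : (0 : ℝ) < N + 1 := by positivity
  unfold eigAvg
  rw [abs_div, abs_of_pos hN]
  gcongr
  exact (Finset.abs_sum_le_sum_abs _ _).trans (Finset.sum_le_sum fun i _ => h i)

lemma eigAvg_re (E : ℝ) {y : ℝ} (hy : 0 < y) :
    eigAvg hA (fun x => (1 / ((x : ℂ) - vert E y)).re) = (stieltjes A (vert E y)).re := by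
  rw [stieltjes_eq_sum hA (by simpa), Complex.div_ofReal_re, Complex.re_sum, eigAvg]

lemma eigAvg_im (E : ℝ) {y : ℝ} (hy : 0 < y) :
    eigAvg hA (fun x => (1 / ((x : ℂ) - vert E y)).im) = (stieltjes A (vert E y)).im := by
  rw [stieltjes_eq_sum hA (by simpa), Complex.div_ofReal_im, Complex.im_sum, eigAvg]

lemma one_div_vert_im (x E y : ℝ) :
    y * (1 / ((x : ℂ) - vert E y)).im = y ^ 2 / ((x - E) ^ 2 + y ^ 2) := by
  have e : (x : ℂ) - vert E y = ⟨x - E, -y⟩ := by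
    apply Complex.ext <;> simp
  rw [e, one_div, Complex.inv_im, Complex.normSq_mk]
  ring

/-- Iterating over dyadic heights, scale k contributes 2⁻ᵏ · 3 · 2ᵏη · Im m ≤ 3ηM. After m steps the
remaining kernel has weight 2⁻ᵐ. -/
lemma eigAvg_tailKernel_le (E : ℝ) {η M : ℝ} (hη : 0 < η) (m : ℕ)
    (hM : ∀ k < m, (stieltjes A (vert E (2 ^ k * η))).im ≤ M) :
    eigAvg hA (fun x => tailKernel η (x - E)) ≤ 3 * η * M * m + (1 / 2) ^ m := by
  induction m generalizing η with
  | zero =>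
    simp only [Nat.cast_zero, mul_zero, pow_zero, zero_add]
    exact (eigAvg_mono hA fun i => tailKernel_le_one hη _).trans_eq (eigAvg_const hA 1)
  | succ m ih =>
    have h1 := eigAvg_mono hA (f := fun x => tailKernel η (x - E))
      (g := fun x => 3 * η * (1 / ((x : ℂ) - vert E η)).im + 1 / 2 * tailKernel (2 * η) (x - E))
      (fun i => by
        have := tailKernel_le hη ((isHermitian_of_isSymm hA).eigenvalues i - E)
        rw [← one_div_vert_im] at this
        linarith)
    rw [eigAvg_add, eigAvg_const_mul, eigAvg_const_mul, eigAvg_im hA E hη] at h1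
    have h2 := ih (η := 2 * η) (by positivity) (fun k hk => by
      have := hM (k + 1) (by omega)
      rwa [pow_succ, mul_assoc] at this)
    have h3 := hM 0 (by omega)
    rw [pow_zero, one_mul] at h3
    have h4 : 3 * η * (stieltjes A (vert E η)).im ≤ 3 * η * M := by gcongr
    rw [pow_succ]
    push_cast
    linarith

/-- The fraction of eigenvalues not exceeding `E`. -/
def eigCdf (E : ℝ) : ℝ := eigAvg hA fun x => if x - E ≤ 0 then 1 else 0

/-- The smoothed counting function is close to the distribution function of the free convolution. -/
lemma abs_eigAvg_arctan_sub_le {E η Y B R : ℝ} (hη : 0 < η) (hηY : η ≤ Y) (hY : 1 ≤ Y)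
    (hB : ∀ y ∈ Icc η Y, ‖stieltjes A (vert E y) - freeStieltjes (vert E y)‖ ≤ B / y)
    (hR : ∀ i, |(isHermitian_of_isSymm hA).eigenvalues i| ≤ R) :
    |eigAvg hA (fun x => 1 / 2 - Real.arctan ((x - E) / η) / Real.pi) - freeCdf E| ≤
      absHalfMoment 0 * η + B * Real.log (Y / η) + (R + |E|) / Y +
        (gaussAbsMean + (|E| + absHalfMoment 0) + 1) / Y := by
  have hpi := Real.pi_gt_three
  have hY0 : 0 < Y := by linarith
  -- The derivative of D is -Re(m - m_fc), so a local law of size B/y integrates to a logarithm. At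
  -- the top Y, D is close to π/2.
  set D : ℝ → ℝ := fun y => eigAvg hA (fun x => Real.arctan ((x - E) / y)) -
    (freePot (vert E y)).im with hD
  have hderiv : ∀ y ∈ Icc η Y, HasDerivAt D
      (-(stieltjes A (vert E y) - freeStieltjes (vert E y)).re) y := by
    intro y hy
    have hy0 : 0 < y := hη.trans_le hy.1
    have h1 : HasDerivAt (fun y => eigAvg hA (fun x => Real.arctan ((x - E) / y)))
        (-(stieltjes A (vert E y)).re) y := by
      have := (HasDerivAt.fun_sum (u := Finset.univ) fun (i : Fin (N + 1)) _ => hasDerivAt_arctan_div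
        ((isHermitian_of_isSymm hA).eigenvalues i) E hy0).div_const ((N : ℝ) + 1)
      convert! this using 1
      rw [← eigAvg_re hA E hy0, eigAvg, Finset.sum_neg_distrib, neg_div]
    have := h1.sub (hasDerivAt_freePot_im E hy0)
    convert! this using 1
    rw [Complex.sub_re]; ring
  have hlog := abs_sub_le_mul_log hη hηY hderiv (fun y hy => by
    rw [abs_neg]
    exact (Complex.abs_re_le_norm _).trans (hB y hy))
  have hN : |eigAvg hA (fun x => Real.arctan ((x - E) / Y))| ≤ (R + |E|) / Y := by
    refine (abs_eigAvg_le hA (g := fun _ => (R + |E|) / Y) fun i => ?_).trans_eq (eigAvg_const hA _)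
    refine (abs_arctan_le _).trans ?_
    rw [abs_div, abs_of_pos hY0]
    gcongr
    exact (abs_sub _ _).trans (by linarith [hR i])
  have hF : |(freePot (vert E Y)).im + Real.pi / 2| ≤ _ := abs_freePot_im_add_le hY
  have h0 : |(freePot (vert E η)).im - (freePot E).im| ≤ absHalfMoment 0 * η := by
    have := norm_freePot_sub_le (z₁ := (E : ℂ)) (z₂ := vert E η) (by simp) (by simpa using hη.le)
    have e : vert E η - E = η * Complex.I := by simp [vert]
    rw [e, norm_mul, Complex.norm_I, mul_one, Complex.norm_real, Real.norm_of_nonneg hη.le] at this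
    rw [← Complex.sub_im]
    exact (Complex.abs_im_le_norm _).trans this
  have e1 : eigAvg hA (fun x => 1 / 2 - Real.arctan ((x - E) / η) / Real.pi) - freeCdf E =
      -(D η - D Y + (eigAvg hA (fun x => Real.arctan ((x - E) / Y)) -
        ((freePot (vert E Y)).im + Real.pi / 2)) +
        ((freePot (vert E η)).im - (freePot E).im)) / Real.pi := by
    have e2 : eigAvg hA (fun x => 1 / 2 - Real.arctan ((x - E) / η) / Real.pi) =
        1 / 2 - 1 / Real.pi * eigAvg hA (fun x => Real.arctan ((x - E) / η)) := by
      rw [← eigAvg_const_mul, ← eigAvg_const hA (1 / 2), ← eigAvg_sub, eigAvg_const]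
      congr 1; ext x; ring
    rw [e2, freeCdf, hD]
    field_simp
    ring
  rw [e1, abs_div, abs_neg, abs_of_pos Real.pi_pos]
  have hnum : |D η - D Y + (eigAvg hA (fun x => Real.arctan ((x - E) / Y)) -
        ((freePot (vert E Y)).im + Real.pi / 2)) +
        ((freePot (vert E η)).im - (freePot E).im)| ≤
      absHalfMoment 0 * η + B * Real.log (Y / η) + (R + |E|) / Y +
        (gaussAbsMean + (|E| + absHalfMoment 0) + 1) / Y := by
    rw [abs_sub_comm] at hlog
    have a1 := abs_add_le (D η - D Y + (eigAvg hA (fun x => Real.arctan ((x - E) / Y)) -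
        ((freePot (vert E Y)).im + Real.pi / 2))) ((freePot (vert E η)).im - (freePot E).im)
    have a2 := abs_add_le (D η - D Y) (eigAvg hA (fun x => Real.arctan ((x - E) / Y)) -
        ((freePot (vert E Y)).im + Real.pi / 2))
    have a3 := abs_sub (eigAvg hA (fun x => Real.arctan ((x - E) / Y)))
      ((freePot (vert E Y)).im + Real.pi / 2)
    linarith
  exact (div_le_self (abs_nonneg _) (by linarith)).trans hnum

/-- The eigenvalue counting function is close to the distribution function of the free
convolution. -/
theorem abs_eigCdf_sub_freeCdf_le {E η Y B R M : ℝ} (hη : 0 < η) (hηY : η ≤ Y) (hY : 1 ≤ Y)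
    (hB : ∀ y ∈ Icc η Y, ‖stieltjes A (vert E y) - freeStieltjes (vert E y)‖ ≤ B / y)
    (hR : ∀ i, |(isHermitian_of_isSymm hA).eigenvalues i| ≤ R) (m : ℕ)
    (hM : ∀ k < m, (stieltjes A (vert E (2 ^ k * η))).im ≤ M) :
    |eigCdf hA E - freeCdf E| ≤
      3 * η * M * m + (1 / 2) ^ m + (absHalfMoment 0 * η + B * Real.log (Y / η) + (R + |E|) / Y +
        (gaussAbsMean + (|E| + absHalfMoment 0) + 1) / Y) := by
  have h1 := abs_eigAvg_arctan_sub_le hA hη hηY hY hB hR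
  have h2 : |eigCdf hA E - eigAvg hA (fun x => 1 / 2 - Real.arctan ((x - E) / η) / Real.pi)| ≤
      3 * η * M * m + (1 / 2) ^ m := by
    rw [eigCdf, ← eigAvg_sub]
    exact (abs_eigAvg_le hA (g := fun x => tailKernel η (x - E)) fun i =>
      abs_indicator_sub_arctan_le hη _).trans (eigAvg_tailKernel_le hA E hη m hM)
  exact (abs_sub_le _ _ _).trans (add_le_add h2 h1)

end

end Counting

end LaplacianRigidity
end

/-! ### Sorted eigenvalues with one zero removed. -/

noncomputable section
namespace LaplacianRigidity

section Sorting

lemma sortedLE_getElem_le {L : List ℝ} (hL : L.Pairwise (· ≤ ·)) {j : ℕ} (hj : j < L.length) {x : ℝ}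
    (h : j + 1 ≤ L.countP (· ≤ x)) : L[j] ≤ x := by
  by_contra hcon
  rw [not_le] at hcon
  have h1 : (L.drop j).countP (· ≤ x) = 0 := by
    rw [List.countP_eq_zero]
    intro a ha
    obtain ⟨k, hk, rfl⟩ := List.mem_iff_getElem.1 ha
    rw [List.getElem_drop]
    have : L[j] ≤ L[j + k]'(by rw [List.length_drop] at hk; omega) := by
      rcases Nat.eq_zero_or_pos k with rfl | hk0
      · simp
      · exact List.pairwise_iff_getElem.1 hL _ _ _ _ (by omega)
    simpa using hcon.trans_le this
  have h2 : (L.take j).countP (· ≤ x) ≤ j :=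
    List.countP_le_length.trans (List.length_take_le _ _)
  rw [← List.take_append_drop j L, List.countP_append, h1] at h
  omega

lemma lt_sortedLE_getElem {L : List ℝ} (hL : L.Pairwise (· ≤ ·)) {j : ℕ} (hj : j < L.length) {x : ℝ}
    (h : L.countP (· ≤ x) ≤ j) : x < L[j] := by
  by_contra hcon
  rw [not_lt] at hcon
  have h1 : (L.take (j + 1)).countP (· ≤ x) = (L.take (j + 1)).length := by
    rw [List.countP_eq_length]
    intro a ha
    obtain ⟨k, hk, rfl⟩ := List.mem_iff_getElem.1 ha
    rw [List.length_take] at hk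
    rw [List.getElem_take]
    have : L[k]'(by omega) ≤ L[j] := by
      rcases (show k ≤ j by omega).eq_or_lt with rfl | hk0
      · exact le_rfl
      · exact List.pairwise_iff_getElem.1 hL _ _ _ _ hk0
    simpa using this.trans hcon
  rw [← List.take_append_drop (j + 1) L, List.countP_append, h1, List.length_take] at h
  omega

open Matrix

variable {N : ℕ} {A : Matrix (Fin (N + 1)) (Fin (N + 1)) ℝ}

lemma zero_mem_roots_charpoly (h0 : ∀ i, ∑ j, A i j = 0) : (0 : ℝ) ∈ A.charpoly.roots := by
  rw [Polynomial.mem_roots (Matrix.charpoly_monic A).ne_zero, Polynomial.IsRoot,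
    Matrix.eval_charpoly]
  have : (Matrix.scalar (Fin (N + 1)) (0 : ℝ) - A) *ᵥ (fun _ => 1) = 0 := by
    ext i
    simp [Matrix.mulVec, dotProduct, h0]
  exact Matrix.exists_mulVec_eq_zero_iff.1 ⟨fun _ => 1, fun h => by
    have := congrFun h 0
    simp at this, this⟩

lemma countP_roots_charpoly (hA : A.IsSymm) (x : ℝ) :
    ((A.charpoly.roots.countP (· ≤ x) : ℕ) : ℝ) = (N + 1) * eigCdf hA x := by
  have hN : (N : ℝ) + 1 ≠ 0 := by positivity
  rw [eigCdf, eigAvg, mul_div_cancel₀ _ hN,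
    (isHermitian_of_isSymm hA).roots_charpoly_eq_eigenvalues, Multiset.countP_map]
  simp only [sub_nonpos]
  rw [Finset.sum_boole]
  rfl

lemma card_roots_charpoly (hA : A.IsSymm) : A.charpoly.roots.card = N + 1 := by
  rw [(isHermitian_of_isSymm hA).roots_charpoly_eq_eigenvalues]; simp

/-- Erasing one zero lowers the count of eigenvalues not exceeding x by 0 or 1, according to the
sign of x; hence i + 1 in the first implication and i in the second, valid for either sign. -/
lemma nontrivialEigenvalue_bounds (hA : A.IsSymm) (h0 : ∀ i, ∑ j, A i j = 0) {i : ℕ} (hi : 1 ≤ i)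
    (hiN : i ≤ N) (x : ℝ) :
    ((i : ℝ) + 1 ≤ (N + 1) * eigCdf hA x → nontrivialEigenvalue A i ≤ x) ∧
      ((N + 1) * eigCdf hA x < i → x < nontrivialEigenvalue A i) := by
  have hmem := zero_mem_roots_charpoly h0
  set s := A.charpoly.roots with hs
  set L := (s.erase 0).sort (· ≤ ·) with hL
  have hsort : L.Pairwise (· ≤ ·) := Multiset.pairwise_sort _ _
  have hlen : L.length = N := by
    rw [hL, Multiset.length_sort, Multiset.card_erase_of_mem hmem, hs, card_roots_charpoly hA]
    rfl
  have hget : nontrivialEigenvalue A i = L[i - 1]'(by omega) := by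
    change L.getD (i - 1) 0 = _
    exact List.getD_eq_getElem _ _ _
  have hcount : L.countP (· ≤ x) = (s.erase 0).countP (· ≤ x) := by
    rw [← Multiset.coe_countP, hL, Multiset.sort_eq]
  have hcons : s.countP (· ≤ x) = (s.erase 0).countP (· ≤ x) + if (0 : ℝ) ≤ x then 1 else 0 := by
    conv_lhs => rw [← Multiset.cons_erase hmem]
    rw [Multiset.countP_cons]
  rw [← countP_roots_charpoly hA, ← hs, hget]
  constructor
  · intro h
    refine sortedLE_getElem_le hsort _ ?_
    have h' : i + 1 ≤ s.countP (· ≤ x) := by exact_mod_cast h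
    rw [hcount]
    split_ifs at hcons <;> omega
  · intro h
    refine lt_sortedLE_getElem hsort _ ?_
    have h' : s.countP (· ≤ x) < i := by exact_mod_cast h
    rw [hcount]
    split_ifs at hcons <;> omega

end Sorting

end LaplacianRigidity
end

/-! ### Union bounds for the regularity event. -/

noncomputable section
namespace LaplacianRigidity

section UnionBound

variable {Ω : Type*} [MeasurableSpace Ω] {μ : Measure Ω} {N : ℕ} {β q : ℝ} {c : ℕ → ℝ}
  {H : Ω → Matrix (Fin (N + 1)) (Fin (N + 1)) ℝ}

/-- Constant in the bound for the failure probability of `RegularAt`. -/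
def regularConst (m : ℕ → ℝ) (p : ℕ) : ℝ :=
  m (2 * p) + 2 * (momentConst m p + momentConst (squareConst m) p) + 2 * empiricalConst m p

lemma regularConst_nonneg {m : ℕ → ℝ} (hm : ∀ r, 0 ≤ m r) (p : ℕ) :
    0 ≤ regularConst m p := by
  have h1 := momentConst_nonneg hm p
  have h2 : 0 ≤ momentConst (squareConst m) p := momentConst_nonneg (fun r => by
    have := hm (2 * r)
    unfold squareConst
    positivity) p
  have h3 := hm (2 * p)
  unfold regularConst empiricalConst
  positivity

/-- Each component of regularity has its own tail bound. A common factor (N + 1)² covers the unions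
over entries and rows and the bounds for the diagonal statistics. -/
theorem IsRandomLaplacianType.measureReal_not_regularAt_le [IsProbabilityMeasure μ]
    (hH : IsRandomLaplacianType μ N β q c H) (hN : 0 < N) (hq : 1 ≤ q) {a : ℝ} (ha : 0 < a) {z : ℂ}
    (hz : 1 / q ≤ z.im) (hw : a ≤ (subord z).im) (p : ℕ) (hp : 1 ≤ p) {lam : ℝ} (hlam : 1 ≤ lam)
    (hlq : lam ≤ q) :
    μ.real {ω | ¬ RegularAt (H ω) (60 * weightConst a) lam q z} ≤
      ((N : ℝ) + 1) ^ 2 * (regularConst (entryConst c) p / lam ^ (2 * p)) := by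
  have hS := fun i => hH.row_sparseFamily hN i
  set m := entryConst c with hm
  have hlam0 : 0 < lam := by linarith
  have hM := momentConst_nonneg (hS 0).const_nonneg p
  have hM2 := momentConst_nonneg (hS 0).squareConst_nonneg p
  have hm2 := (hS 0).const_nonneg (2 * p)
  set E1 : Set Ω := ⋃ x ∈ (Finset.univ : Finset (Fin (N + 1) × Fin N)),
    {ω | lam / q < |H ω x.1 (x.1.succAbove x.2)|} with hE1
  set E2 : Set Ω := ⋃ i ∈ (Finset.univ : Finset (Fin (N + 1))), {ω | 12 * lam ^ 2 / (q * z.im) *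
          ((resolvent (reducedMinor (H ω) i) z).trace.im / N + z.im) <
        ‖cvec (offRow (H ω) i) ⬝ᵥ Matrix.mulVec (resolvent (reducedMinor (H ω) i) z)
            (cvec (offRow (H ω) i)) -
          (resolvent (reducedMinor (H ω) i) z).trace / (N : ℝ)‖} with hE2
  set E3 : Set Ω := {ω | 60 * (weightConst a / (subord z).im) * (lam / q) <
        ‖diagStieltjes (H ω) (subord z) - gaussStieltjes (subord z)‖} with hE3
  set E4 : Set Ω := {ω | 60 * (weightConst a / (subord z).im) * (lam / q) <
        ‖diagStieltjesDeriv (H ω) (subord z) - gaussStieltjesDeriv (subord z)‖} with hE4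
  have hsub : {ω | ¬ RegularAt (H ω) (60 * weightConst a) lam q z} ⊆ (E1 ∪ E2) ∪ (E3 ∪ E4) := by
    intro ω hω
    by_contra hcon
    simp only [hE1, hE2, hE3, hE4, Set.mem_union, Set.mem_iUnion, Set.mem_ofPred_eq, not_or,
      not_exists, not_lt, Finset.mem_univ, exists_prop, true_and] at hcon
    obtain ⟨⟨h1, h2⟩, h3, h4⟩ := hcon
    rw [← mul_div_assoc 60] at h3 h4
    exact hω ⟨fun i k => h1 (i, k), h2, h3, h4⟩
  have p1 : μ.real E1 ≤ ((N : ℝ) + 1) ^ 2 * (m (2 * p) / lam ^ (2 * p)) := by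
    refine (measureReal_biUnion_finset_le _ _).trans
      ((Finset.sum_le_sum fun x _ => (hS x.1).tail_entry x.2 p hp hlam0).trans ?_)
    rw [Finset.sum_const, nsmul_eq_mul, Finset.card_univ, Fintype.card_prod, Fintype.card_fin,
      Fintype.card_fin]
    push_cast
    gcongr
    nlinarith
  have p2 : μ.real E2 ≤ ((N : ℝ) + 1) ^ 2 *
      (2 * (momentConst m p + momentConst (squareConst m) p) / lam ^ (2 * p)) := by
    refine (measureReal_biUnion_finset_le _ _).trans
      ((Finset.sum_le_sum fun i _ => hH.tail_row_form hN i hz p hlam).trans ?_)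
    rw [Finset.sum_const, nsmul_eq_mul, Finset.card_univ, Fintype.card_fin]
    push_cast
    rw [← mul_div_assoc, ← mul_div_assoc, ← mul_div_assoc]
    refine div_le_div_of_nonneg_right ?_ (by positivity)
    have : 0 ≤ (N : ℝ) * momentConst (squareConst m) p := by positivity
    have : 0 ≤ (N : ℝ) * (N * momentConst (squareConst m) p) := by positivity
    nlinarith
  have p3 : μ.real E3 ≤ _ := hH.tail_diagStieltjes hN hq ha hw p hp hlam hlq
  have p4 : μ.real E4 ≤ _ := hH.tail_diagStieltjesDeriv hN hq ha hw p hp hlam hlq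
  have u1 := measureReal_union_le (μ := μ) (E1 ∪ E2) (E3 ∪ E4)
  have u2 := measureReal_union_le (μ := μ) E1 E2
  have u3 := measureReal_union_le (μ := μ) E3 E4
  have e : ((N : ℝ) + 1) ^ 2 * (regularConst m p / lam ^ (2 * p)) =
      ((N : ℝ) + 1) ^ 2 * (m (2 * p) / lam ^ (2 * p)) + ((N : ℝ) + 1) ^ 2 *
      (2 * (momentConst m p + momentConst (squareConst m) p) / lam ^ (2 * p)) +
      2 * (((N : ℝ) + 1) ^ 2 * (empiricalConst m p / lam ^ (2 * p))) := by
    unfold regularConst; ring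
  rw [e]
  have := measureReal_mono (μ := μ) hsub
  linarith

/-- Union bound over a finite family of points. -/
theorem IsRandomLaplacianType.measureReal_not_forall_regularAt_le [IsProbabilityMeasure μ]
    (hH : IsRandomLaplacianType μ N β q c H) (hN : 0 < N) (hq : 1 ≤ q) {a : ℝ} (ha : 0 < a)
    {ι : Type*} (t : Finset ι) (z : ι → ℂ)
    (hz : ∀ k ∈ t, 1 / q ≤ (z k).im) (hw : ∀ k ∈ t, a ≤ (subord (z k)).im) (p : ℕ) (hp : 1 ≤ p)
    {lam : ℝ} (hlam : 1 ≤ lam) (hlq : lam ≤ q) :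
    μ.real {ω | ¬ ∀ k ∈ t, RegularAt (H ω) (60 * weightConst a) lam q (z k)} ≤
      t.card * (((N : ℝ) + 1) ^ 2 * (regularConst (entryConst c) p / lam ^ (2 * p))) := by
  have hsub : {ω | ¬ ∀ k ∈ t, RegularAt (H ω) (60 * weightConst a) lam q (z k)} ⊆
      ⋃ k ∈ t, {ω | ¬ RegularAt (H ω) (60 * weightConst a) lam q (z k)} := by
    intro ω hω
    simp only [Set.mem_ofPred_eq, not_forall] at hω
    obtain ⟨k, hk, h⟩ := hω
    exact Set.mem_biUnion hk h
  refine (measureReal_mono hsub (measure_ne_top _ _)).trans ((measureReal_biUnion_finset_le _ _).trans ?_)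
  refine (Finset.sum_le_sum fun k hk =>
    hH.measureReal_not_regularAt_le hN hq ha (hz k hk) (hw k hk) p hp hlam hlq).trans_eq ?_
  rw [Finset.sum_const, nsmul_eq_mul]

end UnionBound

end LaplacianRigidity
end

/-! ### Deterministic counting estimate on the regularity event. -/

noncomputable section
namespace LaplacianRigidity

section Assembly

variable {N : ℕ}

/-- Input for Gershgorin: the diagonal entry is minus the sum of the others, which doubles the row
sum. -/
lemma sum_abs_row_le {A : Matrix (Fin (N + 1)) (Fin (N + 1)) ℝ} (h0 : ∀ i, ∑ j, A i j = 0) {τ : ℝ}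
    (hτ : ∀ i k, |offRow A i k| ≤ τ) (i : Fin (N + 1)) : ∑ j, |A i j| ≤ 2 * (N * τ) := by
  have h1 : ∑ k, |offRow A i k| ≤ N * τ := by
    refine (Finset.sum_le_sum fun k _ => hτ i k).trans_eq ?_
    simp
  have h2 : A i i = -∑ k, offRow A i k := by
    have := h0 i
    rw [Fin.sum_univ_succAbove _ i] at this
    simp only [offRow]
    linarith
  have h3 : |A i i| ≤ N * τ := by
    rw [h2, abs_neg]
    exact (Finset.abs_sum_le_sum_abs _ _).trans h1
  rw [Fin.sum_univ_succAbove _ i]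
  simp only [offRow] at h1
  linarith

lemma clog_le (hN : 0 < N) : ((Nat.clog 2 N : ℕ) : ℝ) ≤ 1 + 2 * Real.log N := by
  have hN' : (1 : ℝ) ≤ N := by exact_mod_cast hN
  have hlog : 0 ≤ Real.log N := Real.log_nonneg hN'
  rcases Nat.eq_zero_or_pos (Nat.clog 2 N) with h | h
  · rw [h]; push_cast; linarith
  · have h1 : 2 ^ (Nat.clog 2 N - 1) < N := (Nat.lt_clog_iff_pow_lt one_lt_two).1 (by omega)
    have h2 : ((2 : ℝ) ^ (Nat.clog 2 N - 1)) ≤ N := by exact_mod_cast h1.le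
    have h3 := Real.log_le_log (by positivity) h2
    rw [Real.log_pow, Nat.cast_sub h] at h3
    have h4 := Real.log_two_gt_d9
    have h5 : (0 : ℝ) ≤ (Nat.clog 2 N : ℝ) - 1 := by
      have : (1 : ℝ) ≤ (Nat.clog 2 N : ℕ) := by exact_mod_cast h
      linarith
    push_cast at h3
    nlinarith

set_option maxHeartbeats 2000000 in
/-- On the event that the matrix is regular along a vertical grid, its eigenvalue counting function
is close to the distribution function of the free convolution. -/
theorem exists_eigCdf_bound (K : ℝ) : ∃ a Λ C₂ : ℝ, 0 < a ∧ 0 < Λ ∧ 0 < C₂ ∧ IsStabilityBound K a ∧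
    ∀ (N : ℕ) (lam q : ℝ) (A : Matrix (Fin (N + 1)) (Fin (N + 1)) ℝ) (hA : A.IsSymm) (E : ℝ),
      0 < N → Λ ≤ lam → lam ^ 3 ≤ q → q ^ 2 ≤ N → (∀ i, ∑ j, A i j = 0) → |E| ≤ K →
      (∀ k ≤ N ^ 7, RegularAt A (60 * weightConst a) lam q
        (vert E (lam ^ 3 / q + k * (1 / (N : ℝ) ^ 5)))) →
      |eigCdf hA E - freeCdf E| ≤ C₂ * (lam ^ 3 / q * (1 + Real.log N)) := by
  obtain ⟨c, hc, hcK⟩ := exists_subord_lower_bound K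
  set a := min c 1 with ha
  have ha0 : 0 < a := lt_min hc one_pos
  have ha1 : a ≤ 1 := min_le_right _ _
  have haK : IsStabilityBound K a := fun z h1 h2 =>
    ⟨(min_le_left _ _).trans (hcK z h1 h2).1, (min_le_left _ _).trans (hcK z h1 h2).2⟩
  set C := 60 * weightConst a with hC
  have hC0 : 0 ≤ C := by rw [hC, weightConst]; positivity
  set S := stabConst a C with hS
  have hS0 : 0 ≤ S := by rw [hS, stabConst]; positivity
  have hJ := absHalfMoment_nonneg 0
  have hG : 0 ≤ gaussAbsMean := integral_nonneg fun x => abs_nonneg x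
  set B₀ := 12 * S + (1 / a + 2) with hB₀
  have hB₀0 : 0 ≤ B₀ := by positivity
  set M := absHalfMoment 0 + B₀ with hM
  have hM0 : 0 ≤ M := by positivity
  set C₂ := 6 * M + 1 + absHalfMoment 0 + 3 * B₀ + (2 + |K|) +
    (gaussAbsMean + |K| + absHalfMoment 0 + 1) with hC₂
  -- The summands of Λ secure in turn ε ≤ 1/100, the smallness of the derivative error, the bound
  -- a⁴/16 after improvement, and, through λ ≤ N, both the grid step and the top height.
  refine ⟨a, 1200 + 4 * C / a ^ 2 + 192 * S / a ^ 4 + 16 * (1 / a + 2) / a ^ 4, C₂, ha0,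
    by positivity, by positivity, haK, ?_⟩
  clear_value C₂ M B₀ S C a
  intro N lam q A hA E hN hΛ hlq hqN h0 hE hreg
  rw [← hC] at hreg
  have hp1 : 0 ≤ 4 * C / a ^ 2 := by positivity
  have hp2 : 0 ≤ 192 * S / a ^ 4 := by positivity
  have hp3 : 0 ≤ 16 * (1 / a + 2) / a ^ 4 := by positivity
  have hlam : 1 ≤ lam := by linarith
  have hlam0 : 0 < lam := by linarith
  have hl3 : lam ≤ lam ^ 3 := le_self_pow₀ hlam (by norm_num)
  have hl2 : lam ≤ lam ^ 2 := le_self_pow₀ hlam (by norm_num)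
  have hl1 : lam ^ 2 ≤ lam ^ 3 := pow_le_pow_right₀ hlam (by norm_num)
  have hq : 1 ≤ q := by linarith
  have hq0 : 0 < q := by linarith
  have hN1 : (1 : ℝ) ≤ N := by exact_mod_cast hN
  have hN0 : (0 : ℝ) < N := by linarith
  have hqN' : q ≤ N := (le_self_pow₀ hq two_ne_zero).trans hqN
  have hΛN : lam ≤ N := by linarith
  have hlog : 0 ≤ Real.log N := Real.log_nonneg hN1
  -- At this lowest height the error parameter 12λ²/(qη) is 12/λ, which is small once λ is large.
  set η := lam ^ 3 / q with hη
  have hη0 : 0 < η := by positivity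
  have hη1 : η ≤ 1 := by rw [hη, div_le_one hq0]; exact hlq
  have hηq : 1 / q ≤ η := by
    rw [hη]
    have : 1 ≤ lam ^ 3 := one_le_pow₀ hlam
    gcongr
  have hinvN : 1 / (N : ℝ) ≤ η := (one_div_le_one_div_of_le hq0 hqN').trans hηq
  -- The Lipschitz constant is of order N, so a step changes the error by O(N⁻⁴). The N⁷ steps reach
  -- height N².
  set δ := 1 / (N : ℝ) ^ 5 with hδ
  have hδ0 : 0 < δ := by positivity
  have hqη : 12 * lam ^ 2 / (q * η) = 12 / lam := by rw [hη]; field_simp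
  have hL : (1 / η) ^ 2 + 1 / a + 1 ≤ (1 / a + 2) * N := by
    have h1 : 1 / η ≤ q := by rwa [one_div_le hη0 hq0]
    have h2 : (1 / η) ^ 2 ≤ N := (pow_le_pow_left₀ (by positivity) h1 2).trans hqN
    have h3 : 1 / a + 1 ≤ (1 / a + 1) * N := le_mul_of_one_le_right (by positivity) hN1
    linarith
  have hLδ : ((1 / η) ^ 2 + 1 / a + 1) * δ ≤ (1 / a + 2) / (N : ℝ) ^ 4 := by
    calc _ ≤ (1 / a + 2) * N * δ := by gcongr
      _ = _ := by rw [hδ]; field_simp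
  clear_value η δ
  have c1 : 12 * lam ^ 2 / (q * η) ≤ 1 / 100 := by
    rw [hqη, div_le_div_iff₀ hlam0 (by norm_num)]; linarith
  have c2 : C / a * (lam / q) ≤ a / 4 := by
    have h1 : 4 * C / a ^ 2 ≤ lam := by linarith
    rw [div_le_iff₀ (by positivity)] at h1
    have h2 : lam / q ≤ 1 / lam := by
      rw [div_le_div_iff₀ hq0 hlam0, one_mul, ← pow_two]
      exact hl1.trans hlq
    calc C / a * (lam / q) ≤ C / a * (1 / lam) := by gcongr
      _ ≤ a / 4 := by
        rw [div_mul_div_comm, mul_one, div_le_div_iff₀ (by positivity) (by norm_num)]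
        linarith
  have c3 : S * (12 * lam ^ 2 / (q * η)) ≤ a ^ 4 / 16 := by
    have h1 : 192 * S / a ^ 4 ≤ lam := by linarith
    rw [div_le_iff₀ (by positivity)] at h1
    rw [hqη, mul_div_assoc', div_le_div_iff₀ hlam0 (by norm_num)]
    linarith
  have hN4 : lam ≤ (N : ℝ) ^ 4 := hΛN.trans (le_self_pow₀ hN1 (by norm_num))
  have c4 : ((1 / η) ^ 2 + 1 / a + 1) * δ ≤ a ^ 4 / 16 := by
    refine hLδ.trans ?_
    have h1 : 16 * (1 / a + 2) / a ^ 4 ≤ (N : ℝ) ^ 4 := by linarith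
    rw [div_le_iff₀ (by positivity)] at h1
    rw [div_le_div_iff₀ (by positivity) (by norm_num)]
    linarith
  have hnδ : ((N ^ 7 : ℕ) : ℝ) * δ = (N : ℝ) ^ 2 := by
    rw [hδ]; push_cast; field_simp
  have c5 : 2 / (η + ((N ^ 7 : ℕ) : ℝ) * δ) ≤ a ^ 4 / 8 := by
    rw [hnδ]
    have h1 : 16 * (1 / a + 2) / a ^ 4 ≤ (N : ℝ) ^ 2 := by
      have : (N : ℝ) ≤ (N : ℝ) ^ 2 := le_self_pow₀ hN1 (by norm_num)
      linarith
    rw [div_le_iff₀ (by positivity)] at h1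
    have h2 : 0 < 1 / a := by positivity
    have h3 : 0 ≤ η * a ^ 4 := by positivity
    rw [div_le_div_iff₀ (by positivity) (by norm_num)]
    linarith
  have hlocal := fun {y : ℝ} (hy : η ≤ y) (hyn : y ≤ η + ((N ^ 7 : ℕ) : ℝ) * δ) =>
    local_law_of_regular hA hN ha0 ha1 hC0 haK hE hlam hq hqN hηq c1 c2 (hS ▸ c3) hδ0 c4 c5 hreg hy hyn
  rw [hnδ, ← hS] at hlocal
  have hYη : η ≤ (N : ℝ) ^ 2 := hη1.trans (one_le_pow₀ hN1)
  have hBl : ∀ y ∈ Set.Icc η ((N : ℝ) ^ 2),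
      ‖stieltjes A (vert E y) - freeStieltjes (vert E y)‖ ≤ B₀ * (lam ^ 2 / q) / y := by
    intro y hy
    have hy0 : 0 < y := hη0.trans_le hy.1
    refine (hlocal hy.1 (by linarith [hy.2])).trans ?_
    have h1 : (1 / a + 2) / (N : ℝ) ^ 4 ≤ (1 / a + 2) * (lam ^ 2 / q) / y := by
      rw [div_eq_mul_one_div, mul_div_assoc]
      refine mul_le_mul_of_nonneg_left ?_ (by positivity)
      rw [le_div_iff₀ hy0, one_div_mul_eq_div, div_le_div_iff₀ (by positivity) hq0]
      have hN2 : 0 < (N : ℝ) ^ 2 := by positivity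
      calc y * q ≤ (N : ℝ) ^ 2 * (N : ℝ) := mul_le_mul hy.2 hqN' hq0.le hN2.le
        _ ≤ (N : ℝ) ^ 4 := by
          rw [← pow_succ]; exact pow_le_pow_right₀ hN1 (by norm_num)
        _ ≤ lam ^ 2 * (N : ℝ) ^ 4 := le_mul_of_one_le_left (by positivity) (by linarith)
    have e : B₀ * (lam ^ 2 / q) / y = S * (12 * lam ^ 2 / (q * y)) +
        (1 / a + 2) * (lam ^ 2 / q) / y := by
      rw [hB₀]; field_simp
    rw [e]
    linarith
  have hlq1 : lam ^ 2 / q ≤ η := by rw [hη]; gcongr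
  -- The crude bound 2N suffices because it is divided by the top height N².
  have hR : ∀ i, |(isHermitian_of_isSymm hA).eigenvalues i| ≤ 2 * N := by
    refine abs_eigenvalues_le _ fun i => ?_
    have hlq' : lam / q ≤ 1 := by rw [div_le_one hq0]; linarith
    refine (sum_abs_row_le h0 (hreg 0 (Nat.zero_le _)).entry i).trans ?_
    exact mul_le_mul_of_nonneg_left (mul_le_of_le_one_right hN0.le hlq') zero_le_two
  -- With 2ᵐ ≥ N the leftover weight is at most 1/N ≤ η, while for k < m the heights 2ᵏη remain
  -- below N² and hence within the local law.
  set m := Nat.clog 2 N with hm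
  have hMk : ∀ k < m, (stieltjes A (vert E (2 ^ k * η))).im ≤ M := by
    intro k hk
    have h1 : 2 ^ k < N := (Nat.lt_clog_iff_pow_lt one_lt_two).1 hk
    have h2 : (2 : ℝ) ^ k ≤ N := by exact_mod_cast h1.le
    have h3 : (1 : ℝ) ≤ 2 ^ k := one_le_pow₀ (by norm_num)
    have hy1 : η ≤ 2 ^ k * η := le_mul_of_one_le_left hη0.le h3
    have hy2 : 2 ^ k * η ≤ (N : ℝ) ^ 2 := by
      calc 2 ^ k * η ≤ N * 1 := by gcongr
        _ ≤ _ := by rw [mul_one]; exact le_self_pow₀ hN1 (by norm_num)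
    have h4 := hBl _ ⟨hy1, hy2⟩
    have h5 : B₀ * (lam ^ 2 / q) / (2 ^ k * η) ≤ B₀ := by
      rw [div_le_iff₀ (by positivity)]
      exact mul_le_mul_of_nonneg_left (hlq1.trans hy1) hB₀0
    have h6 := norm_freeStieltjes_le (z := vert E (2 ^ k * η)) (by simpa using by positivity)
    have h7 := (le_abs_self _).trans (Complex.abs_im_le_norm (stieltjes A (vert E (2 ^ k * η))))
    have h8 := norm_sub_norm_le (stieltjes A (vert E (2 ^ k * η))) (freeStieltjes (vert E (2 ^ k * η)))
    linarith
  have main := abs_eigCdf_sub_freeCdf_le hA hη0 hYη (one_le_pow₀ hN1) hBl hR m hMk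
  refine main.trans ?_
  set T := η * (1 + Real.log N) with hT
  have hηT : η ≤ T := le_mul_of_one_le_right hη0.le (by linarith)
  have hT0 : 0 ≤ T := hη0.le.trans hηT
  have t1 : 3 * η * M * m ≤ 6 * M * T := by
    have := clog_le hN
    have h2 : (m : ℝ) ≤ 2 * (1 + Real.log N) := by linarith
    calc 3 * η * M * m ≤ 3 * η * M * (2 * (1 + Real.log N)) := by gcongr
      _ = _ := by rw [hT]; ring
  have t2 : (1 / 2 : ℝ) ^ m ≤ 1 * T := by
    have h1 : (N : ℝ) ≤ 2 ^ m := by exact_mod_cast Nat.le_pow_clog one_lt_two N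
    rw [one_div_pow, one_mul]
    exact ((one_div_le_one_div_of_le hN0 h1).trans hinvN).trans hηT
  have t3 : absHalfMoment 0 * η ≤ absHalfMoment 0 * T := by gcongr
  have t4 : B₀ * (lam ^ 2 / q) * Real.log ((N : ℝ) ^ 2 / η) ≤ 3 * B₀ * T := by
    have h1 : Real.log ((N : ℝ) ^ 2 / η) ≤ 3 * Real.log N := by
      have h2 : (N : ℝ) ^ 2 / η ≤ (N : ℝ) ^ 3 := by
        rw [div_le_iff₀ hη0]
        have h3 : 1 ≤ N * η := by
          rw [div_le_iff₀ hN0] at hinvN; linarith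
        calc (N : ℝ) ^ 2 = (N : ℝ) ^ 2 * 1 := (mul_one _).symm
          _ ≤ (N : ℝ) ^ 2 * (N * η) := by gcongr
          _ = _ := by ring
      have := Real.log_le_log (by positivity) h2
      rwa [Real.log_pow] at this
    calc B₀ * (lam ^ 2 / q) * Real.log ((N : ℝ) ^ 2 / η) ≤ B₀ * η * (3 * Real.log N) := by
          gcongr
          exact Real.log_nonneg (by rw [one_le_div hη0]; exact hYη)
      _ ≤ B₀ * η * (3 * (1 + Real.log N)) := by gcongr; linarith
      _ = _ := by rw [hT]; ring
  have hEK : |E| ≤ |K| := hE.trans (le_abs_self K)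
  have hN2 : 1 / (N : ℝ) ^ 2 ≤ T := by
    refine le_trans ?_ (hinvN.trans hηT)
    exact one_div_le_one_div_of_le hN0 (le_self_pow₀ hN1 (by norm_num))
  have t5 : (2 * N + |E|) / (N : ℝ) ^ 2 ≤ (2 + |K|) * T := by
    have e : (2 * N + |E|) / (N : ℝ) ^ 2 = 2 * (1 / N) + |E| * (1 / (N : ℝ) ^ 2) := by
      field_simp
    rw [e, add_mul]
    gcongr
    exact hinvN.trans hηT
  have t6 : (gaussAbsMean + (|E| + absHalfMoment 0) + 1) / (N : ℝ) ^ 2 ≤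
      (gaussAbsMean + |K| + absHalfMoment 0 + 1) * T := by
    rw [div_eq_mul_one_div]
    exact mul_le_mul (by linarith) hN2 (by positivity) (by positivity)
  have e : C₂ * T = 6 * M * T + 1 * T + absHalfMoment 0 * T + 3 * B₀ * T + (2 + |K|) * T +
    (gaussAbsMean + |K| + absHalfMoment 0 + 1) * T := by rw [hC₂]; ring
  rw [e]
  linarith

end Assembly

end LaplacianRigidity
end

/-! ### From distribution functions to rigidity. -/

noncomputable section
namespace LaplacianRigidity

section Rigidity

lemma exists_rhofc_lower_bound (K : ℝ) : ∃ c₀ : ℝ, 0 < c₀ ∧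
    ∀ x y, -K ≤ x → x ≤ y → y ≤ K → c₀ * (y - x) ≤ freeCdf y - freeCdf x := by
  obtain ⟨x₀, -, hx₀⟩ := (isCompact_Icc (a := -|K|) (b := |K|)).exists_isMinOn
    (Set.nonempty_Icc.2 (by linarith [abs_nonneg K])) continuous_rhofc.continuousOn
  refine ⟨rhofc x₀, rhofc_pos x₀, fun x y hx hxy hy => ?_⟩
  have hK := le_abs_self K
  refine (convex_Icc (-|K|) |K|).mul_sub_le_image_sub_of_le_deriv
    continuous_freeCdf.continuousOn
    (fun u _ => (hasDerivAt_freeCdf u).differentiableAt.differentiableWithinAt)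
    (fun u hu => ?_) x ⟨by linarith, by linarith⟩ y ⟨by linarith, by linarith⟩ hxy
  rw [(hasDerivAt_freeCdf u).deriv]
  exact hx₀ (interior_subset hu)

/-- The condition κN ≥ 1 gives (i - 1/2)/N ≥ κ/2, so the quantile levels stay in [κ/2, 1 - κ] and
strict monotonicity confines the locations to a fixed interval. The extra 1 leaves room for the
shift by s. -/
lemma exists_classicalLocation_bound {κ : ℝ} (hκ : 0 < κ) : ∃ K : ℝ, 1 ≤ K ∧
    ∀ N i : ℕ, 1 / κ ≤ N → κ * N ≤ i → (i : ℝ) ≤ (1 - κ) * N →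
      freeCdf (classicalLocation N i) = ((i : ℝ) - 1 / 2) / N ∧ |classicalLocation N i| + 1 ≤ K := by
  obtain ⟨x₀, hx₀⟩ := (tendsto_freeCdf_atBot.eventually_lt_const (half_pos hκ)).exists
  obtain ⟨x₁, hx₁⟩ := (tendsto_freeCdf_atTop.eventually_const_lt (u := 1 - κ)
    (by linarith)).exists
  refine ⟨max |x₀| |x₁| + 1, by linarith [abs_nonneg x₀, le_max_left |x₀| |x₁|], ?_⟩
  intro N i hN h1 h2
  have hN0 : (0 : ℝ) < N := lt_of_lt_of_le (by positivity) hN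
  have hκN : 1 ≤ κ * N := by rw [div_le_iff₀ hκ] at hN; linarith
  have hlow : κ / 2 ≤ ((i : ℝ) - 1 / 2) / N := by
    rw [le_div_iff₀ hN0]; linarith
  have hup : ((i : ℝ) - 1 / 2) / N ≤ 1 - κ := by
    rw [div_le_iff₀ hN0]; linarith
  have hγ := freeCdf_classicalLocation (N := N) (i := i) (by linarith) (by linarith)
  refine ⟨hγ, ?_⟩
  have g0 : x₀ < classicalLocation N i := strictMono_freeCdf.lt_iff_lt.1 (by linarith)
  have g1 : classicalLocation N i < x₁ := strictMono_freeCdf.lt_iff_lt.1 (by linarith)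
  have : |classicalLocation N i| ≤ max |x₀| |x₁| := by
    rw [abs_le]
    constructor
    · linarith [neg_abs_le x₀, le_max_left |x₀| |x₁|]
    · linarith [le_abs_self x₁, le_max_right |x₀| |x₁|]
  linarith

variable {N : ℕ}

/-- Closeness of distribution functions at `γ ± s` locates the eigenvalue near `γ`. -/
lemma abs_nontrivialEigenvalue_sub_le {A : Matrix (Fin (N + 1)) (Fin (N + 1)) ℝ} (hA : A.IsSymm)
    (h0 : ∀ i, ∑ j, A i j = 0) {i : ℕ} (hi : 1 ≤ i) (hiN : i ≤ N) {γ s err c₀ : ℝ}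
    (hγ : freeCdf γ = ((i : ℝ) - 1 / 2) / N) (herr : err + 2 / N ≤ c₀ * s)
    (hup : c₀ * s ≤ freeCdf (γ + s) - freeCdf γ) (hlow : c₀ * s ≤ freeCdf γ - freeCdf (γ - s))
    (hu : |eigCdf hA (γ + s) - freeCdf (γ + s)| ≤ err)
    (hl : |eigCdf hA (γ - s) - freeCdf (γ - s)| ≤ err) :
    |nontrivialEigenvalue A i - γ| ≤ s := by
  have hN0 : (0 : ℝ) < N := by exact_mod_cast hi.trans hiN
  have hiN' : (i : ℝ) ≤ N := by exact_mod_cast hiN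
  have hi' : (1 : ℝ) ≤ i := by exact_mod_cast hi
  -- The margin 2/N pays for the half index, the removed zero, and the passage between N + 1
  -- eigenvalues and normalization by N.
  have e1 : ((i : ℝ) - 1 / 2) / N + 2 / N = (i + 3 / 2) / N := by ring
  have e2 : ((i : ℝ) - 1 / 2) / N - 2 / N = (i - 5 / 2) / N := by ring
  have h1 : ((i : ℝ) + 3 / 2) / N ≤ eigCdf hA (γ + s) := by
    have := (abs_le.1 hu).1
    linarith
  have h2 : eigCdf hA (γ - s) ≤ ((i : ℝ) - 5 / 2) / N := by
    have := (abs_le.1 hl).2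
    linarith
  have b1 := (nontrivialEigenvalue_bounds hA h0 hi hiN (γ + s)).1 (by
    rw [div_le_iff₀ hN0] at h1
    have : ((i : ℝ) + 3 / 2) / N ≥ 0 := by positivity
    have h3 : 0 ≤ eigCdf hA (γ + s) := by
      rw [← div_le_iff₀ hN0] at h1; linarith
    linarith)
  have b2 := (nontrivialEigenvalue_bounds hA h0 hi hiN (γ - s)).2 (by
    have h3 : ((i : ℝ) - 5 / 2) / N < 1 := by
      rw [div_lt_one hN0]; linarith
    rw [le_div_iff₀ hN0] at h2
    have h4 : eigCdf hA (γ - s) < 1 := by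
      rw [← le_div_iff₀ hN0] at h2; linarith
    linarith)
  rw [abs_le]
  constructor <;> linarith

/-- The thresholds in `N` needed for rigidity. -/
lemma exists_rigidity_threshold {α ν κ Λ C₂ c₀ R : ℝ} (hα : 0 < α) (hν : 0 < ν) (hC₂ : 0 < C₂)
    (hc₀ : 0 < c₀) (h3 : 3 * α = ν / 2) : ∃ N₀ : ℕ, ∀ N : ℕ, N₀ ≤ N → 1 ≤ N ∧ Λ ≤ (N : ℝ) ^ α ∧
      1 / κ ≤ N ∧ R ≤ N ∧
      C₂ * (((N : ℝ) ^ α) ^ 3 * (1 + Real.log N)) + 2 ≤ c₀ * ((N : ℝ) ^ ν) ^ 2 := by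
  have hcast := tendsto_natCast_atTop_atTop (R := ℝ)
  have t1 := ((tendsto_rpow_atTop hα).comp hcast).eventually_ge_atTop Λ
  have t2 := ((tendsto_rpow_atTop hν).comp hcast).eventually_ge_atTop
    ((C₂ * (1 + 1 / (ν / 2)) + 2) / c₀)
  have t3 := hcast.eventually_ge_atTop (1 / κ)
  have t4 := hcast.eventually_ge_atTop R
  have t5 := eventually_ge_atTop 1
  obtain ⟨N₀, hN₀⟩ := eventually_atTop.1 (t1.and (t2.and (t3.and (t4.and t5))))
  refine ⟨N₀, fun N hN => ?_⟩
  obtain ⟨h1, h2, h3', h4, h5⟩ := hN₀ N hN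
  simp only [Function.comp] at h1 h2
  refine ⟨h5, h1, h3', h4, ?_⟩
  have hN1 : (1 : ℝ) ≤ N := by exact_mod_cast h5
  have hN0 : (0 : ℝ) ≤ N := by linarith
  have e1 : ((N : ℝ) ^ α) ^ 3 = (N : ℝ) ^ (ν / 2) := by
    rw [← Real.rpow_natCast, ← Real.rpow_mul hN0]
    congr 1; push_cast; linarith
  -- One factor N^{ν/2} is λ³ and the other dominates log N. Against N^{2ν} a factor N^ν remains to
  -- absorb all constants.
  have e2 : (N : ℝ) ^ (ν / 2) * (N : ℝ) ^ (ν / 2) = (N : ℝ) ^ ν := by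
    rw [← Real.rpow_add (by linarith)]; congr 1; ring
  have hx1 : 1 ≤ (N : ℝ) ^ (ν / 2) := Real.one_le_rpow hN1 (by positivity)
  have hv1 : 1 ≤ (N : ℝ) ^ ν := Real.one_le_rpow hN1 hν.le
  have hlog : Real.log N ≤ (N : ℝ) ^ (ν / 2) / (ν / 2) := Real.log_le_rpow_div hN0 (by positivity)
  set x := (N : ℝ) ^ (ν / 2)
  set v := (N : ℝ) ^ ν
  rw [e1]
  have hl : 1 + Real.log N ≤ (1 + 1 / (ν / 2)) * x := by
    have : x / (ν / 2) = 1 / (ν / 2) * x := by ring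
    linarith
  rw [div_le_iff₀ hc₀] at h2
  calc C₂ * (x * (1 + Real.log N)) + 2 ≤ C₂ * (x * ((1 + 1 / (ν / 2)) * x)) + 2 * v := by
        gcongr
        linarith
    _ = (C₂ * (1 + 1 / (ν / 2)) + 2) * v := by rw [← e2]; ring
    _ ≤ v * c₀ * v := by gcongr
    _ = _ := by ring

lemma IsRandomLaplacianType.sum_row_eq_zero {Ω : Type*} [MeasurableSpace Ω] {μ : Measure Ω}
    {β q : ℝ} {c : ℕ → ℝ} {H : Ω → Matrix (Fin (N + 1)) (Fin (N + 1)) ℝ}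
    (hH : IsRandomLaplacianType μ N β q c H) (ω : Ω) (i : Fin (N + 1)) : ∑ j, H ω i j = 0 := by
  rw [← Finset.add_sum_erase _ _ (Finset.mem_univ i), hH.diag ω i, neg_add_cancel]

/-- At most 8N⁸ grid points times (N + 1)² ≤ 4N² gives 32N¹⁰; the exponent 11 leaves one power of N
to absorb R. -/
lemma union_bound_le {α D R : ℝ} {p : ℕ} (hN : 1 ≤ N) (hR : 0 ≤ R) (hRN : 32 * R ≤ N)
    (hp : D + 11 ≤ 2 * p * α) {n : ℕ} (hn : n ≤ (N + 1) * 2 * (N ^ 7 + 1)) :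
    n * (((N : ℝ) + 1) ^ 2 * (R / ((N : ℝ) ^ α) ^ (2 * p))) ≤ (N : ℝ) ^ (-D) := by
  have hN1 : (1 : ℝ) ≤ N := by exact_mod_cast hN
  have hN0 : (0 : ℝ) < N := by linarith
  have h7 : (1 : ℝ) ≤ (N : ℝ) ^ 7 := one_le_pow₀ hN1
  have hn' : (n : ℝ) ≤ (2 * N) * 2 * (2 * (N : ℝ) ^ 7) := by
    have : (n : ℝ) ≤ (N + 1) * 2 * ((N : ℝ) ^ 7 + 1) := by exact_mod_cast hn
    refine this.trans ?_
    gcongr <;> linarith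
  have e1 : ((N : ℝ) ^ α) ^ (2 * p) = (N : ℝ) ^ (2 * p * α) := by
    rw [← Real.rpow_natCast, ← Real.rpow_mul hN0.le]
    congr 1; push_cast; ring
  have h2 : (N : ℝ) ^ (D + 11) ≤ (N : ℝ) ^ (2 * p * α) := Real.rpow_le_rpow_of_exponent_le hN1 hp
  have e2 : (N : ℝ) ^ (D + 11) = (N : ℝ) ^ D * (N : ℝ) ^ 11 := by
    rw [Real.rpow_add hN0]; norm_cast
  have hD : 0 < (N : ℝ) ^ D := by positivity
  have hs : ((N : ℝ) + 1) ^ 2 ≤ (2 * N) ^ 2 := by gcongr; linarith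
  rw [e1, Real.rpow_neg hN0.le]
  calc n * (((N : ℝ) + 1) ^ 2 * (R / (N : ℝ) ^ (2 * p * α))) ≤
      ((2 * N) * 2 * (2 * (N : ℝ) ^ 7)) * ((2 * N) ^ 2 * (R / ((N : ℝ) ^ D * (N : ℝ) ^ 11))) := by
        rw [← e2]; gcongr
    _ = (32 * R) / N * ((N : ℝ) ^ D)⁻¹ := by field_simp; ring
    _ ≤ 1 * ((N : ℝ) ^ D)⁻¹ := by
        gcongr
        rw [div_le_one hN0]; exact hRN
    _ = _ := one_mul _

end Rigidity

end LaplacianRigidity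
end

/-! ### Choice of exponents and conclusion. -/

theorem mainTheorem2 (β : ℝ) (hβ : 0 < β) (c : ℕ → ℝ) (κ : ℝ) (hκ : 0 < κ) :
    ∃ C : ℝ, 0 < C ∧ ∀ ν : ℝ, 0 < ν → ∀ D : ℝ, 0 < D → ∃ N₀ : ℕ, ∀ N : ℕ, N₀ ≤ N →
      ∀ (Ω : Type*) [MeasurableSpace Ω] (μ : Measure Ω) [IsProbabilityMeasure μ] (q : ℝ)
        (H : Ω → Matrix (Fin (N + 1)) (Fin (N + 1)) ℝ),
        LaplacianRigidity.IsRandomLaplacianType μ N β q c H →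
          1 - (N : ℝ) ^ (-D) ≤
            μ.real {ω | ∀ i : ℕ, κ * N ≤ i → (i : ℝ) ≤ (1 - κ) * N →
              |LaplacianRigidity.nontrivialEigenvalue (H ω) i -
                LaplacianRigidity.classicalLocation N i| ≤ C * ((N : ℝ) ^ ν) ^ 2 / q} := by
  open LaplacianRigidity in
  obtain ⟨K, hK1, hKγ⟩ := exists_classicalLocation_bound hκ
  obtain ⟨c₀, hc₀, hcdf⟩ := exists_rhofc_lower_bound K
  obtain ⟨a, Λ, C₂, ha, hΛ, hC₂, hstab, hmain⟩ := exists_eigCdf_bound K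
  -- The constant 1 suffices, because powers of N absorb the others.
  refine ⟨1, one_pos, fun ν₀ hν₀ D hD => ?_⟩
  -- A smaller exponent proves a stronger bound. The cap β/4 gives N^{2ν} ≤ N^{β/2} ≤ q, so the
  -- shift s is at most 1, and also λ³ = N^{ν/2} ≤ q.
  set ν := min ν₀ (β / 4) with hνdef
  have hν : 0 < ν := lt_min hν₀ (by positivity)
  have hνβ : ν ≤ β / 4 := min_le_right _ _
  set α := ν / 6 with hα
  have hα0 : 0 < α := by positivity
  obtain ⟨p, hp⟩ := exists_nat_ge ((D + 11) / (2 * α))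
  have hp' : D + 11 ≤ 2 * p * α := by
    rw [div_le_iff₀ (by positivity)] at hp; linarith
  have hp1 : 1 ≤ p := by
    by_contra h
    have : p = 0 := by omega
    rw [this] at hp'
    push_cast at hp'
    linarith
  have hm : ∀ r, 0 ≤ entryConst c r := fun r => by unfold entryConst; positivity
  set R := regularConst (entryConst c) p with hR
  have hR0 : 0 ≤ R := regularConst_nonneg hm p
  obtain ⟨N₀, hN₀⟩ := exists_rigidity_threshold (κ := κ) (Λ := max Λ 1) (R := 32 * R) hα0 hν hC₂
    hc₀ (by rw [hα]; ring)
  refine ⟨N₀, fun N hN Ω _ μ _ q H hH => ?_⟩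
  obtain ⟨hN1, hΛN, hκN, hRN, hbig⟩ := hN₀ N hN
  have hNpos : 0 < N := hN1
  have hN1' : (1 : ℝ) ≤ N := by exact_mod_cast hN1
  have hN0' : (0 : ℝ) < N := by linarith
  have hq := hH.one_le_q hNpos hβ
  have hq0 : 0 < q := by linarith
  have hqN := hH.q_sq_le hNpos
  set lam := (N : ℝ) ^ α with hlamdef
  have hlam1 : 1 ≤ lam := (le_max_right _ _).trans hΛN
  have hlamΛ : Λ ≤ lam := (le_max_left _ _).trans hΛN
  have hl3 : lam ^ 3 ≤ q := by
    refine le_trans ?_ hH.le_sparsity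
    rw [hlamdef, ← Real.rpow_natCast, ← Real.rpow_mul hN0'.le]
    refine Real.rpow_le_rpow_of_exponent_le hN1' ?_
    push_cast
    rw [hα]
    linarith
  have hlq : lam ≤ q := (le_self_pow₀ hlam1 (by norm_num)).trans hl3
  set s := ((N : ℝ) ^ ν) ^ 2 / q with hs
  have hs0 : 0 ≤ s := by positivity
  have hs1 : s ≤ 1 := by
    rw [hs, div_le_one hq0]
    refine le_trans ?_ hH.le_sparsity
    rw [← Real.rpow_natCast, ← Real.rpow_mul hN0'.le]
    refine Real.rpow_le_rpow_of_exponent_le hN1' ?_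
    push_cast
    linarith
  have hsle : s ≤ 1 * ((N : ℝ) ^ ν₀) ^ 2 / q := by
    rw [one_mul, hs]
    have : (N : ℝ) ^ ν ≤ (N : ℝ) ^ ν₀ := Real.rpow_le_rpow_of_exponent_le hN1' (min_le_left _ _)
    gcongr
  have herr : C₂ * (lam ^ 3 / q * (1 + Real.log N)) + 2 / N ≤ c₀ * s := by
    have h1 : 2 / (N : ℝ) ≤ 2 / q := by
      gcongr
      exact (le_self_pow₀ hq two_ne_zero).trans hqN
    calc _ ≤ C₂ * (lam ^ 3 / q * (1 + Real.log N)) + 2 / q := by linarith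
      _ = (C₂ * (lam ^ 3 * (1 + Real.log N)) + 2) / q := by ring
      _ ≤ (c₀ * ((N : ℝ) ^ ν) ^ 2) / q := by gcongr
      _ = _ := by rw [hs]; ring
  -- Only the energies γ_i ± s with i in the bulk are needed, each with its vertical grid.
  set pt : (ℕ × Bool) × ℕ → ℂ := fun x => vert
    (classicalLocation N x.1.1 + (if x.1.2 then s else -s))
    (lam ^ 3 / q + x.2 * (1 / (N : ℝ) ^ 5)) with hpt
  set t : Finset ((ℕ × Bool) × ℕ) :=
    (((Finset.range (N + 1)).filter fun i : ℕ => κ * N ≤ (i : ℝ) ∧ (i : ℝ) ≤ (1 - κ) * N) ×ˢ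
      Finset.univ) ×ˢ Finset.range (N ^ 7 + 1) with ht
  have hcard : t.card ≤ (N + 1) * 2 * (N ^ 7 + 1) := by
    rw [ht, Finset.card_product, Finset.card_product, Finset.card_range, Finset.card_univ,
      Fintype.card_bool]
    gcongr
    exact (Finset.card_filter_le _ _).trans_eq (Finset.card_range _)
  have hEK : ∀ (i : ℕ) (b : Bool), κ * N ≤ i → (i : ℝ) ≤ (1 - κ) * N →
      |classicalLocation N i + (if b then s else -s)| ≤ K := by
    intro i b h1 h2
    have h3 := (hKγ N i hκN h1 h2).2
    have h4 := abs_add_le (classicalLocation N i) (if b then s else -s)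
    have h5 : |(if b then s else -s)| ≤ 1 := by
      cases b <;> simp [abs_of_nonneg hs0, hs1]
    linarith
  have hpim : ∀ x, 1 / q ≤ (pt x).im := by
    intro x
    rw [hpt, vert_im]
    have h1 : 1 / q ≤ lam ^ 3 / q := by
      gcongr
      exact one_le_pow₀ hlam1
    have h2 : 0 ≤ (x.2 : ℝ) * (1 / (N : ℝ) ^ 5) := by positivity
    linarith
  have hbad := hH.measureReal_not_forall_regularAt_le hNpos hq ha t pt (fun x _ => hpim x)
    (fun x hx => by
      simp only [ht, Finset.mem_product, Finset.mem_filter] at hx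
      refine (hstab (pt x) ?_ (le_trans (by positivity) (hpim x))).1
      rw [hpt, vert_re]
      exact hEK _ _ hx.1.1.2.1 hx.1.1.2.2) p hp1 hlam1 hlq
  have hbad' := hbad.trans (union_bound_le hN1 hR0 hRN hp' hcard)
  set bad : Set Ω := {ω | ¬ ∀ x ∈ t, RegularAt (H ω) (60 * weightConst a) lam q (pt x)} with hbaddef
  -- Covering the whole space by the target event and the bad event and using subadditivity avoids
  -- any measurability question for the target.
  have hsub : (Set.univ : Set Ω) ⊆ {ω | ∀ i : ℕ, κ * N ≤ i → (i : ℝ) ≤ (1 - κ) * N →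
      |nontrivialEigenvalue (H ω) i - classicalLocation N i| ≤
        1 * ((N : ℝ) ^ ν₀) ^ 2 / q} ∪ bad := by
    intro ω _
    by_cases hω : ω ∈ bad
    · exact Or.inr hω
    · left
      rw [hbaddef, Set.mem_ofPred_eq, not_not] at hω
      intro i h1 h2
      have hi0 : 0 < κ * N := by positivity
      have hi1 : 1 ≤ i := by
        have : (0 : ℝ) < i := hi0.trans_le h1
        exact_mod_cast this
      have hiN : i ≤ N := by
        have : (i : ℝ) ≤ N := by linarith
        exact_mod_cast this
      obtain ⟨hγ, hγK⟩ := hKγ N i hκN h1 h2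
      have hγ' := abs_le.1 (show |classicalLocation N i| ≤ K - 1 by linarith)
      have hcdfE : ∀ b : Bool, |eigCdf (hH.isSymm ω)
          (classicalLocation N i + (if b then s else -s)) -
          freeCdf (classicalLocation N i + (if b then s else -s))| ≤
            C₂ * (lam ^ 3 / q * (1 + Real.log N)) := by
        intro b
        refine hmain N lam q (H ω) (hH.isSymm ω) _ hNpos hlamΛ hl3 hqN (hH.sum_row_eq_zero ω)
          (hEK i b h1 h2) fun k hk => ?_
        refine hω ((i, b), k) ?_
        simp only [ht, Finset.mem_product, Finset.mem_filter, Finset.mem_range, Finset.mem_univ,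
          and_true]
        exact ⟨⟨by omega, h1, h2⟩, by omega⟩
      refine (abs_nontrivialEigenvalue_sub_le (hH.isSymm ω) (hH.sum_row_eq_zero ω) hi1 hiN hγ herr
        ?_ ?_ (by simpa using hcdfE true) (by simpa [← sub_eq_add_neg] using hcdfE false)).trans hsle
      · have := hcdf (classicalLocation N i) (classicalLocation N i + s) (by linarith)
          (by linarith) (by linarith)
        rwa [add_sub_cancel_left] at this
      · have := hcdf (classicalLocation N i - s) (classicalLocation N i) (by linarith)
          (by linarith) (by linarith)
        rwa [sub_sub_cancel] at this
  have h1 := (measureReal_mono (μ := μ) hsub).trans (measureReal_union_le _ _)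
  rw [probReal_univ] at h1
  linarith
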